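/- Let $(M,\omega)$ be a connected (not necessarily compact) symplectic manifold without boundary, and let $\mathrm{Ham}^c(M)$ be its group of compactly supported Hamiltonian symplectomorphisms. For a smooth function $F$ let $X_F$ be the vector field with $\omega(X_F,\cdot)=dF$, and for compactly supported $F$ let $\phi_F$ denote the time-one map of the flow of $X_F$. Let $\gamma=\{\phi_t\}_{0\le t\le 1}$ be a smooth path in $\mathrm{Ham}^c(M)$, with $\phi_0\in \mathrm{Ham}^c(M)$ arbitrary, generated by the smooth family $H_t$, $0\le t\le 1$, of functions supported in a common compact subset of $M$; that is, $\frac{d}{dt}\phi_t(x)=X_{H_t}(\phi_t(x))$ for all $x\in M$ and $t\in[0,1]$. ($H_t$ is determined by $\gamma$ up to adding constants depending on $t$.) Its length is $$\mathcal L(\gamma)=\int_0^1\Bigl(\sup_M H_t-\inf_M H_t\Bigr)\,dt .$$ A tangent vector field along $\gamma$ is a smooth family $\{G_t\}_{0\le t\le1}$ of functions on $M$, supported in a common compact set, with $G_0=G_1=0$; it defines the paths $\gamma_\varepsilon=\{\phi_{\varepsilon G_t}\circ\phi_t\}_{0\le t\le 1}$, where for each fixed $t$, $\phi_{\varepsilon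 G_t}$ is the time-one map of the flow of the function $\varepsilon G_t$. The path $\gamma$ is called $\mathcal L$-critical if for every such $\{G_t\}$ there are $\delta>0$ and a smooth function $f:(-\delta,\delta)\to\mathbf R$ with $f(0)=\mathcal L(\gamma)$, $f'(0)=0$ and $f(\varepsilon)\le\mathcal L(\gamma_\varepsilon)$ for all $|\varepsilon|<\delta$. **Theorem.** The path $\gamma$ is $\mathcal L$-critical if and only if $H_t$ has at least one fixed minimum and at least one fixed maximum, i.e. there are points $p,P\in M$ such that $H_t(p)=\min_M H_t$ and $H_t(P)=\max_M H_t$ for all $t\in[0,1]$. -/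

import Mathlib

open Set MeasureTheory
open scoped Manifold ContDiff

noncomputable section HoferGeometry

variable {E : Type*} [NormedAddCommGroup E] [NormedSpace ℝ E]
variable {M : Type*} [TopologicalSpace M] [ChartedSpace E M]

/-- The expression in a chart `e` of a field `form` of alternating two-forms on `M`, i.e. the
pull-back of `form` under `e.symm`; meaningful on `e.target`. -/
def chartForm (form : ∀ x : M, TangentSpace 𝓘(ℝ, E) x [⋀^Fin 2]→L[ℝ] ℝ)
    (e : OpenPartialHomeomorph M E) (y : E) : E [⋀^Fin 2]→L[ℝ] ℝ :=
  (form (e.symm y)).compContinuousLinearMap (mfderiv 𝓘(ℝ, E) 𝓘(ℝ, E) e.symm y)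

variable (E M) in
/-- A symplectic form on `M`: a smooth closed nondegenerate two-form. Smoothness and closedness are
expressed in the charts of the atlas. -/
structure SymplecticForm where
  form : ∀ x : M, TangentSpace 𝓘(ℝ, E) x [⋀^Fin 2]→L[ℝ] ℝ
  smooth : ∀ e ∈ atlas E M, ContDiffOn ℝ ∞ (chartForm form e) e.target
  closed : ∀ e ∈ atlas E M, ∀ y ∈ e.target, extDeriv (chartForm form e) y = 0
  nondegenerate : ∀ (x : M) (v : TangentSpace 𝓘(ℝ, E) x),
    (∀ w : TangentSpace 𝓘(ℝ, E) x, form x ![v, w] = 0) → v = 0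

namespace SymplecticForm

/-- The bilinear form `(v, w) ↦ Ω_x (v, w)` on the tangent space at `x`. -/
def bilin (Ω : SymplecticForm E M) (x : M) :
    LinearMap.BilinForm ℝ (TangentSpace 𝓘(ℝ, E) x) :=
  have h₀ (v w u : TangentSpace 𝓘(ℝ, E) x) : Function.update ![v, w] 0 u = ![u, w] := by
    ext i; fin_cases i <;> rfl
  have h₁ (v w u : TangentSpace 𝓘(ℝ, E) x) : Function.update ![v, w] 1 u = ![v, u] := by
    ext i; fin_cases i <;> rfl
  LinearMap.mk₂ ℝ (fun v w => Ω.form x ![v, w])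
    (fun v v' w => by
      have h := (Ω.form x).toAlternatingMap.map_update_add ![v, w] 0 v v'
      rwa [h₀, h₀, h₀] at h)
    (fun c v w => by
      have h := (Ω.form x).toAlternatingMap.map_update_smul ![v, w] 0 c v
      rwa [h₀, h₀] at h)
    (fun v w w' => by
      have h := (Ω.form x).toAlternatingMap.map_update_add ![v, w] 1 w w'
      rwa [h₁, h₁, h₁] at h)
    (fun c v w => by
      have h := (Ω.form x).toAlternatingMap.map_update_smul ![v, w] 1 c w
      rwa [h₁, h₁] at h)

theorem bilin_apply (Ω : SymplecticForm E M) (x : M) (v w : TangentSpace 𝓘(ℝ, E) x) :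
    Ω.bilin x v w = Ω.form x ![v, w] := rfl

theorem bilin_swap (Ω : SymplecticForm E M) (x : M) (v w : TangentSpace 𝓘(ℝ, E) x) :
    Ω.bilin x v w = - Ω.bilin x w v := by
  rw [bilin_apply, bilin_apply]
  have h := (Ω.form x).toAlternatingMap.map_swap ![w, v] (i := 0) (j := 1) (by decide)
  have e : (![w, v] ∘ Equiv.swap (0 : Fin 2) 1) = ![v, w] := by
    ext i; fin_cases i <;> simp
  rw [e] at h
  exact h

theorem bilin_nondegenerate (Ω : SymplecticForm E M) (x : M) : (Ω.bilin x).Nondegenerate :=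
  ⟨fun v hv => Ω.nondegenerate x v hv,
    fun v hv => Ω.nondegenerate x v fun w => by
      have h := hv w
      rw [bilin_swap, neg_eq_zero] at h
      exact h⟩

instance [FiniteDimensional ℝ E] (x : M) : FiniteDimensional ℝ (TangentSpace 𝓘(ℝ, E) x) :=
  inferInstanceAs (FiniteDimensional ℝ E)

/-- The Hamiltonian vector field `X_F` of a function `F`, defined by `Ω (X_F, ·) = dF`. -/
def hamVectorField [FiniteDimensional ℝ E] (Ω : SymplecticForm E M) (F : M → ℝ) (x : M) :
    TangentSpace 𝓘(ℝ, E) x :=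
  ((Ω.bilin x).toDual (Ω.bilin_nondegenerate x)).symm
    (mfderiv 𝓘(ℝ, E) 𝓘(ℝ, ℝ) F x : TangentSpace 𝓘(ℝ, E) x →L[ℝ] ℝ).toLinearMap

theorem form_hamVectorField [FiniteDimensional ℝ E] (Ω : SymplecticForm E M) (F : M → ℝ) (x : M)
    (w : TangentSpace 𝓘(ℝ, E) x) :
    Ω.form x ![Ω.hamVectorField F x, w] = mfderiv 𝓘(ℝ, E) 𝓘(ℝ, ℝ) F x w :=
  LinearMap.BilinForm.apply_toDual_symm_apply (hB := Ω.bilin_nondegenerate x) _ w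

end SymplecticForm

variable (E) in
/-- A smooth family of functions `F t : M → ℝ`, `0 ≤ t ≤ 1`, all supported in one compact set. The
values at times outside `[0,1]` are irrelevant. -/
def IsCompactlySupportedFamily (F : ℝ → M → ℝ) : Prop :=
  ContMDiffOn (𝓘(ℝ, ℝ).prod 𝓘(ℝ, E)) 𝓘(ℝ, ℝ) ∞ (fun p : ℝ × M => F p.1 p.2)
      (Icc 0 1 ×ˢ univ) ∧
    ∃ K : Set M, IsCompact K ∧ ∀ t ∈ Icc (0 : ℝ) 1, ∀ x ∉ K, F t x = 0

variable [FiniteDimensional ℝ E]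

/-- `H` is a (compactly supported, smooth) generating Hamiltonian of the smooth family of maps
`φ t`, `0 ≤ t ≤ 1`: one has `d/dt φ t x = X_{H t} (φ t x)` for all `x` and all `t ∈ [0,1]`, with
one-sided derivatives at the ends. -/
def Generates (Ω : SymplecticForm E M) (H : ℝ → M → ℝ) (φ : ℝ → M → M) : Prop :=
  IsCompactlySupportedFamily E H ∧
  ContMDiffOn (𝓘(ℝ, ℝ).prod 𝓘(ℝ, E)) 𝓘(ℝ, E) ∞ (fun p : ℝ × M => φ p.1 p.2)
    (Icc 0 1 ×ˢ univ) ∧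
  ∀ t ∈ Icc (0 : ℝ) 1, ∀ x : M,
    HasMFDerivWithinAt 𝓘(ℝ, ℝ) 𝓘(ℝ, E) (fun s => φ s x) (Icc 0 1) t
      ((1 : ℝ →L[ℝ] ℝ).smulRight (Ω.hamVectorField (H t) (φ t x)))

/-- The group `Ham^c(M)` of compactly supported Hamiltonian symplectomorphisms: the time-one maps
of the Hamiltonian isotopies that start at the identity. -/
def hamGroup (Ω : SymplecticForm E M) : Set (M → M) :=
  {ψ | ∃ (H : ℝ → M → ℝ) (Φ : ℝ → M → M), Generates Ω H Φ ∧ Φ 0 = id ∧ Φ 1 = ψ}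

/-- The Hofer norm `Totvar F = sup F - inf F`. -/
def totvar (F : M → ℝ) : ℝ := (⨆ x, F x) - ⨅ x, F x

open Classical in
/-- The Hofer length `∫₀¹ Totvar (H t) dt` of a path in `Ham^c(M)` with generating Hamiltonian `H`.
On a connected manifold `H t` is unique up to a constant, so the length does not depend on the
choice of `H`. -/
def hoferLength (Ω : SymplecticForm E M) (φ : ℝ → M → M) : ℝ :=
  if h : ∃ H : ℝ → M → ℝ, Generates Ω H φ then ∫ t in (0 : ℝ)..1, totvar (h.choose t) else 0

open Classical in
/-- The time-one map of the autonomous Hamiltonian flow of `F`. (If `F` is smooth with compact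
support, the integral curve through every point exists for all times and is unique.) -/
def timeOneMap (Ω : SymplecticForm E M) (F : M → ℝ) (x : M) : M :=
  if h : ∃ c : ℝ → M, c 0 = x ∧ IsMIntegralCurve (I := 𝓘(ℝ, E)) c (Ω.hamVectorField F) then
    h.choose 1
  else x

variable (E) in
/-- Tangent vectors `{G t}` to the space of paths with fixed ends. -/
def IsTangentField (G : ℝ → M → ℝ) : Prop :=
  IsCompactlySupportedFamily E G ∧ G 0 = 0 ∧ G 1 = 0

/-- The variation `t ↦ φ_{ε G t} ∘ φ t` of the path `φ` in the direction `G`, where `φ_{ε G t}` is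
the time-one map of the function `ε G t`, for fixed `t`. -/
def variation (Ω : SymplecticForm E M) (G : ℝ → M → ℝ) (φ : ℝ → M → M) (ε : ℝ) : ℝ → M → M :=
  fun t => timeOneMap Ω (fun x => ε * G t x) ∘ φ t

/-- A path is `L`-critical if along each variation the length is bounded below, near `ε = 0`, by a
smooth function with the same value and with zero derivative at `ε = 0`. -/
def IsLCritical (Ω : SymplecticForm E M) (φ : ℝ → M → M) : Prop :=
  ∀ G : ℝ → M → ℝ, IsTangentField E G →
    ∃ δ > 0, ∃ f : ℝ → ℝ, ContDiffOn ℝ ∞ f (Ioo (-δ) δ) ∧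
      f 0 = hoferLength Ω φ ∧ deriv f 0 = 0 ∧
      ∀ ε ∈ Ioo (-δ) δ, f ε ≤ hoferLength Ω (variation Ω G φ ε)

/-- The set of points where `F` attains its minimum. -/
def minset (F : M → ℝ) : Set M := {x | ∀ y, F x ≤ F y}

/-- The set of points where `F` attains its maximum. -/
def maxset (F : M → ℝ) : Set M := {x | ∀ y, F y ≤ F x}

end HoferGeometry

/-! The heart is a first-order formula for the length of a variation. Write `ψ_s` for the time-`s`
flow of `G_t`. The path `ψ_ε ∘ φ_t` is generated by `(H_t + D_ε) ∘ ψ_ε⁻¹`, where the drift `D_ε(x) =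
∫₀^ε ∂_t G_t(ψ_σ x) dσ` records the dependence of `G_t` on `t`. Total variation does not see the
composition with the bijection `ψ_ε⁻¹`, and `D_ε = ε ∂_t G_t + O(ε²)` uniformly. Hence `L(γ_ε) = ∫
totvar (H_t + ε ∂_t G_t) dt + O(ε²)` (`Generates.exists_length_estimate`), and the rest is about
functions only.

If `p` and `P` are a fixed minimum and maximum, the integrand is at least `H_t(P) - H_t(p) + ε (∂_t
G_t(P) - ∂_t G_t(p))`. The `ε`-term integrates to zero because `G_0 = G_1 = 0`, so `L(γ) - C ε²` is
an admissible lower bound (`Generates.isLCritical_of_fixed`).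

If there is no fixed maximum, choose a time `t₁` at which the maximum set is compact. Each of its
points fails to be a maximum at some other time. Cover the set by finitely many bumps `h_x`, each
supported off the maximum set of a time `σ x`, and move mass in time: `∂_t G_t` is `-h_x` near `t₁`
and `+h_x` near `σ x`, with total integral zero. Near `t₁` this pushes the maximum down at a linear
rate in `ε`; near `σ x` it acts where `H` is well below its maximum and does no harm; the minimum is
never lowered. So the length drops linearly in `ε` (`exists_shortening_field`), which no lower bound
with zero derivative allows (`Generates.not_isLCritical_of_decreasing`). A missing minimum is a
missing maximum of `-H`.

Most of the work lies in the formula for the generator. It needs flows that are smooth jointly in `t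
∈ [0,1]`, ends included, and in the point; these come from a smooth fixed point theorem for the
Picard operator. Closedness of the form then gives `Ψ_s^*ω = ω + dt ∧ dD_s` for the flow with `t` as
a variable (`pullback_flow_two_form`), and this identity yields the velocity of the varied path.
Finally `hoferLength` refers to an arbitrary generating Hamiltonian. Its total variation is well
defined because each `φ_t` is onto: it preserves the form, hence is open, and it is the identity off
a compact set (`Generates.surjective`). -/

open Filter Topology

set_option linter.unusedSectionVars false

/-! ### Superposition operators on path spaces and smooth dependence of fixed points. -/

noncomputable section PathSpaces

universe u

section Superposition

variable {ι : Type*} [TopologicalSpace ι] [CompactSpace ι]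
variable {Z F G : Type*} [NormedAddCommGroup Z] [NormedSpace ℝ Z]
  [NormedAddCommGroup F] [NormedSpace ℝ F] [NormedAddCommGroup G] [NormedSpace ℝ G]

open Classical in
/-- The superposition operator `c ↦ v ∘ c` on continuous paths (zero if `v ∘ c` is not
continuous). -/
def superposition (v : Z → F) (c : C(ι, Z)) : C(ι, F) :=
  if h : Continuous (v ∘ c) then ⟨v ∘ c, h⟩ else 0

/-- The paths with values in `Q`. -/
def pathsIn (ι : Type*) [TopologicalSpace ι] (Q : Set Z) : Set C(ι, Z) := {c | ∀ r, c r ∈ Q}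

theorem superposition_apply {v : Z → F} {Q : Set Z} (hv : ContinuousOn v Q) {c : C(ι, Z)}
    (hc : c ∈ pathsIn ι Q) (r : ι) : superposition v c r = v (c r) := by
  have h : Continuous (v ∘ c) := hv.comp_continuous c.continuous hc
  simp [superposition, h]

/-- The pointwise product of two paths along a bounded bilinear map. -/
def pathBilin {W : Type*} [NormedAddCommGroup W] [NormedSpace ℝ W] (B : W →L[ℝ] F →L[ℝ] G) :
    C(ι, W) →L[ℝ] C(ι, F) →L[ℝ] C(ι, G) :=
  LinearMap.mkContinuous₂
    (LinearMap.mk₂ ℝ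
      (fun (A : C(ι, W)) (h : C(ι, F)) =>
        (⟨fun r => B (A r) (h r), (B.continuous.comp A.continuous).clm_apply h.continuous⟩ :
          C(ι, G)))
      (fun _ _ _ => by ext; simp) (fun _ _ _ => by ext; simp)
      (fun _ _ _ => by ext; simp) (fun _ _ _ => by ext; simp)) ‖B‖
    (fun A h => by
      refine (ContinuousMap.norm_le _ (by positivity)).2 fun r => ?_
      simp only [LinearMap.mk₂_apply, ContinuousMap.coe_mk]
      exact (B.le_opNorm₂ _ _).trans
        (by gcongr; exacts [A.norm_coe_le_norm r, h.norm_coe_le_norm r]))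

@[simp] theorem pathBilin_apply {W : Type*} [NormedAddCommGroup W] [NormedSpace ℝ W]
    (B : W →L[ℝ] F →L[ℝ] G) (A : C(ι, W)) (h : C(ι, F)) (r : ι) :
    pathBilin B A h r = B (A r) (h r) := rfl

/-- The range of `c` is compact, so continuity along it is uniform, even when compared with points
of `Q` outside the range. -/
theorem exists_uniform_of_continuousOn {v : Z → F} {Q : Set Z} (hv : ContinuousOn v Q)
    {c : C(ι, Z)} (hc : c ∈ pathsIn ι Q) {ε : ℝ} (hε : 0 < ε) :
    ∃ δ > 0, ∀ r, ∀ y ∈ Q, ‖y - c r‖ < δ → ‖v y - v (c r)‖ < ε := by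
  let c' : ι → Q := fun r => ⟨c r, hc r⟩
  have hc' : Continuous c' := c.continuous.subtype_mk _
  have hK : IsCompact (range c') := isCompact_range hc'
  have hv' : Continuous (Q.domRestrict v) := continuousOn_iff_continuous_domRestrict.1 hv
  have h := hK.uniformContinuousAt_of_continuousAt (Q.domRestrict v)
    (fun a _ => hv'.continuousAt) (Metric.dist_mem_uniformity hε)
  obtain ⟨δ, hδ, h⟩ := Metric.mem_uniformity_dist.1 h
  refine ⟨δ, hδ, fun r y hy hyr => ?_⟩
  have h2 := @h (c' r) ⟨y, hy⟩ (by
    rw [Subtype.dist_eq, dist_comm, dist_eq_norm]; exact hyr) (mem_range_self r)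
  have h3 : dist (v (c r)) (v y) < ε := h2
  rwa [dist_comm, dist_eq_norm] at h3

theorem continuousOn_superposition {v : Z → F} {Q : Set Z} (hv : ContinuousOn v Q) :
    ContinuousOn (superposition (ι := ι) v) (pathsIn ι Q) := by
  rw [Metric.continuousOn_iff]
  intro c hc ε hε
  obtain ⟨δ, hδ, h⟩ := exists_uniform_of_continuousOn hv hc (half_pos hε)
  refine ⟨δ, hδ, fun b hb hbc => ?_⟩
  rw [dist_eq_norm] at hbc ⊢
  refine lt_of_le_of_lt ((ContinuousMap.norm_le _ (half_pos hε).le).2 fun r => ?_) (half_lt_self hε)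
  rw [ContinuousMap.sub_apply, superposition_apply hv hb, superposition_apply hv hc]
  exact (h r _ (hb r) (lt_of_le_of_lt ((b - c).norm_coe_le_norm r) hbc)).le

/-- The derivative acts pointwise, as `h ↦ v' (c r) (h r)`. The mean value inequality on the convex
sets `Q ∩ ball (c r) δ` bounds the remainder with one `δ` for all `r`, and a bound uniform in `r` is
a bound in the sup norm. -/
theorem hasFDerivWithinAt_superposition {v : Z → F} {v' : Z → Z →L[ℝ] F} {Q : Set Z}
    (hQ : Convex ℝ Q) (hv : ∀ z ∈ Q, HasFDerivWithinAt v (v' z) Q z) (hv' : ContinuousOn v' Q)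
    {c : C(ι, Z)} (hc : c ∈ pathsIn ι Q) :
    HasFDerivWithinAt (superposition v) (pathBilin (ContinuousLinearMap.id ℝ (Z →L[ℝ] F)) (superposition v' c)) (pathsIn ι Q) c := by
  have hvc : ContinuousOn v Q := fun z hz => (hv z hz).continuousWithinAt
  rw [hasFDerivWithinAt_iff_isLittleO, Asymptotics.isLittleO_iff]
  intro ε hε
  obtain ⟨δ, hδ, h⟩ := exists_uniform_of_continuousOn hv' hc hε
  filter_upwards [inter_mem_nhdsWithin _ (Metric.ball_mem_nhds c hδ)] with b hb
  have hbc : ‖b - c‖ < δ := by simpa [dist_eq_norm] using hb.2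
  refine (ContinuousMap.norm_le _ (by positivity)).2 fun r => ?_
  have hbr : ‖b r - c r‖ ≤ ‖b - c‖ := (b - c).norm_coe_le_norm r
  simp only [ContinuousMap.sub_apply, pathBilin_apply, ContinuousLinearMap.id_apply, superposition_apply hvc hb.1,
    superposition_apply hvc hc, superposition_apply hv' hc]
  have hmem : ∀ z ∈ Q ∩ Metric.ball (c r) δ,
      HasFDerivWithinAt v (v' z) (Q ∩ Metric.ball (c r) δ) z :=
    fun z hz => (hv z hz.1).mono inter_subset_left
  refine ((hQ.inter (convex_ball (c r) δ)).norm_image_sub_le_of_norm_hasFDerivWithin_le'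
    hmem (fun z hz => (h r z hz.1 ?_).le) ⟨hc r, Metric.mem_ball_self hδ⟩
    ⟨hb.1 r, ?_⟩).trans ?_
  · simpa [dist_eq_norm] using hz.2
  · simpa [dist_eq_norm] using hbr.trans_lt hbc
  · gcongr

end Superposition

/-- The derivative is again a superposition operator, that of `v'`, followed by a bounded linear
map, so induction applies. The quantifier over `F` sits inside the induction, and `F` lives in the
universe of `Z`, so that `Z →L[ℝ] F` may take its place. -/
theorem contDiffOn_nat_superposition {ι : Type*} [TopologicalSpace ι] [CompactSpace ι]
    {Z : Type u} [NormedAddCommGroup Z] [NormedSpace ℝ Z] {Q : Set Z} (hQ : Convex ℝ Q)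
    (hQu : UniqueDiffOn ℝ Q) (n : ℕ) :
    ∀ {F : Type u} [NormedAddCommGroup F] [NormedSpace ℝ F] {v : Z → F},
      ContDiffOn ℝ n v Q → ContDiffOn ℝ n (superposition (ι := ι) v) (pathsIn ι Q) := by
  induction n with
  | zero =>
    intro F _ _ v hv
    exact contDiffOn_zero.2 (continuousOn_superposition hv.continuousOn)
  | succ n ih =>
    intro F _ _ v hv
    have hv2 := (contDiffOn_succ_iff_fderivWithin (n := (n : ℕ∞ω)) hQu).1 hv
    intro c hc
    have hd := fun b (hb : b ∈ pathsIn ι Q) => hasFDerivWithinAt_superposition hQ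
      (fun z hz => (hv2.1 z hz).hasFDerivWithinAt) hv2.2.2.continuousOn hb
    have hp := (pathBilin (ι := ι) (ContinuousLinearMap.id ℝ (Z →L[ℝ] F))).contDiff (n := n)
    push_cast
    -- Unique differentiability of the set of paths in `Q` is not available, so the derivative is
    -- exhibited rather than taken as `fderivWithin`.
    rw [contDiffWithinAt_succ_iff_hasFDerivWithinAt (by simp), insert_eq_of_mem hc]
    exact ⟨pathsIn ι Q, self_mem_nhdsWithin, by simp, _, hd,
      ContDiff.comp_contDiffWithinAt hp (ih hv2.2.2 c hc)⟩

theorem contDiffOn_superposition {ι : Type*} [TopologicalSpace ι] [CompactSpace ι]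
    {Z : Type u} [NormedAddCommGroup Z] [NormedSpace ℝ Z] {Q : Set Z} (hQ : Convex ℝ Q)
    (hQu : UniqueDiffOn ℝ Q) {F : Type u} [NormedAddCommGroup F] [NormedSpace ℝ F] {v : Z → F}
    (hv : ContDiffOn ℝ ∞ v Q) : ContDiffOn ℝ ∞ (superposition (ι := ι) v) (pathsIn ι Q) :=
  contDiffOn_infty.2 fun n => contDiffOn_nat_superposition hQ hQu n (contDiffOn_infty.1 hv n)

section FixedPoint

variable {X Y : Type*} [NormedAddCommGroup X] [NormedSpace ℝ X] [NormedAddCommGroup Y]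
  [NormedSpace ℝ Y]
  {S : Set X} {V : Set Y} {T : X × Y → Y} {f : X → Y}

/-- Moving from `(p, f p)` to `(q, f q)` in two stages, the change in the second variable
contributes at most half of the left side and is absorbed. -/
theorem norm_sub_le_of_fixedPoint
    (hT : ∀ p ∈ S, ∀ y ∈ V, ∀ y' ∈ V, ‖T (p, y) - T (p, y')‖ ≤ 1 / 2 * ‖y - y'‖)
    (hf : ∀ p ∈ S, f p ∈ V) (hfT : ∀ p ∈ S, T (p, f p) = f p) {p q : X} (hp : p ∈ S)
    (hq : q ∈ S) : ‖f q - f p‖ ≤ 2 * ‖T (q, f p) - T (p, f p)‖ := by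
  have h1 := hT q hq _ (hf q hq) _ (hf p hp)
  have h2 : f q - f p = (T (q, f q) - T (q, f p)) + (T (q, f p) - T (p, f p)) := by
    rw [hfT q hq, hfT p hp]; abel
  have h3 := norm_add_le (T (q, f q) - T (q, f p)) (T (q, f p) - T (p, f p))
  rw [← h2] at h3
  linarith

theorem continuousOn_of_fixedPoint (hTc : ContinuousOn T (S ×ˢ V))
    (hT : ∀ p ∈ S, ∀ y ∈ V, ∀ y' ∈ V, ‖T (p, y) - T (p, y')‖ ≤ 1 / 2 * ‖y - y'‖)
    (hf : ∀ p ∈ S, f p ∈ V) (hfT : ∀ p ∈ S, T (p, f p) = f p) : ContinuousOn f S := by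
  intro p hp
  have h1 : ContinuousWithinAt (fun q => T (q, f p)) S p :=
    (hTc (p, f p) ⟨hp, hf p hp⟩).comp (f := fun q => (q, f p))
      (continuousWithinAt_id.prodMk continuousWithinAt_const) fun q hq => ⟨hq, hf p hp⟩
  rw [ContinuousWithinAt, tendsto_iff_norm_sub_tendsto_zero] at h1 ⊢
  refine squeeze_zero' (Eventually.of_forall fun _ => norm_nonneg _) ?_
    (by simpa using h1.const_mul 2)
  filter_upwards [self_mem_nhdsWithin] with q hq
  exact norm_sub_le_of_fixedPoint hT hf hfT hp hq

/-- Differentiating `f = T (·, f)` gives `f' = A + B f'`, where `A` and `B` are the partial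
derivatives of `T`. The contraction bound passes to `‖B‖ ≤ 1/2`, so `1 - B` is invertible. The
parameter set `S` need not be open, which allows closed time intervals. -/
theorem hasFDerivWithinAt_of_fixedPoint [CompleteSpace Y] {T' : X × Y →L[ℝ] Y} {p : X}
    (hp : p ∈ S) (hV : IsOpen V) (hTc : ContinuousOn T (S ×ˢ V))
    (hTd : HasFDerivWithinAt T T' (S ×ˢ V) (p, f p))
    (hT : ∀ p ∈ S, ∀ y ∈ V, ∀ y' ∈ V, ‖T (p, y) - T (p, y')‖ ≤ 1 / 2 * ‖y - y'‖)
    (hf : ∀ p ∈ S, f p ∈ V) (hfT : ∀ p ∈ S, T (p, f p) = f p) :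
    ‖T'.comp (ContinuousLinearMap.inr ℝ X Y)‖ ≤ 1 / 2 ∧
    HasFDerivWithinAt f ((Ring.inverse (1 - T'.comp (ContinuousLinearMap.inr ℝ X Y))).comp
      (T'.comp (ContinuousLinearMap.inl ℝ X Y))) S p := by
  set A := T'.comp (ContinuousLinearMap.inl ℝ X Y) with hA
  set B := T'.comp (ContinuousLinearMap.inr ℝ X Y) with hB
  have hBd : HasFDerivAt (fun y => T (p, y)) B (f p) := by
    have h1 : HasFDerivWithinAt (fun y => T (p, y)) B V (f p) :=
      hTd.comp (f := fun y => (p, y)) (f p)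
        (hasFDerivAt_prodMk_right p (f p)).hasFDerivWithinAt fun y hy => ⟨hp, hy⟩
    exact h1.hasFDerivAt (hV.mem_nhds (hf p hp))
  have hBn : ‖B‖ ≤ 1 / 2 := by
    refine hBd.le_of_lip' (by norm_num) ?_
    filter_upwards [hV.mem_nhds (hf p hp)] with y hy
    exact hT p hp y hy _ (hf p hp)
  refine ⟨hBn, ?_⟩
  have hB1 : ‖B‖ < 1 := by linarith
  have hinv : Ring.inverse (1 - B) * (1 - B) = 1 :=
    Ring.inverse_mul_cancel _ (Units.oneSub B hB1).isUnit
  have hcf : ContinuousWithinAt f S p := continuousOn_of_fixedPoint hTc hT hf hfT p hp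
  have hgr : Tendsto (fun q => (q, f q)) (𝓝[S] p) (𝓝[S ×ˢ V] (p, f p)) := by
    refine tendsto_nhdsWithin_iff.2 ⟨?_, ?_⟩
    · exact (continuousWithinAt_id.prodMk hcf)
    · filter_upwards [self_mem_nhdsWithin] with q hq using ⟨hq, hf q hq⟩
  have hg2 : Tendsto (fun q => (q, f p)) (𝓝[S] p) (𝓝[S ×ˢ V] (p, f p)) := by
    refine tendsto_nhdsWithin_iff.2 ⟨?_, ?_⟩
    · exact (continuousWithinAt_id.prodMk continuousWithinAt_const)
    · filter_upwards [self_mem_nhdsWithin] with q hq using ⟨hq, hf p hp⟩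
  have hlo := (hasFDerivWithinAt_iff_isLittleO.1 hTd)
  have hO : (fun q => f q - f p) =O[𝓝[S] p] fun q => q - p := by
    have h1 : (fun q => T (q, f p) - T (p, f p)) =O[𝓝[S] p] fun q => q - p := by
      have h2 := hTd.isBigO_sub.comp_tendsto hg2
      refine h2.trans (Asymptotics.IsBigO.of_bound 1 (Eventually.of_forall fun q => ?_))
      simp [Prod.norm_def]
    refine Asymptotics.IsBigO.trans (Asymptotics.IsBigO.of_bound 2 ?_) h1
    filter_upwards [self_mem_nhdsWithin] with q hq
    exact norm_sub_le_of_fixedPoint hT hf hfT hp hq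
  have h3 : (fun q => T (q, f q) - T (p, f p) - T' ((q, f q) - (p, f p)))
      =o[𝓝[S] p] fun q => q - p := by
    refine (hlo.comp_tendsto hgr).trans_isBigO ?_
    exact ((Asymptotics.isBigO_refl _ _).prod_left hO)
  rw [hasFDerivWithinAt_iff_isLittleO]
  refine (((Ring.inverse (1 - B)).isBigO_comp _ (𝓝[S] p)).trans_isLittleO h3).congr' ?_
    EventuallyEq.rfl
  filter_upwards [self_mem_nhdsWithin] with q hq
  have h4 : T (q, f q) - T (p, f p) - T' ((q, f q) - (p, f p))
      = (1 - B) (f q - f p) - A (q - p) := by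
    rw [hfT q hq, hfT p hp]
    have h5 : ((q, f q) - (p, f p) : X × Y) = (q - p, 0) + (0, f q - f p) := by simp
    rw [h5, map_add]
    simp [hA, hB]
    abel
  have h6 : ∀ y, Ring.inverse (1 - B) ((1 - B) y) = y := fun y => by
    have := congrArg (fun L : Y →L[ℝ] Y => L y) hinv
    simpa using this
  show Ring.inverse (1 - B) (T (q, f q) - T (p, f p) - T' ((q, f q) - (p, f p))) = _
  rw [h4, map_sub, h6]
  simp

/-- Bootstrapping: the formula for `f'` involves only `f`, the smooth derivative of `T` and operator
inversion, so `f` being `C^n` makes `f'` of class `C^n`. -/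
theorem contDiffOn_of_fixedPoint [CompleteSpace Y] (hSu : UniqueDiffOn ℝ S) (hV : IsOpen V)
    (hTs : ContDiffOn ℝ ∞ T (S ×ˢ V))
    (hT : ∀ p ∈ S, ∀ y ∈ V, ∀ y' ∈ V, ‖T (p, y) - T (p, y')‖ ≤ 1 / 2 * ‖y - y'‖)
    (hf : ∀ p ∈ S, f p ∈ V) (hfT : ∀ p ∈ S, T (p, f p) = f p) : ContDiffOn ℝ ∞ f S := by
  have hu : UniqueDiffOn ℝ (S ×ˢ V) := hSu.prod hV.uniqueDiffOn
  have hTd : ∀ p ∈ S, HasFDerivWithinAt T (fderivWithin ℝ T (S ×ˢ V) (p, f p)) (S ×ˢ V) (p, f p) :=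
    fun p hp => ((hTs.differentiableOn (by simp)) _ ⟨hp, hf p hp⟩).hasFDerivWithinAt
  have hT' : ContDiffOn ℝ ∞ (fderivWithin ℝ T (S ×ˢ V)) (S ×ˢ V) :=
    hTs.fderivWithin hu (by simp)
  refine contDiffOn_infty.2 fun n => ?_
  induction n with
  | zero => exact contDiffOn_zero.2 (continuousOn_of_fixedPoint hTs.continuousOn hT hf hfT)
  | succ n ih =>
    have hd := fun p (hp : p ∈ S) =>
      hasFDerivWithinAt_of_fixedPoint hp hV hTs.continuousOn (hTd p hp) hT hf hfT
    have hgr : ContDiffOn ℝ n (fun p => fderivWithin ℝ T (S ×ˢ V) (p, f p)) S :=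
      (contDiffOn_infty.1 hT' n).comp (contDiffOn_id.prodMk ih) fun p hp => ⟨hp, hf p hp⟩
    have hA : ContDiffOn ℝ n (fun p => (fderivWithin ℝ T (S ×ˢ V) (p, f p)).comp
        (ContinuousLinearMap.inl ℝ X Y)) S := hgr.clm_comp contDiffOn_const
    have hB : ContDiffOn ℝ n (fun p => 1 - (fderivWithin ℝ T (S ×ˢ V) (p, f p)).comp
        (ContinuousLinearMap.inr ℝ X Y)) S :=
      contDiffOn_const.sub (hgr.clm_comp contDiffOn_const)
    have hI : ContDiffOn ℝ n (fun p => Ring.inverse (1 - (fderivWithin ℝ T (S ×ˢ V) (p, f p)).comp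
        (ContinuousLinearMap.inr ℝ X Y))) S := by
      intro p hp
      have hlt : ‖(fderivWithin ℝ T (S ×ˢ V) (p, f p)).comp
        (ContinuousLinearMap.inr ℝ X Y)‖ < 1 := by linarith [(hd p hp).1]
      have h1 := contDiffAt_ringInverse ℝ (n := n) (Units.oneSub _ hlt)
      exact h1.comp_contDiffWithinAt p (hB p hp)
    push_cast
    refine (contDiffOn_succ_iff_fderivWithin hSu).2
      ⟨fun p hp => (hd p hp).2.differentiableWithinAt, by simp, ?_⟩
    exact (hI.clm_comp hA).congr fun p hp => (hd p hp).2.fderivWithin (hSu p hp)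

end FixedPoint

end PathSpaces

/-! ### Smooth local flows of vector fields depending on a parameter in `[0,1]`. -/

noncomputable section LocalFlow

universe u

variable {F : Type*} [NormedAddCommGroup F] [NormedSpace ℝ F]

/-- The time interval of the local solutions. -/
abbrev flowTime : Set ℝ := Icc (-2) 2

theorem continuous_pathIntegral_aux (c : C(flowTime, F)) :
    Continuous fun r : flowTime =>
      ∫ x in (0 : ℝ)..r, IccExtend (by norm_num : (-2 : ℝ) ≤ 2) c x :=
  (intervalIntegral.continuous_primitive
    (fun a b => (c.continuous.Icc_extend').intervalIntegrable a b) 0).comp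
      continuous_subtype_val

/-- The primitive of a path that vanishes at time zero. -/
def pathIntegral [CompleteSpace F] : C(flowTime, F) →L[ℝ] C(flowTime, F) :=
  LinearMap.mkContinuous
    { toFun := fun c => ⟨fun r => ∫ x in (0 : ℝ)..r, IccExtend (by norm_num : (-2 : ℝ) ≤ 2) c x,
        continuous_pathIntegral_aux c⟩
      map_add' := fun c d => by
        ext r
        simp only [ContinuousMap.coe_mk, ContinuousMap.add_apply]
        rw [← intervalIntegral.integral_add
          ((c.continuous.Icc_extend').intervalIntegrable _ _)
          ((d.continuous.Icc_extend').intervalIntegrable _ _)]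
        rfl
      map_smul' := fun a c => by
        ext r
        simp only [ContinuousMap.coe_mk, ContinuousMap.smul_apply, RingHom.id_apply]
        rw [← intervalIntegral.integral_smul]
        rfl } 2
    (fun c => by
      refine (ContinuousMap.norm_le _ (by positivity)).2 fun r => ?_
      have h := intervalIntegral.norm_integral_le_of_norm_le_const (a := 0) (b := (r : ℝ))
        (f := IccExtend (by norm_num : (-2 : ℝ) ≤ 2) c) (C := ‖c‖)
        (fun x _ => c.norm_coe_le_norm _)
      refine h.trans ?_
      rw [mul_comm]
      gcongr
      rw [sub_zero, abs_le]
      exact ⟨by linarith [r.2.1], r.2.2⟩)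

theorem norm_pathIntegral_le [CompleteSpace F] (c : C(flowTime, F)) :
    ‖pathIntegral c‖ ≤ 2 * ‖c‖ :=
  (pathIntegral.le_opNorm c).trans
    (by gcongr; exact LinearMap.mkContinuous_norm_le _ (by norm_num) _)

/-- Constant paths. -/
def constPath : F →L[ℝ] C(flowTime, F) :=
  LinearMap.mkContinuous
    { toFun := fun x => ContinuousMap.const _ x
      map_add' := fun _ _ => rfl
      map_smul' := fun _ _ => rfl } 1
    (fun x => (ContinuousMap.norm_le _ (by positivity)).2 fun r => (one_mul ‖x‖).ge)

/-- The image under `B` of a path with a constant first component. -/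
def parametrizedPathAux {Z : Type*} [NormedAddCommGroup Z] [NormedSpace ℝ Z]
    (B : ℝ × F →L[ℝ] Z) : ℝ × C(flowTime, F) →L[ℝ] C(flowTime, Z) :=
  LinearMap.mkContinuous
    { toFun := fun p => ⟨fun r => B (p.1, p.2 r), by fun_prop⟩
      map_add' := fun p q => by
        ext r
        simp only [ContinuousMap.coe_mk, ContinuousMap.add_apply, ← map_add]
        rfl
      map_smul' := fun a p => by
        ext r
        simp only [ContinuousMap.coe_mk, ContinuousMap.smul_apply, RingHom.id_apply, ← map_smul]
        rfl } ‖B‖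
    (fun p => (ContinuousMap.norm_le _ (by positivity)).2 fun r => by
      simp only [LinearMap.coe_mk, AddHom.coe_mk, ContinuousMap.coe_mk]
      exact B.le_opNorm_of_le (max_le_max le_rfl (p.2.norm_coe_le_norm r)))

/-- A path with a constant first component. -/
def parametrizedPath : ℝ × C(flowTime, F) →L[ℝ] C(flowTime, ℝ × F) :=
  parametrizedPathAux (ContinuousLinearMap.id ℝ (ℝ × F))

/-- Evaluation of a path. -/
def evalPath (r : flowTime) : C(flowTime, F) →L[ℝ] F :=
  LinearMap.mkContinuous
    { toFun := fun c => c r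
      map_add' := fun _ _ => rfl
      map_smul' := fun _ _ => rfl } 1
    (fun c => by simpa using c.norm_coe_le_norm r)

/-- The Picard operator of the parametrized vector field `v`, with the time rescaled by `s`. -/
def picardMap [CompleteSpace F] (v : ℝ × F → F) (p : (ℝ × ℝ × F) × C(flowTime, F)) :
    C(flowTime, F) :=
  constPath p.1.2.2 + p.1.1 • pathIntegral (superposition v (parametrizedPath (p.1.2.1, p.2)))

theorem contDiffOn_picardMap {F : Type u} [NormedAddCommGroup F] [NormedSpace ℝ F]
    [CompleteSpace F] {v : ℝ × F → F} {D : Set ℝ} {B : Set F}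
    (hD : Convex ℝ D) (hB : Convex ℝ B) (hDu : UniqueDiffOn ℝ D) (hBu : UniqueDiffOn ℝ B)
    (hv : ContDiffOn ℝ ∞ v (D ×ˢ B)) :
    ContDiffOn ℝ ∞ (picardMap v)
      ((univ ×ˢ D ×ˢ univ) ×ˢ {c : C(flowTime, F) | ∀ r, c r ∈ B}) := by
  have h1 : ContDiffOn ℝ ∞ (superposition (ι := flowTime) v) (pathsIn flowTime (D ×ˢ B)) :=
    contDiffOn_superposition (Z := ℝ × F) (hD.prod hB) (hDu.prod hBu) hv
  have h2 : ContDiffOn ℝ ∞ (fun p : (ℝ × ℝ × F) × C(flowTime, F) =>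
      superposition v (parametrizedPath (p.1.2.1, p.2)))
      ((univ ×ˢ D ×ˢ univ) ×ˢ {c : C(flowTime, F) | ∀ r, c r ∈ B}) :=
    h1.comp (f := fun p : (ℝ × ℝ × F) × C(flowTime, F) => parametrizedPath (p.1.2.1, p.2))
      ((parametrizedPathAux (ContinuousLinearMap.id ℝ (ℝ × F))).contDiff.comp (contDiff_fst.snd.fst.prodMk contDiff_snd)).contDiffOn
      fun p hp r => ⟨hp.1.2.1, hp.2 r⟩
  have h3 : ContDiff ℝ ∞ fun p : (ℝ × ℝ × F) × C(flowTime, F) => constPath p.1.2.2 :=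
    (constPath (F := F)).contDiff.comp (contDiff_snd.comp (contDiff_snd.comp contDiff_fst))
  refine h3.contDiffOn.add ?_
  have h4 := ((pathIntegral (F := F)).contDiff (n := ∞)).comp_contDiffOn h2
  have h5 : ContDiff ℝ ∞ fun p : (ℝ × ℝ × F) × C(flowTime, F) => p.1.1 :=
    contDiff_fst.comp contDiff_fst
  exact h5.contDiffOn.smul h4

theorem norm_superposition_sub_le {v : ℝ × F → F} {Q : Set (ℝ × F)} {K : NNReal}
    (hv : LipschitzOnWith K v Q) {t : ℝ} {c d : C(flowTime, F)}
    (hc : ∀ r, (t, c r) ∈ Q) (hd : ∀ r, (t, d r) ∈ Q) :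
    ‖superposition v (parametrizedPath (t, c)) - superposition v (parametrizedPath (t, d))‖
      ≤ K * ‖c - d‖ := by
  refine (ContinuousMap.norm_le _ (by positivity)).2 fun r => ?_
  rw [ContinuousMap.sub_apply, superposition_apply hv.continuousOn (by exact hc),
    superposition_apply hv.continuousOn (by exact hd), ← dist_eq_norm]
  refine (hv.dist_le_mul _ (hc r) _ (hd r)).trans ?_
  gcongr
  rw [Prod.dist_eq, dist_self, dist_eq_norm (c r)]
  exact max_le (norm_nonneg _) ((c - d).norm_coe_le_norm r)

theorem mem_of_mem_closedBall_const {x₀ : F} {ρ : ℝ} {c : C(flowTime, F)}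
    (hc : ‖c - constPath x₀‖ < ρ) (r : flowTime) : c r ∈ Metric.ball x₀ ρ := by
  rw [Metric.mem_ball, dist_eq_norm]
  exact ((c - constPath x₀).norm_coe_le_norm r).trans_lt hc

/-- The flow is the value at `r = 1` of the fixed point of `c ↦ x + s ∫₀^r v (t, c)`. Rescaling time
puts `s` among the parameters, so the fixed point theorem gives smoothness in `(s, t, x)` at once.
The parameter `t` is frozen along the flow and may be an end of `[0,1]`. -/
theorem exists_smooth_local_flow {E : Type u} [NormedAddCommGroup E] [NormedSpace ℝ E]
    [CompleteSpace E] {v : ℝ × E → E} {V : Set E} (hV : IsOpen V)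
    (hv : ContDiffOn ℝ ∞ v (Icc 0 1 ×ˢ V)) {t₀ : ℝ} (ht₀ : t₀ ∈ Icc (0 : ℝ) 1) {x₀ : E}
    (hx₀ : x₀ ∈ V) :
    ∃ δ > 0, ∃ Φ : ℝ × ℝ × E → E,
      ContDiffOn ℝ ∞ Φ
        (Ioo (-δ) δ ×ˢ (Icc 0 1 ∩ Ioo (t₀ - δ) (t₀ + δ)) ×ˢ Metric.ball x₀ δ) ∧
      ∀ s ∈ Ioo (-δ) δ, ∀ t ∈ Icc 0 1 ∩ Ioo (t₀ - δ) (t₀ + δ), ∀ x ∈ Metric.ball x₀ δ,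
        Φ (s, t, x) ∈ V ∧ Φ (0, t, x) = x ∧
        HasDerivAt (fun σ => Φ (σ, t, x)) (v (t, Φ (s, t, x))) s := by
  obtain ⟨ρ₁, hρ₁, hρV⟩ := Metric.isOpen_iff.1 hV x₀ hx₀
  obtain ⟨K, N, hN, hLip⟩ := (((hv.mono (prod_mono_right hρV)) (t₀, x₀)
    ⟨ht₀, Metric.mem_ball_self hρ₁⟩).of_le (m := 1) (by simp)).exists_lipschitzOnWith
      ((convex_Icc 0 1).prod (convex_ball x₀ ρ₁))
  obtain ⟨ρ₂, hρ₂, hball⟩ := Metric.mem_nhdsWithin_iff.1 hN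
  set ρ := min ρ₁ ρ₂ with hρdef
  have hρ : 0 < ρ := lt_min hρ₁ hρ₂
  set D : Set ℝ := Icc 0 1 ∩ Ioo (t₀ - ρ) (t₀ + ρ) with hDdef
  set B := Metric.ball x₀ ρ with hBdef
  have hDc : Convex ℝ D := (convex_Icc 0 1).inter (convex_Ioo _ _)
  have ht₀D : t₀ ∈ D := ⟨ht₀, by linarith, by linarith⟩
  have hDu : UniqueDiffOn ℝ D := (uniqueDiffOn_Icc_zero_one).inter isOpen_Ioo
  have hBu : UniqueDiffOn ℝ B := Metric.isOpen_ball.uniqueDiffOn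
  have hQN : D ×ˢ B ⊆ N := by
    rintro ⟨t, x⟩ ⟨ht, hx⟩
    refine hball ⟨?_, ht.1, Metric.ball_subset_ball (min_le_left _ _) hx⟩
    rw [Metric.mem_ball, Prod.dist_eq]
    refine max_lt ?_ (lt_of_lt_of_le hx (min_le_right _ _))
    rw [Real.dist_eq, abs_lt]
    have := min_le_right ρ₁ ρ₂
    exact ⟨by linarith [ht.2.1], by linarith [ht.2.2]⟩
  have hLip' : LipschitzOnWith K v (D ×ˢ B) := hLip.mono hQN
  have hvQ : ContDiffOn ℝ ∞ v (D ×ˢ B) := hv.mono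
    (prod_mono inter_subset_left ((Metric.ball_subset_ball (min_le_left _ _)).trans hρV))
  set m : ℝ := ‖v (t₀, x₀)‖ + K * ρ with hm
  have hm0 : 0 ≤ m := by positivity
  have hmb : ∀ z ∈ D ×ˢ B, ‖v z‖ ≤ m := by
    intro z hz
    have h1 := hLip'.dist_le_mul z hz (t₀, x₀) ⟨ht₀D, Metric.mem_ball_self hρ⟩
    have h2 : dist z (t₀, x₀) ≤ ρ := by
      rw [Prod.dist_eq]
      refine max_le ?_ (le_of_lt hz.2)
      rw [Real.dist_eq, abs_le]
      exact ⟨by linarith [hz.1.2.1], by linarith [hz.1.2.2]⟩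
    have h3 : ‖v z‖ ≤ ‖v (t₀, x₀)‖ + ‖v z - v (t₀, x₀)‖ := by
      have := norm_add_le (v (t₀, x₀)) (v z - v (t₀, x₀)); simpa using this
    rw [dist_eq_norm] at h1
    have h4 : (K : ℝ) * dist z (t₀, x₀) ≤ K * ρ := by gcongr
    linarith
  have hKm : (0 : ℝ) < K + m + 1 := by positivity
  -- The factor `8 (K + m + 1)` makes both `2 K |s| ≤ 1/2`, the contraction, and `2 m |s| ≤ ρ/4`,
  -- invariance of the ball of radius `ρ/2`; the `2` is the norm bound of `pathIntegral` on
  -- `[-2,2]`.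
  set δ₁ := min (ρ / 4) (min 1 ρ / (8 * (K + m + 1))) with hδ₁
  have hδ₁0 : 0 < δ₁ := lt_min (by positivity) (by positivity)
  have hδ₁a : δ₁ ≤ ρ / 4 := min_le_left _ _
  have hδ₁b : δ₁ * (8 * (K + m + 1)) ≤ min 1 ρ :=
    (le_div_iff₀ (by positivity)).1 (min_le_right _ _)
  have hsK : ∀ s ∈ Ioo (-δ₁) δ₁, |s| * (2 * K) ≤ 1 / 2 := fun s hs => by
    have h1 : |s| ≤ δ₁ := (abs_lt.2 hs).le
    have h2 := min_le_left 1 ρ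
    have h3 : |s| * (2 * K) ≤ δ₁ * (2 * K) := by gcongr
    nlinarith
  have hsm : ∀ s ∈ Ioo (-δ₁) δ₁, |s| * (2 * m) ≤ ρ / 4 := fun s hs => by
    have h1 : |s| ≤ δ₁ := (abs_lt.2 hs).le
    have h2 := min_le_right 1 ρ
    have h3 : |s| * (2 * m) ≤ δ₁ * (2 * m) := by gcongr
    have h4 : 0 ≤ δ₁ * (K : ℝ) := by positivity
    nlinarith
  set D₁ : Set ℝ := Icc 0 1 ∩ Ioo (t₀ - δ₁) (t₀ + δ₁) with hD₁
  have hD₁D : D₁ ⊆ D := fun t ht => ⟨ht.1, by linarith [ht.2.1], by linarith [ht.2.2]⟩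
  set S : Set (ℝ × ℝ × E) := Ioo (-δ₁) δ₁ ×ˢ D₁ ×ˢ Metric.ball x₀ δ₁ with hS
  have hSu : UniqueDiffOn ℝ S := isOpen_Ioo.uniqueDiffOn.prod
    ((uniqueDiffOn_Icc_zero_one.inter isOpen_Ioo).prod Metric.isOpen_ball.uniqueDiffOn)
  set W : Set C(flowTime, E) := Metric.ball (constPath x₀) ρ with hW
  have hWB : ∀ c ∈ W, ∀ r, c r ∈ B := fun c hc r =>
    mem_of_mem_closedBall_const (by rwa [hW, Metric.mem_ball, dist_eq_norm] at hc) r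
  have hTs : ContDiffOn ℝ ∞ (picardMap v) (S ×ˢ W) :=
    (contDiffOn_picardMap hDc (convex_ball _ _) hDu hBu hvQ).mono fun p hp =>
      ⟨⟨mem_univ _, hD₁D hp.1.2.1, mem_univ _⟩, hWB _ hp.2⟩
  have hTL : ∀ p ∈ S, ∀ y ∈ W, ∀ y' ∈ W,
      ‖picardMap v (p, y) - picardMap v (p, y')‖ ≤ 1 / 2 * ‖y - y'‖ := by
    intro p hp y hy y' hy'
    have h1 := norm_superposition_sub_le hLip' (t := p.2.1)
      (fun r => ⟨hD₁D hp.2.1, hWB y hy r⟩) (fun r => ⟨hD₁D hp.2.1, hWB y' hy' r⟩)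
    have h2 : picardMap v (p, y) - picardMap v (p, y') = p.1 • pathIntegral
        (superposition v (parametrizedPath (p.2.1, y)) -
          superposition v (parametrizedPath (p.2.1, y'))) := by
      simp only [picardMap, map_sub, smul_sub]; abel
    rw [h2, norm_smul, Real.norm_eq_abs]
    calc |p.1| * _ ≤ |p.1| * (2 * (K * ‖y - y'‖)) := by
          gcongr
          exact (norm_pathIntegral_le _).trans (by gcongr)
      _ = |p.1| * (2 * K) * ‖y - y'‖ := by ring
      _ ≤ 1 / 2 * ‖y - y'‖ := by gcongr; exact hsK _ hp.1
  have hmaps : ∀ p ∈ S, MapsTo (fun y => picardMap v (p, y))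
      (Metric.closedBall (constPath x₀) (ρ / 2)) (Metric.closedBall (constPath x₀) (ρ / 2)) := by
    intro p hp y hy
    have hyW : y ∈ W := Metric.closedBall_subset_ball (by linarith) hy
    have h1 : ‖superposition v (parametrizedPath (p.2.1, y))‖ ≤ m := by
      refine (ContinuousMap.norm_le _ hm0).2 fun r => ?_
      rw [superposition_apply hvQ.continuousOn
        (fun r => ⟨hD₁D hp.2.1, hWB y hyW r⟩ : parametrizedPath (p.2.1, y) ∈ pathsIn _ (D ×ˢ B))]
      exact hmb _ ⟨hD₁D hp.2.1, hWB y hyW r⟩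
    have h2 : picardMap v (p, y) - constPath x₀ = constPath (p.2.2 - x₀) +
        p.1 • pathIntegral (superposition v (parametrizedPath (p.2.1, y))) := by
      simp only [picardMap, map_sub]; abel
    rw [Metric.mem_closedBall, dist_eq_norm, h2]
    refine (norm_add_le _ _).trans ?_
    have h3 : ‖constPath (p.2.2 - x₀)‖ ≤ ρ / 4 := by
      refine (ContinuousMap.norm_le _ (by positivity)).2 fun r => ?_
      have := hp.2.2
      rw [Metric.mem_ball, dist_eq_norm] at this
      exact this.le.trans hδ₁a
    have h4 : ‖p.1 • pathIntegral (superposition v (parametrizedPath (p.2.1, y)))‖ ≤ ρ / 4 := by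
      rw [norm_smul, Real.norm_eq_abs]
      refine le_trans ?_ (hsm _ hp.1)
      gcongr
      exact (norm_pathIntegral_le _).trans (by gcongr)
    linarith
  have hex : ∀ p, ∃ y : C(flowTime, E), p ∈ S → y ∈ Metric.closedBall (constPath x₀) (ρ / 2) ∧
      picardMap v (p, y) = y := by
    intro p
    by_cases hp : p ∈ S
    · have hcontr : ContractingWith (1 / 2) ((hmaps p hp).restrict _ _ _) := by
        refine ⟨by rw [← NNReal.coe_lt_coe]; norm_num, LipschitzWith.of_dist_le_mul fun a b => ?_⟩
        rw [Subtype.dist_eq, Subtype.dist_eq, dist_eq_norm, dist_eq_norm]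
        refine (hTL p hp a (Metric.closedBall_subset_ball (by linarith) a.2) b
          (Metric.closedBall_subset_ball (by linarith) b.2)).trans (le_of_eq ?_)
        simp
      obtain ⟨y, hy, hyf, -⟩ := hcontr.exists_fixedPoint' Metric.isClosed_closedBall.isComplete
        (hmaps p hp) (Metric.mem_closedBall_self (by positivity)) (edist_ne_top _ _)
      exact ⟨y, fun _ => ⟨hy, hyf⟩⟩
    · exact ⟨0, fun h => absurd h hp⟩
  choose f hf using hex
  have hfW : ∀ p ∈ S, f p ∈ W := fun p hp =>
    Metric.closedBall_subset_ball (by linarith) (hf p hp).1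
  have hfs : ContDiffOn ℝ ∞ f S :=
    contDiffOn_of_fixedPoint hSu Metric.isOpen_ball hTs hTL hfW fun p hp => (hf p hp).2
  have hfr : ∀ p ∈ S, ∀ r : flowTime, f p r = p.2.2 + p.1 • ∫ x in (0 : ℝ)..r,
      IccExtend (by norm_num : (-2 : ℝ) ≤ 2)
        (superposition v (parametrizedPath (p.2.1, f p))) x := fun p hp r => by
    conv_lhs => rw [← (hf p hp).2]
    rfl
  have hsup : ∀ t ∈ D, ∀ y ∈ W, ∀ r, superposition v (parametrizedPath (t, y)) r = v (t, y r) :=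
    fun t ht y hy r => superposition_apply hvQ.continuousOn
      (fun r => ⟨ht, hWB y hy r⟩ : parametrizedPath (t, y) ∈ pathsIn _ (D ×ˢ B)) r
  have hδ0 : 0 < δ₁ / 2 := half_pos hδ₁0
  have hmem : ∀ s ∈ Icc (-(δ₁ / 2)) (δ₁ / 2), ∀ r : flowTime, (r : ℝ) * (s / (δ₁ / 2)) ∈ flowTime := by
    intro s hs r
    have h1 : |(r : ℝ) * (s / (δ₁ / 2))| ≤ 2 * 1 := by
      rw [abs_mul]
      gcongr
      · exact abs_le.2 r.2
      · rw [abs_div, abs_of_pos hδ0, div_le_one hδ0]; exact abs_le.2 hs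
    rw [mul_one] at h1
    exact abs_le.1 h1
  -- The solutions for different `s` are reparametrizations of the one for `s = δ₁/2`: the rescaled
  -- path solves the same fixed point equation, and fixed points in `W` are unique. This turns the
  -- derivative in `s` into the derivative of an integral in its upper limit.
  have key : ∀ s ∈ Icc (-(δ₁ / 2)) (δ₁ / 2), ∀ t ∈ D₁, ∀ x ∈ Metric.ball x₀ δ₁, ∀ r : flowTime,
      ∀ r' : flowTime, (r' : ℝ) = r * (s / (δ₁ / 2)) → f (s, t, x) r = f (δ₁ / 2, t, x) r' := by
    intro s hs t ht x hx r r' hr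
    have hpS : (s, t, x) ∈ S := ⟨⟨by linarith [hs.1], by linarith [hs.2]⟩, ht, hx⟩
    have hqS : (δ₁ / 2, t, x) ∈ S := ⟨⟨by linarith, by linarith⟩, ht, hx⟩
    set y := f (δ₁ / 2, t, x) with hy
    let y' : C(flowTime, E) := ⟨fun r => y ⟨r * (s / (δ₁ / 2)), hmem s hs r⟩, by fun_prop⟩
    have hy'W : y' ∈ W := by
      rw [hW, Metric.mem_ball, dist_eq_norm]
      refine lt_of_le_of_lt ((ContinuousMap.norm_le _ (by positivity)).2 fun r => ?_)
        (half_lt_self hρ)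
      have h1 := (hf _ hqS).1
      rw [Metric.mem_closedBall, dist_eq_norm] at h1
      exact ((y - constPath x₀).norm_coe_le_norm _).trans h1
    have hfix : picardMap v ((s, t, x), y') = y' := by
      ext r
      have h1 : picardMap v ((s, t, x), y') r = x + s • ∫ a in (0 : ℝ)..r,
        IccExtend (by norm_num : (-2 : ℝ) ≤ 2) (superposition v (parametrizedPath (t, y'))) a := rfl
      have h2 : y' r = y ⟨r * (s / (δ₁ / 2)), hmem s hs r⟩ := rfl
      rw [h1, h2, hy, hfr _ hqS]
      congr 1
      have h3 : ∀ a ∈ uIcc (0 : ℝ) r, IccExtend (by norm_num : (-2 : ℝ) ≤ 2)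
          (superposition v (parametrizedPath (t, y'))) a =
          IccExtend (by norm_num : (-2 : ℝ) ≤ 2) (superposition v (parametrizedPath (t, y)))
            (a * (s / (δ₁ / 2))) := by
        intro a ha
        have ha' : a ∈ flowTime := by
          refine uIcc_subset_Icc ?_ r.2 ha
          exact ⟨by norm_num, by norm_num⟩
        rw [IccExtend_of_mem _ _ ha', IccExtend_of_mem _ _ (hmem s hs ⟨a, ha'⟩),
          hsup t (hD₁D ht) y' hy'W, hsup t (hD₁D ht) y (hfW _ hqS)]
        rfl
      rw [intervalIntegral.integral_congr h3]
      have h4 := intervalIntegral.smul_integral_comp_mul_right (a := 0) (b := (r : ℝ))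
        (IccExtend (by norm_num : (-2 : ℝ) ≤ 2) (superposition v (parametrizedPath (t, y))))
        (s / (δ₁ / 2))
      rw [zero_mul] at h4
      simp only
      rw [← h4, smul_smul, mul_div_cancel₀ _ hδ0.ne']
    have huniq : f (s, t, x) = y' := by
      have h1 := hTL _ hpS _ (hfW _ hpS) _ hy'W
      rw [(hf _ hpS).2, hfix] at h1
      have h2 : ‖f (s, t, x) - y'‖ = 0 := by linarith [norm_nonneg (f (s, t, x) - y')]
      exact sub_eq_zero.1 (norm_eq_zero.1 h2)
    rw [huniq]
    exact congrArg y (Subtype.ext hr.symm)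
  have h1mem : (1 : ℝ) ∈ flowTime := ⟨by norm_num, by norm_num⟩
  refine ⟨δ₁ / 2, hδ0, fun p => f p ⟨1, h1mem⟩, ?_, ?_⟩
  · refine ((evalPath ⟨1, h1mem⟩).contDiff.comp_contDiffOn hfs).mono (prod_mono ?_ (prod_mono ?_ ?_))
    · exact Ioo_subset_Ioo (by linarith) (by linarith)
    · exact inter_subset_inter_right _ (Ioo_subset_Ioo (by linarith) (by linarith))
    · exact Metric.ball_subset_ball (by linarith)
  intro s hs t ht x hx
  have ht' : t ∈ D₁ := ⟨ht.1, by linarith [ht.2.1], by linarith [ht.2.2]⟩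
  have hx' : x ∈ Metric.ball x₀ δ₁ := Metric.ball_subset_ball (by linarith) hx
  have hpS : ∀ s ∈ Ioo (-(δ₁ / 2)) (δ₁ / 2), (s, t, x) ∈ S :=
    fun s hs => ⟨⟨by linarith [hs.1], by linarith [hs.2]⟩, ht', hx'⟩
  have hqS : (δ₁ / 2, t, x) ∈ S := ⟨⟨by linarith, by linarith⟩, ht', hx'⟩
  refine ⟨hρV (Metric.ball_subset_ball (min_le_left _ _) (hWB _ (hfW _ (hpS s hs)) _)), ?_, ?_⟩
  · have h0 := hfr _ (hpS 0 ⟨by linarith, hδ0⟩) ⟨1, h1mem⟩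
    simpa using h0
  · set y := f (δ₁ / 2, t, x) with hy
    set g := IccExtend (by norm_num : (-2 : ℝ) ≤ 2) (superposition v (parametrizedPath (t, y)))
      with hg
    have hgc : Continuous g := (superposition v (parametrizedPath (t, y))).continuous.Icc_extend'
    have hdiv : ∀ σ ∈ Ioo (-(δ₁ / 2)) (δ₁ / 2), σ / (δ₁ / 2) ∈ flowTime := fun σ hσ => by
      have := hmem σ ⟨hσ.1.le, hσ.2.le⟩ ⟨1, h1mem⟩
      simpa using this
    have heq : ∀ σ (hσ : σ ∈ Ioo (-(δ₁ / 2)) (δ₁ / 2)),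
        f (σ, t, x) ⟨1, h1mem⟩ = y ⟨σ / (δ₁ / 2), hdiv σ hσ⟩ := fun σ hσ =>
      key σ ⟨hσ.1.le, hσ.2.le⟩ t ht' x hx' _ _ (by simp)
    have heq2 : ∀ σ ∈ Ioo (-(δ₁ / 2)) (δ₁ / 2),
        f (σ, t, x) ⟨1, h1mem⟩ = x + (δ₁ / 2) • ∫ a in (0 : ℝ)..(σ / (δ₁ / 2)), g a := fun σ hσ => by
      rw [heq σ hσ, hy, hfr _ hqS]
    have hgs : g (s / (δ₁ / 2)) = v (t, f (s, t, x) ⟨1, h1mem⟩) := by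
      rw [hg, IccExtend_of_mem _ _ (hdiv s hs), hsup t (hD₁D ht') y (hfW _ hqS), heq s hs]
    have hd1 : HasDerivAt (fun b => ∫ a in (0 : ℝ)..b, g a) (g (s / (δ₁ / 2))) (s / (δ₁ / 2)) :=
      intervalIntegral.integral_hasDerivAt_right (hgc.intervalIntegrable _ _)
        (hgc.stronglyMeasurableAtFilter _ _) hgc.continuousAt
    have hd2 : HasDerivAt (fun σ : ℝ => σ / (δ₁ / 2)) (1 / (δ₁ / 2)) s :=
      (hasDerivAt_id s).div_const _
    have hd3 := ((hd1.scomp s hd2).const_smul (δ₁ / 2)).const_add x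
    rw [smul_smul, mul_one_div_cancel hδ0.ne', one_smul, hgs] at hd3
    refine hd3.congr_of_eventuallyEq ?_
    filter_upwards [isOpen_Ioo.mem_nhds hs] with σ hσ
    exact heq2 σ hσ

end LocalFlow

/-! ### Pull-backs of closed two-forms along families of maps. -/

noncomputable section PullbackCalculus

variable {E Q : Type*} [NormedAddCommGroup E] [NormedSpace ℝ E] [NormedAddCommGroup Q]
  [NormedSpace ℝ Q]

theorem minSmoothness_two_le_infty : minSmoothness ℝ 2 ≤ ∞ := by
  rw [minSmoothness_of_isRCLikeNormedField]
  exact WithTop.coe_le_coe.2 le_top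

theorem HasFDerivWithinAt.apply_const {F G : Type*} [NormedAddCommGroup F] [NormedSpace ℝ F]
    [NormedAddCommGroup G] [NormedSpace ℝ G] {f : E → F →L[ℝ] G} {f' : E →L[ℝ] F →L[ℝ] G}
    {s : Set E} {x : E} (hf : HasFDerivWithinAt f f' s x) (u : F) :
    HasFDerivWithinAt (fun x => f x u) (f'.flip u) s x := by
  simpa using hf.clm_apply (hasFDerivWithinAt_const u x s)

/-- If the contraction of the pull-back of a closed two-form with `∂/∂s` is `dg - k λ` for a
constant one-form `λ`, then its derivative in the direction of `s` is `λ ∧ dk`. -/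
theorem fderivWithin_pullback_closed_two_form {S : Set (ℝ × Q)} (hSu : UniqueDiffOn ℝ S)
    (hSc : S ⊆ closure (interior S)) {V : Set E} (hV : IsOpen V)
    {α : E → E [⋀^Fin 2]→L[ℝ] ℝ} (hα : ContDiffOn ℝ ∞ α V) (hαc : ∀ y ∈ V, extDeriv α y = 0)
    {Ψ : ℝ × Q → E} (hΨ : ContDiffOn ℝ ∞ Ψ S) (hΨV : MapsTo Ψ S V)
    {g k : ℝ × Q → ℝ} (hg : ContDiffOn ℝ ∞ g S) (hk : ContDiffOn ℝ ∞ k S) (l : Q → ℝ)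
    (h : ∀ p ∈ S, ∀ b : Q, α (Ψ p) ![fderivWithin ℝ Ψ S p (1, 0), fderivWithin ℝ Ψ S p (0, b)]
      = fderivWithin ℝ g S p (0, b) - l b * k p) {p : ℝ × Q} (hp : p ∈ S) (a b : Q) :
    DifferentiableWithinAt ℝ (fun p => α (Ψ p) ![fderivWithin ℝ Ψ S p (0, a),
      fderivWithin ℝ Ψ S p (0, b)]) S p ∧
    fderivWithin ℝ (fun p => α (Ψ p) ![fderivWithin ℝ Ψ S p (0, a),
      fderivWithin ℝ Ψ S p (0, b)]) S p (1, 0) =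
      l a * fderivWithin ℝ k S p (0, b) - l b * fderivWithin ℝ k S p (0, a) := by
  set β : ℝ × Q → (ℝ × Q) [⋀^Fin 2]→L[ℝ] ℝ :=
    fun x => (α (Ψ x)).compContinuousLinearMap (fderivWithin ℝ Ψ S x) with hβ
  have hαd : DifferentiableWithinAt ℝ α V (Ψ p) := hα.differentiableOn (by simp) _ (hΨV hp)
  have hβe : extDerivWithin β S p = 0 := by
    have h1 := extDerivWithin_pullback (r := ∞) hαd (hΨ p hp) minSmoothness_two_le_infty hSu (hSc hp) hp hΨV
    have h2 : extDerivWithin α V (Ψ p) = 0 := by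
      rw [← hαc _ (hΨV hp)]
      simp only [extDerivWithin, extDeriv, fderivWithin_of_isOpen hV (hΨV hp)]
    rw [h1, h2]
    ext v; simp
  have hdΨ : ContDiffOn ℝ ∞ (fderivWithin ℝ Ψ S) S := hΨ.fderivWithin hSu (by simp)
  have hβd : DifferentiableWithinAt ℝ β S p := by
    have h1 : DifferentiableWithinAt ℝ (fun x => α (Ψ x)) S p :=
      hαd.comp p (hΨ.differentiableOn (by simp) p hp) hΨV
    exact h1.continuousAlternatingMapCompContinuousLinearMap
      (hdΨ.differentiableOn (by simp) p hp)
  have hβ2 : ∀ x, ∀ u w : ℝ × Q, β x ![u, w] =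
      α (Ψ x) ![fderivWithin ℝ Ψ S x u, fderivWithin ℝ Ψ S x w] := by
    intro x u w
    simp only [hβ, ContinuousAlternatingMap.compContinuousLinearMap_apply]
    congr 1
    ext i; fin_cases i <;> rfl
  have hsum := extDerivWithin_apply hβd (hSu p hp) ![((1 : ℝ), (0 : Q)), (0, a), (0, b)]
  rw [hβe] at hsum
  have r0 : (0 : Fin 3).removeNth ![((1 : ℝ), (0 : Q)), (0, a), (0, b)] = ![(0, a), (0, b)] := by
    ext i <;> fin_cases i <;> rfl
  have r1 : (1 : Fin 3).removeNth ![((1 : ℝ), (0 : Q)), (0, a), (0, b)] = ![(1, 0), (0, b)] := by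
    ext i <;> fin_cases i <;> rfl
  have r2 : (2 : Fin 3).removeNth ![((1 : ℝ), (0 : Q)), (0, a), (0, b)] = ![(1, 0), (0, a)] := by
    ext i <;> fin_cases i <;> rfl
  -- The vanishing of `d(Ψ^*α)` on `(∂_s, a, b)` expresses the sought `s`-derivative through
  -- derivatives of the contraction with `∂_s`. In these the second derivatives of `g` cancel by
  -- symmetry, which at boundary points uses `S ⊆ closure (interior S)`.
  rw [Fin.sum_univ_three, r0, r1, r2] at hsum
  have hdg : ContDiffOn ℝ ∞ (fderivWithin ℝ g S) S := hg.fderivWithin hSu (by simp)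
  have hβs : ∀ u w : Q, fderivWithin ℝ (fun x => β x ![(1, 0), (0, u)]) S p (0, w) =
      fderivWithin ℝ (fderivWithin ℝ g S) S p (0, w) (0, u) - l u * fderivWithin ℝ k S p (0, w) := by
    intro u w
    have h1 : ∀ x ∈ S, β x ![(1, 0), (0, u)] = fderivWithin ℝ g S x (0, u) - l u * k x :=
      fun x hx => by rw [hβ2, h x hx]
    rw [fderivWithin_congr h1 (h1 p hp)]
    have h2 : HasFDerivWithinAt (fun x => fderivWithin ℝ g S x (0, u))
        ((fderivWithin ℝ (fderivWithin ℝ g S) S p).flip (0, u)) S p :=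
      (hdg.differentiableOn (by simp) p hp).hasFDerivWithinAt.apply_const (0, u)
    have h3 : HasFDerivWithinAt (fun x => l u * k x) (l u • fderivWithin ℝ k S p) S p :=
      (hk.differentiableOn (by simp) p hp).hasFDerivWithinAt.const_mul _
    have h4 := (h2.fun_sub h3).fderivWithin (hSu p hp)
    rw [h4]
    simp
  have hsymm := (hg p hp).isSymmSndFDerivWithinAt minSmoothness_two_le_infty hSu (hSc hp) hp
  have hs := hsymm (0, a) (0, b)
  constructor
  · have h1 := hβd.continuousAlternatingMap_apply_const ![(0, a), (0, b)]
    refine h1.congr (fun x _ => (hβ2 x _ _).symm) (hβ2 p _ _).symm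
  · have h1 : (fun x => α (Ψ x) ![fderivWithin ℝ Ψ S x (0, a), fderivWithin ℝ Ψ S x (0, b)])
        = fun x => β x ![(0, a), (0, b)] := funext fun x => (hβ2 x _ _).symm
    rw [h1]
    simp only [Matrix.cons_val_zero, Matrix.cons_val_one, Matrix.cons_val_two, Matrix.head_cons,
      Matrix.tail_cons] at hsum
    rw [hβs, hβs] at hsum
    simp at hsum
    linarith

theorem fderivWithin_prod_inr {F : Type*} [NormedAddCommGroup F] [NormedSpace ℝ F]
    {J : Set ℝ} {A : Set Q} (hA : UniqueDiffOn ℝ A) {f : ℝ × Q → F}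
    {s : ℝ} (hs : s ∈ J) {q : Q} (hq : q ∈ A) (hf : DifferentiableWithinAt ℝ f (J ×ˢ A) (s, q))
    {f' : Q →L[ℝ] F} (hf' : HasFDerivWithinAt (fun x => f (s, x)) f' A q) (b : Q) :
    fderivWithin ℝ f (J ×ˢ A) (s, q) (0, b) = f' b := by
  have h1 : HasFDerivWithinAt (fun x => f (s, x))
      ((fderivWithin ℝ f (J ×ˢ A) (s, q)).comp (ContinuousLinearMap.inr ℝ ℝ Q)) A q :=
    hf.hasFDerivWithinAt.comp (f := fun x => (s, x)) q
      (hasFDerivAt_prodMk_right s q).hasFDerivWithinAt fun x hx => ⟨hs, hx⟩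
  have h2 := (hA q hq).eq h1 hf'
  rw [← h2]; simp

theorem hasDerivWithinAt_prod_inl {F : Type*} [NormedAddCommGroup F] [NormedSpace ℝ F]
    {J : Set ℝ} {A : Set Q} {f : ℝ × Q → F}
    {s : ℝ} {q : Q} (hq : q ∈ A) (hf : DifferentiableWithinAt ℝ f (J ×ˢ A) (s, q)) :
    HasDerivWithinAt (fun σ => f (σ, q)) (fderivWithin ℝ f (J ×ˢ A) (s, q) (1, 0)) J s := by
  have h1 : HasFDerivWithinAt (fun σ => f (σ, q))
      ((fderivWithin ℝ f (J ×ˢ A) (s, q)).comp (ContinuousLinearMap.inl ℝ ℝ Q)) J s :=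
    hf.hasFDerivWithinAt.comp (f := fun σ => (σ, q)) s
      (hasFDerivAt_prodMk_left s q).hasFDerivWithinAt fun x hx => ⟨hx, hq⟩
  simpa using h1.hasDerivWithinAt

/-- With `z_s` the primitive of `k` in `s`, the `s`-derivative `λ ∧ dk` of `Ψ_s^*α` is that of `λ ∧
dz_s`. So `Ψ_s^*α - λ ∧ dz_s` is constant in `s`, and at `s = 0` it equals `π^*α`. It will be used
with `λ = dt`, for a flow that carries `t` as a variable. -/
theorem pullback_flow_two_form {δ : ℝ} (hδ : 0 < δ) {A : Set Q} (hAc : Convex ℝ A)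
    (hAi : (interior A).Nonempty) {V : Set E} (hV : IsOpen V)
    {α : E → E [⋀^Fin 2]→L[ℝ] ℝ} (hα : ContDiffOn ℝ ∞ α V) (hαc : ∀ y ∈ V, extDeriv α y = 0)
    {Ψ : ℝ × Q → E} (hΨ : ContDiffOn ℝ ∞ Ψ (Ioo (-δ) δ ×ˢ A)) (hΨV : MapsTo Ψ (Ioo (-δ) δ ×ˢ A) V)
    {g k z : ℝ × Q → ℝ} (hg : ContDiffOn ℝ ∞ g (Ioo (-δ) δ ×ˢ A))
    (hk : ContDiffOn ℝ ∞ k (Ioo (-δ) δ ×ˢ A)) (hz : ContDiffOn ℝ ∞ z (Ioo (-δ) δ ×ˢ A)) (l : Q → ℝ)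
    (h : ∀ p ∈ Ioo (-δ) δ ×ˢ A, ∀ b : Q, α (Ψ p) ![fderivWithin ℝ Ψ (Ioo (-δ) δ ×ˢ A) p (1, 0),
      fderivWithin ℝ Ψ (Ioo (-δ) δ ×ˢ A) p (0, b)]
      = fderivWithin ℝ g (Ioo (-δ) δ ×ˢ A) p (0, b) - l b * k p)
    (hzk : ∀ p ∈ Ioo (-δ) δ ×ˢ A, fderivWithin ℝ z (Ioo (-δ) δ ×ˢ A) p (1, 0) = k p)
    (π : Q →L[ℝ] E) (hΨ0 : ∀ q ∈ A, Ψ (0, q) = π q) (hz0 : ∀ q ∈ A, z (0, q) = 0)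
    {s : ℝ} (hs : s ∈ Ioo (-δ) δ) {q : Q} (hq : q ∈ A) (a b : Q) :
    α (Ψ (s, q)) ![fderivWithin ℝ Ψ (Ioo (-δ) δ ×ˢ A) (s, q) (0, a),
      fderivWithin ℝ Ψ (Ioo (-δ) δ ×ˢ A) (s, q) (0, b)] =
    α (π q) ![π a, π b] + l a * fderivWithin ℝ z (Ioo (-δ) δ ×ˢ A) (s, q) (0, b)
      - l b * fderivWithin ℝ z (Ioo (-δ) δ ×ˢ A) (s, q) (0, a) := by
  set S := Ioo (-δ) δ ×ˢ A with hS
  have hAu : UniqueDiffOn ℝ A := uniqueDiffOn_convex hAc hAi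
  have hSi : (interior S).Nonempty := by
    rw [hS, interior_prod_eq, isOpen_Ioo.interior_eq]
    exact (nonempty_Ioo.2 (by linarith)).prod hAi
  have hScv : Convex ℝ S := (convex_Ioo _ _).prod hAc
  have hSu : UniqueDiffOn ℝ S := uniqueDiffOn_convex hScv hSi
  have hSc : S ⊆ closure (interior S) := by
    rw [hScv.closure_interior_eq_closure_of_nonempty_interior hSi]; exact subset_closure
  have hdz : ContDiffOn ℝ ∞ (fderivWithin ℝ z S) S := hz.fderivWithin hSu (by simp)
  have hz2 : ∀ p ∈ S, ∀ b, fderivWithin ℝ (fderivWithin ℝ z S) S p (1, 0) (0, b) =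
      fderivWithin ℝ k S p (0, b) := by
    intro p hp b
    have hsymm := (hz p hp).isSymmSndFDerivWithinAt minSmoothness_two_le_infty hSu (hSc hp) hp
    rw [hsymm (1, 0) (0, b)]
    have h2 : HasFDerivWithinAt (fun x => fderivWithin ℝ z S x (1, 0))
        ((fderivWithin ℝ (fderivWithin ℝ z S) S p).flip (1, 0)) S p :=
      (hdz.differentiableOn (by simp) p hp).hasFDerivWithinAt.apply_const _
    have h3 := h2.fderivWithin (hSu p hp)
    rw [fderivWithin_congr (fun x hx => hzk x hx) (hzk p hp)] at h3
    rw [h3]; rfl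
  set f : ℝ × Q → ℝ := fun p => α (Ψ p) ![fderivWithin ℝ Ψ S p (0, a), fderivWithin ℝ Ψ S p (0, b)]
    - l a * fderivWithin ℝ z S p (0, b) + l b * fderivWithin ℝ z S p (0, a) with hf
  have hfd : ∀ p ∈ S, DifferentiableWithinAt ℝ f S p ∧ fderivWithin ℝ f S p (1, 0) = 0 := by
    intro p hp
    obtain ⟨h1, h2⟩ := fderivWithin_pullback_closed_two_form hSu hSc hV hα hαc hΨ hΨV hg hk l h hp a b
    have h3 : ∀ b : Q, HasFDerivWithinAt (fun x => fderivWithin ℝ z S x (0, b))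
        ((fderivWithin ℝ (fderivWithin ℝ z S) S p).flip (0, b)) S p := fun b =>
      (hdz.differentiableOn (by simp) p hp).hasFDerivWithinAt.apply_const _
    have h4 := (h1.hasFDerivWithinAt.sub ((h3 b).const_mul (l a))).add ((h3 a).const_mul (l b))
    refine ⟨h4.differentiableWithinAt, ?_⟩
    have h5 := h4.fderivWithin (hSu p hp)
    have h6 : fderivWithin ℝ f S p = _ := h5
    rw [h6]
    simp only [add_apply, sub_apply,
      smul_apply, ContinuousLinearMap.flip_apply, smul_eq_mul]
    rw [h2, hz2 p hp, hz2 p hp]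
    ring
  have hconst : f (s, q) = f (0, q) := by
    have h0 : (0 : ℝ) ∈ Ioo (-δ) δ := ⟨by linarith, hδ⟩
    have hd : ∀ σ ∈ Ioo (-δ) δ, HasDerivAt (fun σ => f (σ, q)) 0 σ := by
      intro σ hσ
      have h1 := hasDerivWithinAt_prod_inl hq (hfd (σ, q) ⟨hσ, hq⟩).1
      rw [(hfd (σ, q) ⟨hσ, hq⟩).2] at h1
      exact h1.hasDerivAt (isOpen_Ioo.mem_nhds hσ)
    exact isOpen_Ioo.is_const_of_deriv_eq_zero isPreconnected_Ioo
      (fun σ hσ => (hd σ hσ).differentiableAt.differentiableWithinAt)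
      (fun σ hσ => (hd σ hσ).deriv) hs h0
  have h0 : (0 : ℝ) ∈ Ioo (-δ) δ := ⟨by linarith, hδ⟩
  have hf0 : f (0, q) = α (π q) ![π a, π b] := by
    have hΨd : ∀ b, fderivWithin ℝ Ψ S (0, q) (0, b) = π b := fun b =>
      fderivWithin_prod_inr hAu h0 hq (hΨ.differentiableOn (by simp) (0, q) ⟨h0, hq⟩)
        (π.hasFDerivWithinAt.congr (fun x hx => hΨ0 x hx) (hΨ0 q hq)) b
    have hzd : ∀ b, fderivWithin ℝ z S (0, q) (0, b) = 0 := fun b => by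
      have := fderivWithin_prod_inr hAu h0 hq (hz.differentiableOn (by simp) (0, q) ⟨h0, hq⟩)
        ((hasFDerivWithinAt_const (0 : ℝ) q A).congr (fun x hx => hz0 x hx) (hz0 q hq)) b
      simpa using this
    simp only [hf, hΨd, hzd, hΨ0 q hq]
    ring
  rw [hf0] at hconst
  simp only [hf] at hconst
  linarith

end PullbackCalculus

/-! ### Symplectic forms and Hamiltonian vector fields in charts. -/

noncomputable section ChartExpressions

variable {E : Type*} [NormedAddCommGroup E] [NormedSpace ℝ E]
variable {M : Type*} [TopologicalSpace M] [ChartedSpace E M]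

/-- A two-form as a bounded bilinear map. -/
def twoFormFlat : (E [⋀^Fin 2]→L[ℝ] ℝ) → (E →L[ℝ] E →L[ℝ] ℝ) := fun β =>
  have h₀ (v w u : E) : Function.update ![v, w] 0 u = ![u, w] := by
    ext i; fin_cases i <;> rfl
  have h₁ (v w u : E) : Function.update ![v, w] 1 u = ![v, u] := by
    ext i; fin_cases i <;> rfl
  LinearMap.mkContinuous₂
    (LinearMap.mk₂ ℝ (fun v w => β ![v, w])
      (fun v v' w => by
        have h := β.toAlternatingMap.map_update_add ![v, w] 0 v v'
        rwa [h₀, h₀, h₀] at h)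
      (fun c v w => by
        have h := β.toAlternatingMap.map_update_smul ![v, w] 0 c v
        rwa [h₀, h₀] at h)
      (fun v w w' => by
        have h := β.toAlternatingMap.map_update_add ![v, w] 1 w w'
        rwa [h₁, h₁, h₁] at h)
      (fun c v w => by
        have h := β.toAlternatingMap.map_update_smul ![v, w] 1 c w
        rwa [h₁, h₁] at h)) ‖β‖
    (fun v w => by
      have h := β.le_opNorm ![v, w]
      simpa [Fin.prod_univ_two, mul_assoc] using h)

@[simp] theorem twoFormFlat_apply (β : E [⋀^Fin 2]→L[ℝ] ℝ) (v w : E) :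
    twoFormFlat β v w = β ![v, w] := rfl

theorem contDiffOn_twoFormFlat [FiniteDimensional ℝ E] {F : Type*} [NormedAddCommGroup F]
    [NormedSpace ℝ F] {α : F → E [⋀^Fin 2]→L[ℝ] ℝ} {s : Set F} {n : ℕ∞ω}
    (hα : ContDiffOn ℝ n α s) : ContDiffOn ℝ n (fun y => twoFormFlat (α y)) s := by
  rw [contDiffOn_clm_apply]
  intro v
  rw [contDiffOn_clm_apply]
  intro w
  exact (ContinuousAlternatingMap.apply ℝ E ℝ ![v, w]).contDiff.comp_contDiffOn hα

section Atlas

variable [IsManifold 𝓘(ℝ, E) ∞ M] {e : OpenPartialHomeomorph M E}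

theorem mfderiv_atlas_symm_comp (he : e ∈ atlas E M) {y : E} (hy : y ∈ e.target)
    (v : TangentSpace 𝓘(ℝ, E) (e.symm y)) :
    (mfderiv 𝓘(ℝ, E) 𝓘(ℝ, E) e.symm y) (mfderiv 𝓘(ℝ, E) 𝓘(ℝ, E) e (e.symm y) v) = v := by
  have : IsManifold 𝓘(ℝ, E) 1 M := IsManifold.of_le (n := ∞) (by simp)
  have h := (mdifferentiable_of_mem_atlas (I := 𝓘(ℝ, E)) he).symm_comp_deriv (e.map_target hy)
  rw [e.right_inv hy] at h
  exact congrArg (fun L : TangentSpace 𝓘(ℝ, E) (e.symm y) →L[ℝ] TangentSpace 𝓘(ℝ, E) (e.symm y) =>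
    L v) h

theorem mfderiv_atlas_comp_symm (he : e ∈ atlas E M) {y : E} (hy : y ∈ e.target) (v : E) :
    mfderiv 𝓘(ℝ, E) 𝓘(ℝ, E) e (e.symm y) (mfderiv 𝓘(ℝ, E) 𝓘(ℝ, E) e.symm y v) = v := by
  have : IsManifold 𝓘(ℝ, E) 1 M := IsManifold.of_le (n := ∞) (by simp)
  have h := (mdifferentiable_of_mem_atlas (I := 𝓘(ℝ, E)) he).comp_symm_deriv hy
  exact congrArg (fun L : E →L[ℝ] E => L v) h

theorem hasMFDerivAt_atlas (he : e ∈ atlas E M) {x : M} (hx : x ∈ e.source) :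
    HasMFDerivAt 𝓘(ℝ, E) 𝓘(ℝ, E) e x (mfderiv 𝓘(ℝ, E) 𝓘(ℝ, E) e x) :=
  have : IsManifold 𝓘(ℝ, E) 1 M := IsManifold.of_le (n := ∞) (by simp)
  (mdifferentiableAt_atlas he hx).hasMFDerivAt

theorem hasMFDerivAt_atlas_symm (he : e ∈ atlas E M) {y : E} (hy : y ∈ e.target) :
    HasMFDerivAt 𝓘(ℝ, E) 𝓘(ℝ, E) e.symm y (mfderiv 𝓘(ℝ, E) 𝓘(ℝ, E) e.symm y) :=
  have : IsManifold 𝓘(ℝ, E) 1 M := IsManifold.of_le (n := ∞) (by simp)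
  (mdifferentiableAt_atlas_symm he hy).hasMFDerivAt

theorem chartForm_apply (form : ∀ x : M, TangentSpace 𝓘(ℝ, E) x [⋀^Fin 2]→L[ℝ] ℝ)
    (e : OpenPartialHomeomorph M E) (y v w : E) :
    chartForm form e y ![v, w] = form (e.symm y)
      ![mfderiv 𝓘(ℝ, E) 𝓘(ℝ, E) e.symm y v, mfderiv 𝓘(ℝ, E) 𝓘(ℝ, E) e.symm y w] := by
  refine congrArg (form (e.symm y)) (funext fun i => ?_)
  fin_cases i <;> rfl

theorem hasDerivWithinAt_of_hasMFDerivWithinAt {F : Type*} [NormedAddCommGroup F]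
    [NormedSpace ℝ F] {f : ℝ → F} {s : Set ℝ} {t : ℝ} {w : F}
    (h : HasMFDerivWithinAt 𝓘(ℝ, ℝ) 𝓘(ℝ, F) f s t
      ((1 : ℝ →L[ℝ] ℝ).smulRight w : ℝ →L[ℝ] F)) : HasDerivWithinAt f w s t := by
  have h1 : HasFDerivWithinAt f ((1 : ℝ →L[ℝ] ℝ).smulRight w) s t :=
    hasMFDerivWithinAt_iff_hasFDerivWithinAt.1 h
  simpa using h1.hasDerivWithinAt

/-- A curve with given velocity, read in a chart. -/
theorem hasDerivWithinAt_chart_comp (he : e ∈ atlas E M) {c : ℝ → M} {s : Set ℝ} {t : ℝ}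
    {v : TangentSpace 𝓘(ℝ, E) (c t)} (hct : c t ∈ e.source)
    (hc : HasMFDerivWithinAt 𝓘(ℝ, ℝ) 𝓘(ℝ, E) c s t ((1 : ℝ →L[ℝ] ℝ).smulRight v)) :
    HasDerivWithinAt (F := E) (e ∘ c) (mfderiv 𝓘(ℝ, E) 𝓘(ℝ, E) e (c t) v) s t := by
  have h := (hasMFDerivAt_atlas he hct).comp_hasMFDerivWithinAt t hc
  obtain ⟨w, hw⟩ : ∃ w : E, mfderiv 𝓘(ℝ, E) 𝓘(ℝ, E) e (c t) v = w := ⟨_, rfl⟩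
  rw [hw]
  have key : HasMFDerivWithinAt (M' := E) 𝓘(ℝ, ℝ) 𝓘(ℝ, E) (e ∘ c) s t
      ((1 : ℝ →L[ℝ] ℝ).smulRight w : ℝ →L[ℝ] E) := by
    refine h.congr_mfderiv ?_
    ext
    exact (congrArg (mfderiv 𝓘(ℝ, E) 𝓘(ℝ, E) e (c t)) (one_smul ℝ v)).trans
      (hw.trans (one_smul ℝ w).symm)
  exact hasDerivWithinAt_of_hasMFDerivWithinAt key

theorem hasMFDerivWithinAt_symm_comp (he : e ∈ atlas E M) {c : ℝ → E} {s : Set ℝ} {t : ℝ}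
    {v : E} (hct : c t ∈ e.target) (hc : HasDerivWithinAt c v s t) :
    HasMFDerivWithinAt 𝓘(ℝ, ℝ) 𝓘(ℝ, E) (e.symm ∘ c) s t
      ((1 : ℝ →L[ℝ] ℝ).smulRight (mfderiv 𝓘(ℝ, E) 𝓘(ℝ, E) e.symm (c t) v)) := by
  have h1 : HasMFDerivWithinAt 𝓘(ℝ, ℝ) 𝓘(ℝ, E) c s t ((1 : ℝ →L[ℝ] ℝ).smulRight v) :=
    hasMFDerivWithinAt_iff_hasFDerivWithinAt.2 hc.hasFDerivWithinAt
  have h := (hasMFDerivAt_atlas_symm he hct).comp_hasMFDerivWithinAt t h1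
  refine h.congr_mfderiv ?_
  ext
  exact (congrArg (mfderiv 𝓘(ℝ, E) 𝓘(ℝ, E) e.symm (c t)) (one_smul ℝ v)).trans
    (one_smul ℝ (mfderiv 𝓘(ℝ, E) 𝓘(ℝ, E) e.symm (c t) v)).symm

/-- A family of functions on `M`, read in a chart. -/
theorem contDiffOn_family_chart {N : Type*} [NormedAddCommGroup N] [NormedSpace ℝ N]
    (he : e ∈ atlas E M) {F : ℝ × M → N} {T : Set ℝ} {U : Set M}
    (hF : ContMDiffOn (𝓘(ℝ, ℝ).prod 𝓘(ℝ, E)) 𝓘(ℝ, N) ∞ F (T ×ˢ U)) :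
    ContDiffOn ℝ ∞ (fun p : ℝ × E => F (p.1, e.symm p.2)) (T ×ˢ (e.target ∩ e.symm ⁻¹' U)) := by
  rw [← contMDiffOn_iff_contDiffOn]
  have hs : ContMDiffOn 𝓘(ℝ, E) 𝓘(ℝ, E) ∞ e.symm e.target :=
    contMDiffOn_symm_of_mem_maximalAtlas (IsManifold.subset_maximalAtlas he)
  have h2 : ContMDiffOn 𝓘(ℝ, ℝ × E) (𝓘(ℝ, ℝ).prod 𝓘(ℝ, E)) ∞
      (fun p : ℝ × E => (p.1, e.symm p.2)) (T ×ˢ (e.target ∩ e.symm ⁻¹' U)) :=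
    contDiff_fst.contMDiff.contMDiffOn.prodMk
      (hs.comp contDiff_snd.contMDiff.contMDiffOn fun p hp => hp.2.1)
  exact hF.comp h2 fun p hp => ⟨hp.1, hp.2.2⟩

/-- A map defined in a chart, as a map on `M`. -/
theorem contMDiffOn_family_of_chart {N : Type*} [NormedAddCommGroup N] [NormedSpace ℝ N]
    (he : e ∈ atlas E M) {F : ℝ × E → N} {T : Set ℝ} {U : Set E}
    (hF : ContDiffOn ℝ ∞ F (T ×ˢ U)) :
    ContMDiffOn (𝓘(ℝ, ℝ).prod 𝓘(ℝ, E)) 𝓘(ℝ, N) ∞ (fun p : ℝ × M => F (p.1, e p.2))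
      (T ×ˢ (e.source ∩ e ⁻¹' U)) := by
  rw [← contMDiffOn_iff_contDiffOn] at hF
  have hs : ContMDiffOn 𝓘(ℝ, E) 𝓘(ℝ, E) ∞ e e.source :=
    contMDiffOn_of_mem_maximalAtlas (IsManifold.subset_maximalAtlas he)
  have h2 : ContMDiffOn (𝓘(ℝ, ℝ).prod 𝓘(ℝ, E)) 𝓘(ℝ, ℝ × E) ∞
      (fun p : ℝ × M => (p.1, e p.2)) (T ×ˢ (e.source ∩ e ⁻¹' U)) :=
    contMDiffOn_fst.prodMk_space (hs.comp contMDiffOn_snd fun p hp => hp.2.1)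
  exact hF.comp h2 fun p hp => ⟨hp.1, hp.2.2⟩

end Atlas

section Hamiltonian

variable [FiniteDimensional ℝ E] [IsManifold 𝓘(ℝ, E) ∞ M] (Ω : SymplecticForm E M)
  {e : OpenPartialHomeomorph M E}

/-- The Hamiltonian vector field of `F` in the chart `e`. -/
def hamChart (F : M → ℝ) (e : OpenPartialHomeomorph M E) (y : E) : E :=
  mfderiv 𝓘(ℝ, E) 𝓘(ℝ, E) e (e.symm y) (Ω.hamVectorField F (e.symm y))

theorem mfderiv_symm_hamChart (he : e ∈ atlas E M) (F : M → ℝ) {y : E} (hy : y ∈ e.target) :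
    mfderiv 𝓘(ℝ, E) 𝓘(ℝ, E) e.symm y (hamChart (E := E) Ω F e y) = Ω.hamVectorField F (e.symm y) :=
  mfderiv_atlas_symm_comp he hy _

theorem chartForm_hamChart (he : e ∈ atlas E M) {F : M → ℝ} {y : E} (hy : y ∈ e.target)
    (hF : MDifferentiableAt 𝓘(ℝ, E) 𝓘(ℝ, ℝ) F (e.symm y)) (w : E) :
    chartForm Ω.form e y ![hamChart Ω F e y, w] = fderiv ℝ (F ∘ e.symm) y w := by
  rw [chartForm_apply, mfderiv_symm_hamChart Ω he F hy, Ω.form_hamVectorField]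
  have h := hF.hasMFDerivAt.comp y (hasMFDerivAt_atlas_symm he hy)
  have h2 := h.mfderiv
  rw [mfderiv_eq_fderiv] at h2
  exact (congrArg (fun L : E →L[ℝ] ℝ => L w) h2).symm

theorem chartForm_nondegenerate (he : e ∈ atlas E M) {y : E} (hy : y ∈ e.target) {v : E}
    (hv : ∀ w, chartForm Ω.form e y ![v, w] = 0) : v = 0 := by
  have h0 : mfderiv 𝓘(ℝ, E) 𝓘(ℝ, E) e.symm y v = 0 := by
    refine Ω.nondegenerate (e.symm y) _ fun w => ?_
    have h := (chartForm_apply Ω.form e y v _).symm.trans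
      (hv (mfderiv 𝓘(ℝ, E) 𝓘(ℝ, E) e (e.symm y) w))
    rwa [mfderiv_atlas_symm_comp he hy w] at h
  have h1 := mfderiv_atlas_comp_symm he hy v
  rw [← h1, h0]
  exact map_zero _

/-- The chart expression of a symplectic form, as an isomorphism with the dual space. -/
def chartFlatEquiv (he : e ∈ atlas E M) {y : E} (hy : y ∈ e.target) : E ≃L[ℝ] (E →L[ℝ] ℝ) :=
  (LinearEquiv.ofInjectiveOfFinrankEq (twoFormFlat (chartForm Ω.form e y)).toLinearMap
    (by
      rw [injective_iff_map_eq_zero]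
      intro v hv
      refine chartForm_nondegenerate Ω he hy fun w => ?_
      exact congrArg (fun L : E →L[ℝ] ℝ => L w) hv)
    (by
      rw [← (LinearMap.toContinuousLinearMap (𝕜 := ℝ) (E := E) (F' := ℝ)).finrank_eq]
      exact (Subspace.dual_finrank_eq (K := ℝ) (V := E)).symm)).toContinuousLinearEquiv

theorem coe_chartFlatEquiv (he : e ∈ atlas E M) {y : E} (hy : y ∈ e.target) :
    (chartFlatEquiv Ω he hy : E →L[ℝ] (E →L[ℝ] ℝ)) = twoFormFlat (chartForm Ω.form e y) := by
  ext v w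
  rfl

/-- Writing the field through `ContinuousLinearMap.inverse` reduces its smoothness to smoothness of
operator inversion. -/
theorem hamChart_eq (he : e ∈ atlas E M) {F : M → ℝ} {y : E} (hy : y ∈ e.target)
    (hF : MDifferentiableAt 𝓘(ℝ, E) 𝓘(ℝ, ℝ) F (e.symm y)) :
    hamChart Ω F e y =
      (twoFormFlat (chartForm Ω.form e y)).inverse (fderiv ℝ (F ∘ e.symm) y) := by
  rw [← coe_chartFlatEquiv Ω he hy, ContinuousLinearMap.inverse_equiv]
  have h : chartFlatEquiv Ω he hy (hamChart Ω F e y) = fderiv ℝ (F ∘ e.symm) y := by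
    ext w
    exact chartForm_hamChart Ω he hy hF w
  rw [← h]
  exact ((chartFlatEquiv Ω he hy).symm_apply_apply _).symm

theorem eq_hamChart_of_forall (he : e ∈ atlas E M) {F : M → ℝ} {y : E} (hy : y ∈ e.target)
    (hF : MDifferentiableAt 𝓘(ℝ, E) 𝓘(ℝ, ℝ) F (e.symm y)) {v : E}
    (hv : ∀ w, chartForm Ω.form e y ![v, w] = fderiv ℝ (F ∘ e.symm) y w) :
    v = hamChart Ω F e y := by
  rw [← sub_eq_zero]
  refine chartForm_nondegenerate Ω he hy fun w => ?_
  have h : twoFormFlat (chartForm Ω.form e y) (v - hamChart Ω F e y) w = 0 := by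
    rw [map_sub, sub_apply, twoFormFlat_apply, twoFormFlat_apply, hv,
      chartForm_hamChart Ω he hy hF, sub_self]
  exact h

/-- The time slices of a smooth family are smooth. -/
theorem contMDiff_slice {F : ℝ → M → ℝ} {T : Set ℝ}
    (hF : ContMDiffOn (𝓘(ℝ, ℝ).prod 𝓘(ℝ, E)) 𝓘(ℝ, ℝ) ∞ (fun p : ℝ × M => F p.1 p.2) (T ×ˢ univ))
    {t : ℝ} (ht : t ∈ T) : ContMDiff 𝓘(ℝ, E) 𝓘(ℝ, ℝ) ∞ (F t) := by
  have h2 : ContMDiff 𝓘(ℝ, E) (𝓘(ℝ, ℝ).prod 𝓘(ℝ, E)) ∞ fun x : M => (t, x) :=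
    contMDiff_const.prodMk contMDiff_id
  exact hF.comp_contMDiff h2 fun x => ⟨ht, mem_univ _⟩

theorem fderiv_slice_eq {N : Type*} [NormedAddCommGroup N] [NormedSpace ℝ N]
    {F : ℝ × E → N} {T : Set ℝ} {V : Set E} (hV : IsOpen V)
    {t : ℝ} {y : E} (ht : t ∈ T) (hy : y ∈ V)
    (hF : DifferentiableWithinAt ℝ F (T ×ˢ V) (t, y)) (w : E) :
    fderiv ℝ (fun y => F (t, y)) y w = fderivWithin ℝ F (T ×ˢ V) (t, y) (0, w) := by
  have h1 : HasFDerivWithinAt (fun x => F (t, x))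
      ((fderivWithin ℝ F (T ×ˢ V) (t, y)).comp (ContinuousLinearMap.inr ℝ ℝ E)) V y :=
    hF.hasFDerivWithinAt.comp (f := fun x => (t, x)) y
      (hasFDerivAt_prodMk_right t y).hasFDerivWithinAt fun x hx => ⟨ht, hx⟩
  rw [(h1.hasFDerivAt (hV.mem_nhds hy)).fderiv]
  simp

/-- Joint smoothness in time and space: the spatial differential is a component of the derivative
within `T ×ˢ e.target`, and inversion of operators is smooth at isomorphisms. -/
theorem contDiffOn_hamChart (he : e ∈ atlas E M) {F : ℝ → M → ℝ} {T : Set ℝ}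
    (hT : UniqueDiffOn ℝ T)
    (hF : ContMDiffOn (𝓘(ℝ, ℝ).prod 𝓘(ℝ, E)) 𝓘(ℝ, ℝ) ∞ (fun p : ℝ × M => F p.1 p.2)
      (T ×ˢ univ)) :
    ContDiffOn ℝ ∞ (fun p : ℝ × E => hamChart Ω (F p.1) e p.2) (T ×ˢ e.target) := by
  have hFc : ContDiffOn ℝ ∞ (fun p : ℝ × E => F p.1 (e.symm p.2)) (T ×ˢ e.target) := by
    simpa using contDiffOn_family_chart he hF
  have hTu : UniqueDiffOn ℝ (T ×ˢ e.target) := hT.prod e.open_target.uniqueDiffOn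
  have hd : ContDiffOn ℝ ∞ (fun p => (fderivWithin ℝ (fun p : ℝ × E => F p.1 (e.symm p.2))
      (T ×ˢ e.target) p).comp (ContinuousLinearMap.inr ℝ ℝ E)) (T ×ˢ e.target) :=
    (hFc.fderivWithin hTu (by simp)).clm_comp contDiffOn_const
  have hα : ContDiffOn ℝ ∞ (fun p : ℝ × E => twoFormFlat (chartForm Ω.form e p.2))
      (T ×ˢ e.target) :=
    (contDiffOn_twoFormFlat (Ω.smooth e he)).comp contDiffOn_snd fun p hp => hp.2
  have hi : ContDiffOn ℝ ∞ (fun p : ℝ × E => (twoFormFlat (chartForm Ω.form e p.2)).inverse)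
      (T ×ˢ e.target) := by
    intro p hp
    have h1 := contDiffAt_map_inverse (𝕜 := ℝ) (n := ∞) (chartFlatEquiv Ω he hp.2)
    rw [coe_chartFlatEquiv] at h1
    exact h1.comp_contDiffWithinAt p (hα p hp)
  refine (hi.clm_apply hd).congr fun p hp => ?_
  have hm : MDifferentiableAt 𝓘(ℝ, E) 𝓘(ℝ, ℝ) (F p.1) (e.symm p.2) :=
    (contMDiff_slice hF hp.1).mdifferentiable (by simp) _
  rw [hamChart_eq Ω he hp.2 hm]
  congr 1
  ext w
  exact fderiv_slice_eq e.open_target hp.1 hp.2 (hFc.differentiableOn (by simp) p hp) w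

/-- Hamiltonian vector fields of smooth functions are smooth. -/
theorem contMDiff_hamVectorField {F : M → ℝ} (hF : ContMDiff 𝓘(ℝ, E) 𝓘(ℝ, ℝ) ∞ F) :
    ContMDiff 𝓘(ℝ, E) 𝓘(ℝ, E).tangent 1
      (fun x => (⟨x, Ω.hamVectorField F x⟩ : TangentBundle 𝓘(ℝ, E) M)) := by
  have : IsManifold 𝓘(ℝ, E) 1 M := IsManifold.of_le (n := ∞) (by simp)
  intro x₀
  have he : chartAt E x₀ ∈ atlas E M := chart_mem_atlas E x₀
  rw [Bundle.contMDiffAt_section]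
  have h1 := contDiffOn_hamChart Ω he (F := fun _ => F) (T := univ) uniqueDiffOn_univ
    (hF.comp contMDiff_snd).contMDiffOn
  have h2 : ContDiffOn ℝ ∞ (fun y => hamChart Ω F (chartAt E x₀) y) (chartAt E x₀).target :=
    h1.comp (f := fun y => ((0 : ℝ), y)) (contDiffOn_const.prodMk contDiffOn_id)
      fun y hy => ⟨mem_univ _, hy⟩
  have h3 : ContMDiffAt 𝓘(ℝ, E) 𝓘(ℝ, E) 1 (fun x => hamChart Ω F (chartAt E x₀) (chartAt E x₀ x))
      x₀ := by
    have h4 : ContMDiffAt 𝓘(ℝ, E) 𝓘(ℝ, E) 1 (chartAt E x₀) x₀ :=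
      (contMDiffOn_chart (n := 1)).contMDiffAt ((chartAt E x₀).open_source.mem_nhds
        (mem_chart_source E x₀))
    have h5 : ContMDiffAt 𝓘(ℝ, E) 𝓘(ℝ, E) 1 (fun y => hamChart Ω F (chartAt E x₀) y)
        (chartAt E x₀ x₀) :=
      ((h2.contDiffAt ((chartAt E x₀).open_target.mem_nhds (mem_chart_target E x₀))).of_le
        (by simp)).contMDiffAt
    exact h5.comp x₀ h4
  refine h3.congr_of_eventuallyEq ?_
  filter_upwards [(chartAt E x₀).open_source.mem_nhds (mem_chart_source E x₀)] with x hx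
  have h6 := TangentBundle.continuousLinearMapAt_trivializationAt (I := 𝓘(ℝ, E)) hx
  have h7 := congrArg (fun L : TangentSpace 𝓘(ℝ, E) x →L[ℝ] E => L (Ω.hamVectorField F x)) h6
  have hb : x ∈ (trivializationAt E (TangentSpace 𝓘(ℝ, E)) x₀).baseSet := hx
  have h8 := congrFun ((trivializationAt E (TangentSpace 𝓘(ℝ, E)) x₀).coe_linearMapAt_of_mem (R := ℝ) hb)
    (Ω.hamVectorField F x)
  refine h8.symm.trans (h7.trans ?_)
  have h9 : ∀ x', x' = x → mfderiv 𝓘(ℝ, E) 𝓘(ℝ, E) (chartAt E x₀) x (Ω.hamVectorField F x) =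
      mfderiv 𝓘(ℝ, E) 𝓘(ℝ, E) (chartAt E x₀) x' (Ω.hamVectorField F x') := fun x' h => by rw [h]
  exact h9 _ ((chartAt E x₀).left_inv hx)

end Hamiltonian

end ChartExpressions

/-! ### Compactly supported families and their local Hamiltonian flows. -/

noncomputable section HamiltonianFlow

variable {E : Type*} [NormedAddCommGroup E] [NormedSpace ℝ E]
variable {M : Type*} [TopologicalSpace M] [ChartedSpace E M]

/-- The time derivative of a family of functions, one-sided at the ends of `[0,1]`. -/
def timeDeriv (F : ℝ → M → ℝ) (t : ℝ) (x : M) : ℝ := derivWithin (fun τ => F τ x) (Icc 0 1) t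

variable [FiniteDimensional ℝ E] [IsManifold 𝓘(ℝ, E) ∞ M]

theorem uniqueDiffOn_Icc_prod {F : Type*} [NormedAddCommGroup F] [NormedSpace ℝ F] {V : Set F}
    (hV : IsOpen V) : UniqueDiffOn ℝ (Icc (0 : ℝ) 1 ×ˢ V) :=
  (uniqueDiffOn_Icc one_pos).prod hV.uniqueDiffOn

/-- Compactly supported families may be recognized in the charts of the atlas. -/
theorem isCompactlySupportedFamily_of_chart {F : ℝ → M → ℝ}
    (h : ∀ e ∈ atlas E M, ContDiffOn ℝ ∞ (fun p : ℝ × E => F p.1 (e.symm p.2))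
      (Icc 0 1 ×ˢ e.target))
    (hK : ∃ K : Set M, IsCompact K ∧ ∀ t ∈ Icc (0 : ℝ) 1, ∀ x ∉ K, F t x = 0) :
    IsCompactlySupportedFamily E F := by
  refine ⟨fun p hp => ?_, hK⟩
  have he := chart_mem_atlas E p.2
  have h := contMDiffOn_family_of_chart (M := M) (U := (chartAt E p.2).target) he (h _ he)
  have h1 : ContMDiffOn (𝓘(ℝ, ℝ).prod 𝓘(ℝ, E)) 𝓘(ℝ, ℝ) ∞ (fun p : ℝ × M => F p.1 p.2)
      (Icc 0 1 ×ˢ (chartAt E p.2).source) := by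
    refine (h.mono ?_).congr fun q hq => ?_
    · exact prod_mono_right fun x hx => ⟨hx, (chartAt E p.2).map_source hx⟩
    · simp only [(chartAt E p.2).left_inv hq.2]
  refine (h1 p ⟨hp.1, mem_chart_source E p.2⟩).mono_of_mem_nhdsWithin ?_
  rw [nhdsWithin_prod_eq, nhdsWithin_univ]
  exact prod_mem_prod self_mem_nhdsWithin
    ((chartAt E p.2).open_source.mem_nhds (mem_chart_source E p.2))

section Family

variable {F : ℝ → M → ℝ} (hF : IsCompactlySupportedFamily E F)
include hF

theorem IsCompactlySupportedFamily.contDiffOn_chart {e : OpenPartialHomeomorph M E}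
    (he : e ∈ atlas E M) :
    ContDiffOn ℝ ∞ (fun p : ℝ × E => F p.1 (e.symm p.2)) (Icc 0 1 ×ˢ e.target) := by
  simpa using contDiffOn_family_chart he hF.1

theorem IsCompactlySupportedFamily.contMDiff {t : ℝ} (ht : t ∈ Icc (0 : ℝ) 1) :
    ContMDiff 𝓘(ℝ, E) 𝓘(ℝ, ℝ) ∞ (F t) := contMDiff_slice hF.1 ht

theorem IsCompactlySupportedFamily.timeDeriv_chart {e : OpenPartialHomeomorph M E}
    (he : e ∈ atlas E M) {p : ℝ × E} (hp : p ∈ Icc (0 : ℝ) 1 ×ˢ e.target) :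
    HasDerivWithinAt (fun τ => F τ (e.symm p.2))
      (fderivWithin ℝ (fun p : ℝ × E => F p.1 (e.symm p.2)) (Icc 0 1 ×ˢ e.target) p (1, 0))
      (Icc 0 1) p.1 :=
  hasDerivWithinAt_prod_inl hp.2 ((hF.contDiffOn_chart he).differentiableOn (by simp) p hp)

theorem IsCompactlySupportedFamily.contDiffOn_timeDeriv_chart {e : OpenPartialHomeomorph M E}
    (he : e ∈ atlas E M) :
    ContDiffOn ℝ ∞ (fun p : ℝ × E => timeDeriv F p.1 (e.symm p.2)) (Icc 0 1 ×ˢ e.target) := by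
  have h1 := ((hF.contDiffOn_chart he).fderivWithin (m := ∞) (uniqueDiffOn_Icc_prod e.open_target)
    (by simp)).clm_apply (contDiffOn_const (c := ((1 : ℝ), (0 : E))))
  exact h1.congr fun p hp =>
    (hF.timeDeriv_chart he hp).derivWithin (uniqueDiffOn_Icc one_pos p.1 hp.1)

theorem IsCompactlySupportedFamily.hasDerivWithinAt {t : ℝ} (ht : t ∈ Icc (0 : ℝ) 1) (x : M) :
    HasDerivWithinAt (fun τ => F τ x) (timeDeriv F t x) (Icc 0 1) t := by
  have h := hF.timeDeriv_chart (chart_mem_atlas E x) (p := (t, chartAt E x x))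
    ⟨ht, mem_chart_target E x⟩
  simp only [(chartAt E x).left_inv (mem_chart_source E x)] at h
  exact h.differentiableWithinAt.hasDerivWithinAt

/-- The time derivative of a compactly supported family is a compactly supported family. -/
theorem IsCompactlySupportedFamily.timeDeriv :
    IsCompactlySupportedFamily E (timeDeriv F) := by
  refine isCompactlySupportedFamily_of_chart (fun e he => hF.contDiffOn_timeDeriv_chart he) ?_
  obtain ⟨K, hK, hK0⟩ := hF.2
  refine ⟨K, hK, fun t ht x hx => ?_⟩
  have h1 : derivWithin (fun τ => F τ x) (Icc 0 1) t = derivWithin (fun _ => (0 : ℝ)) (Icc 0 1) t :=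
    derivWithin_congr (fun τ hτ => hK0 τ hτ x hx) (hK0 t ht x hx)
  simpa [_root_.timeDeriv] using h1

end Family

section Flow

variable (Ω : SymplecticForm E M)

theorem hamVectorField_eq_of_mfderiv_eq {F F' : M → ℝ} {x : M}
    (h : mfderiv 𝓘(ℝ, E) 𝓘(ℝ, ℝ) F x = mfderiv 𝓘(ℝ, E) 𝓘(ℝ, ℝ) F' x) :
    Ω.hamVectorField F x = Ω.hamVectorField F' x := by
  unfold SymplecticForm.hamVectorField
  rw [h]

theorem hamVectorField_congr {F F' : M → ℝ} {x : M} (h : F =ᶠ[𝓝 x] F') :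
    Ω.hamVectorField F x = Ω.hamVectorField F' x :=
  hamVectorField_eq_of_mfderiv_eq Ω h.mfderiv_eq

theorem eq_of_forall_form_eq {x : M} {v v' : TangentSpace 𝓘(ℝ, E) x}
    (h : ∀ w : TangentSpace 𝓘(ℝ, E) x, Ω.form x ![v, w] = Ω.form x ![v', w]) : v = v' := by
  rw [← sub_eq_zero]
  refine Ω.nondegenerate x _ fun w => ?_
  have h1 : Ω.bilin x (v - v') w = Ω.bilin x v w - Ω.bilin x v' w := by
    rw [map_sub]; rfl
  rw [← Ω.bilin_apply, h1, Ω.bilin_apply, Ω.bilin_apply, h, sub_self]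

theorem hamVectorField_const_mul {F : M → ℝ} {x : M}
    (hF : MDifferentiableAt 𝓘(ℝ, E) 𝓘(ℝ, ℝ) F x) (s : ℝ) :
    Ω.hamVectorField (fun x => s * F x) x = s • Ω.hamVectorField F x := by
  have h1 : mfderiv 𝓘(ℝ, E) 𝓘(ℝ, ℝ) (fun x => s * F x) x = s • mfderiv 𝓘(ℝ, E) 𝓘(ℝ, ℝ) F x :=
    (hF.hasMFDerivAt.const_smul s).mfderiv
  refine eq_of_forall_form_eq Ω fun w => ?_
  have h2 : Ω.form x ![s • Ω.hamVectorField F x, w] = s * Ω.form x ![Ω.hamVectorField F x, w] :=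
    congrArg (fun L => L w) ((Ω.bilin x).map_smul s (Ω.hamVectorField F x))
  rw [h2, Ω.form_hamVectorField, Ω.form_hamVectorField]
  exact congrArg (fun L : TangentSpace 𝓘(ℝ, E) x →L[ℝ] ℝ => L w) h1

theorem hamVectorField_zero_of_eventuallyEq {F : M → ℝ} {x : M} (h : F =ᶠ[𝓝 x] 0) :
    Ω.hamVectorField F x = 0 := by
  have h1 : F =ᶠ[𝓝 x] fun x => (0 : ℝ) * F x := by
    filter_upwards [h] with y hy
    simp [hy]
  rw [hamVectorField_congr Ω h1, hamVectorField_const_mul Ω, zero_smul]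
  exact (mdifferentiableAt_const (c := (0 : ℝ))).congr_of_eventuallyEq h

theorem hamVectorField_zero_of_notMem {F : M → ℝ} {K : Set M} (hK : IsClosed K)
    (hF : ∀ x ∉ K, F x = 0) {x : M} (hx : x ∉ K) : Ω.hamVectorField F x = 0 :=
  hamVectorField_zero_of_eventuallyEq Ω (by
    filter_upwards [hK.isOpen_compl.mem_nhds hx] with y hy using hF y hy)

variable {G : ℝ → M → ℝ}

/-- The local flow of a smooth family of Hamiltonian vector fields in a chart, together with the
integral of the time derivative of the Hamiltonian along it. -/
theorem exists_local_hamiltonian_flow (hG : IsCompactlySupportedFamily E G)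
    {e : OpenPartialHomeomorph M E} (he : e ∈ atlas E M) {t₀ : ℝ} (ht₀ : t₀ ∈ Icc (0 : ℝ) 1)
    {y₀ : E} (hy₀ : y₀ ∈ e.target) :
    ∃ δ > 0, ∃ (Ψ : ℝ × ℝ × E → E) (ζ : ℝ × ℝ × E → ℝ),
      ContDiffOn ℝ ∞ Ψ
        (Ioo (-δ) δ ×ˢ (Icc 0 1 ∩ Ioo (t₀ - δ) (t₀ + δ)) ×ˢ Metric.ball y₀ δ) ∧
      ContDiffOn ℝ ∞ ζ
        (Ioo (-δ) δ ×ˢ (Icc 0 1 ∩ Ioo (t₀ - δ) (t₀ + δ)) ×ˢ Metric.ball y₀ δ) ∧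
      ∀ s ∈ Ioo (-δ) δ, ∀ q ∈ (Icc 0 1 ∩ Ioo (t₀ - δ) (t₀ + δ)) ×ˢ Metric.ball y₀ δ,
        Ψ (s, q) ∈ e.target ∧ Ψ (0, q) = q.2 ∧ ζ (0, q) = 0 ∧
        HasDerivAt (fun σ => Ψ (σ, q)) (hamChart Ω (G q.1) e (Ψ (s, q))) s ∧
        HasDerivAt (fun σ => ζ (σ, q)) (timeDeriv G q.1 (e.symm (Ψ (s, q)))) s := by
  have : CompleteSpace E := FiniteDimensional.complete ℝ E
  -- The integral of `∂_t G_t` along the flow is added as a real unknown started at zero, so that it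
  -- is as smooth as the flow.
  have hv : ContDiffOn ℝ ∞ (fun p : ℝ × E × ℝ =>
      (hamChart Ω (G p.1) e p.2.1, timeDeriv G p.1 (e.symm p.2.1)))
      (Icc 0 1 ×ˢ e.target ×ˢ univ) := by
    have hm : ContDiffOn ℝ ∞ (fun p : ℝ × E × ℝ => (p.1, p.2.1)) (Icc 0 1 ×ˢ e.target ×ˢ univ) :=
      (contDiff_fst.prodMk (contDiff_fst.comp contDiff_snd)).contDiffOn
    exact ((contDiffOn_hamChart Ω he (uniqueDiffOn_Icc one_pos) hG.1).comp hm
        fun p hp => ⟨hp.1, hp.2.1⟩).prodMk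
      ((hG.contDiffOn_timeDeriv_chart he).comp hm fun p hp => ⟨hp.1, hp.2.1⟩)
  obtain ⟨δ, hδ, Φ, hΦ, hΦ'⟩ := exists_smooth_local_flow (x₀ := (y₀, (0 : ℝ)))
    (e.open_target.prod isOpen_univ) hv ht₀ ⟨hy₀, mem_univ _⟩
  have hball : ∀ y ∈ Metric.ball y₀ δ, (y, (0 : ℝ)) ∈ Metric.ball (y₀, (0 : ℝ)) δ := by
    intro y hy
    rw [← ball_prod_same]
    exact ⟨hy, Metric.mem_ball_self hδ⟩
  have hm : ContDiff ℝ ∞ (fun p : ℝ × ℝ × E => (p.1, p.2.1, p.2.2, (0 : ℝ))) :=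
    contDiff_fst.prodMk ((contDiff_fst.comp contDiff_snd).prodMk
      ((contDiff_snd.comp contDiff_snd).prodMk contDiff_const))
  have hc : ContDiffOn ℝ ∞ (fun p : ℝ × ℝ × E => Φ (p.1, p.2.1, p.2.2, (0 : ℝ)))
      (Ioo (-δ) δ ×ˢ (Icc 0 1 ∩ Ioo (t₀ - δ) (t₀ + δ)) ×ˢ Metric.ball y₀ δ) :=
    hΦ.comp hm.contDiffOn fun p hp => ⟨hp.1, hp.2.1, hball _ hp.2.2⟩
  refine ⟨δ, hδ, fun p => (Φ (p.1, p.2.1, p.2.2, (0 : ℝ))).1,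
    fun p => (Φ (p.1, p.2.1, p.2.2, (0 : ℝ))).2, hc.fst, hc.snd, fun s hs q hq => ?_⟩
  obtain ⟨h1, h2, h3⟩ := hΦ' s hs q.1 hq.1 (q.2, 0) (hball _ hq.2)
  exact ⟨h1.1, congrArg Prod.fst h2, congrArg Prod.snd h2, h3.fst, h3.snd⟩

end Flow

end HamiltonianFlow

/-! ### Completeness of the flows, and their identification with `timeOneMap`. -/

noncomputable section GlobalFlow

variable {E : Type*} [NormedAddCommGroup E] [NormedSpace ℝ E] [FiniteDimensional ℝ E]
variable {M : Type*} [TopologicalSpace M] [ChartedSpace E M] [IsManifold 𝓘(ℝ, E) ∞ M]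
variable (Ω : SymplecticForm E M) {G : ℝ → M → ℝ}

theorem isMIntegralCurveOn_symm_comp {e : OpenPartialHomeomorph M E} (he : e ∈ atlas E M)
    {F : M → ℝ} {c : ℝ → E} {s : Set ℝ} (hs : ∀ σ ∈ s, c σ ∈ e.target)
    (hc : ∀ σ ∈ s, HasDerivAt c (hamChart Ω F e (c σ)) σ) :
    IsMIntegralCurveOn (I := 𝓘(ℝ, E)) (e.symm ∘ c) (Ω.hamVectorField F) s := by
  intro σ hσ
  have h := hasMFDerivWithinAt_symm_comp he (hs σ hσ) (hc σ hσ).hasDerivWithinAt (s := s)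
  rwa [mfderiv_symm_hamChart Ω he F (hs σ hσ)] at h

/-- Compactness of `[0,1] × K` makes the existence time uniform; off `K` constant curves serve. A
uniform existence time allows integral curves to be continued for ever. -/
theorem exists_uniform_integral_curves [T2Space M] (hG : IsCompactlySupportedFamily E G) :
    ∃ δ > 0, ∀ t ∈ Icc (0 : ℝ) 1, ∀ x, ∃ γ : ℝ → M, γ 0 = x ∧
      IsMIntegralCurveOn (I := 𝓘(ℝ, E)) γ (Ω.hamVectorField (G t)) (Ioo (-δ) δ) := by
  obtain ⟨K, hK, hK0⟩ := hG.2
  have h1 : ∀ᶠ δ : ℝ in 𝓝 0, ∀ p ∈ Icc (0 : ℝ) 1 ×ˢ K, ∃ γ : ℝ → M, γ 0 = p.2 ∧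
      IsMIntegralCurveOn (I := 𝓘(ℝ, E)) γ (Ω.hamVectorField (G p.1)) (Ioo (-δ) δ) := by
    -- Neighbourhoods are taken in all of `ℝ × M`, so membership of the time in `[0,1]` is carried
    -- along as a premise.
    have h2 : ∀ᶠ δ : ℝ in 𝓝 0, ∀ p ∈ Icc (0 : ℝ) 1 ×ˢ K, p.1 ∈ Icc (0 : ℝ) 1 → ∃ γ : ℝ → M,
        γ 0 = p.2 ∧
        IsMIntegralCurveOn (I := 𝓘(ℝ, E)) γ (Ω.hamVectorField (G p.1)) (Ioo (-δ) δ) := by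
      refine (isCompact_Icc.prod hK).eventually_forall_of_forall_eventually (x₀ := (0 : ℝ)) ?_
      rintro ⟨t₀, x₀⟩ ⟨ht₀, -⟩
      have he := chart_mem_atlas E x₀
      set e := chartAt E x₀
      have hx₀ : x₀ ∈ e.source := mem_chart_source E x₀
      obtain ⟨δ, hδ, Ψ, ζ, -, -, h⟩ :=
        exists_local_hamiltonian_flow Ω hG he ht₀ (mem_chart_target E x₀)
      have hn1 : ∀ᶠ z : ℝ × ℝ × M in 𝓝 (0, t₀, x₀), z.1 < δ :=
        continuousAt_fst.eventually_lt continuousAt_const hδ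
      have hn2 : ∀ᶠ z : ℝ × ℝ × M in 𝓝 (0, t₀, x₀), z.2.1 ∈ Ioo (t₀ - δ) (t₀ + δ) :=
        (continuous_fst.comp continuous_snd).continuousAt.eventually_mem
          (Ioo_mem_nhds (by simp [hδ]) (by simp [hδ]))
      have hn3 : ∀ᶠ z : ℝ × ℝ × M in 𝓝 (0, t₀, x₀), z.2.2 ∈ e.source ∩ e ⁻¹' Metric.ball (e x₀) δ :=
        (continuous_snd.comp continuous_snd).continuousAt.eventually_mem
          (((e.continuousOn.isOpen_inter_preimage e.open_source Metric.isOpen_ball)).mem_nhds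
            ⟨hx₀, Metric.mem_ball_self hδ⟩)
      filter_upwards [hn1, hn2, hn3] with z hz1 hz2 hz3 hzI
      have hq : ((z.2.1, e z.2.2) : ℝ × E) ∈
          (Icc 0 1 ∩ Ioo (t₀ - δ) (t₀ + δ)) ×ˢ Metric.ball (e x₀) δ := ⟨⟨hzI, hz2⟩, hz3.2⟩
      have hsub : Ioo (-z.1) z.1 ⊆ Ioo (-δ) δ := Ioo_subset_Ioo (by linarith) hz1.le
      refine ⟨e.symm ∘ fun σ => Ψ (σ, z.2.1, e z.2.2), ?_,
        isMIntegralCurveOn_symm_comp Ω he (fun σ hσ => (h σ (hsub hσ) _ hq).1)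
          fun σ hσ => (h σ (hsub hσ) _ hq).2.2.2.1⟩
      have h0 := (h 0 ⟨by linarith, hδ⟩ _ hq).2.1
      simp only [Function.comp_apply, h0]
      exact e.left_inv hz3.1
    exact h2.mono fun δ h p hp => h p hp hp.1
  obtain ⟨δ, hδ, h⟩ := Metric.eventually_nhds_iff.1 h1
  refine ⟨δ / 2, by positivity, fun t ht x => ?_⟩
  by_cases hx : x ∈ K
  · exact h (y := δ / 2) (by simp [abs_of_pos hδ, hδ]) (t, x) ⟨ht, hx⟩
  · exact ⟨fun _ => x, rfl, (isMIntegralCurve_const (hamVectorField_zero_of_notMem Ω hK.isClosed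
      (hK0 t ht) hx)).isMIntegralCurveOn _⟩

variable [T2Space M]

/-- The curve `σ ↦ c (σ s)` integrates `X_{sF}`, and by uniqueness it is the curve chosen in
`timeOneMap`. -/
theorem timeOneMap_eq {F : M → ℝ} (hF : ContMDiff 𝓘(ℝ, E) 𝓘(ℝ, ℝ) ∞ F) {c : ℝ → M}
    (hc : IsMIntegralCurve (I := 𝓘(ℝ, E)) c (Ω.hamVectorField F)) (s : ℝ) :
    timeOneMap Ω (fun x => s * F x) (c 0) = c s := by
  have hv : Ω.hamVectorField (fun x => s * F x) = s • Ω.hamVectorField F :=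
    funext fun x => hamVectorField_const_mul Ω (hF.mdifferentiable (by simp) x) s
  have hc' : IsMIntegralCurve (I := 𝓘(ℝ, E)) (c ∘ (· * s)) (Ω.hamVectorField fun x => s * F x) := by
    rw [hv]; exact hc.comp_mul s
  have hex : ∃ c' : ℝ → M, c' 0 = c 0 ∧
      IsMIntegralCurve (I := 𝓘(ℝ, E)) c' (Ω.hamVectorField fun x => s * F x) :=
    ⟨_, by simp, hc'⟩
  have : IsManifold 𝓘(ℝ, E) 1 M := IsManifold.of_le (n := ∞) (by simp)
  have : CompleteSpace E := FiniteDimensional.complete ℝ E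
  have hsF : ContMDiff 𝓘(ℝ, E) 𝓘(ℝ, ℝ) ∞ fun x => s * F x := contMDiff_const.mul hF
  have h := isMIntegralCurve_Ioo_eq_of_contMDiff_boundaryless (t₀ := 0)
    (contMDiff_hamVectorField Ω hsF) hex.choose_spec.2 hc' (by simpa using hex.choose_spec.1)
  rw [timeOneMap, dif_pos hex, h]
  simp

/-- The time-`s` flow of `G t`. -/
def hamFlow (G : ℝ → M → ℝ) (s t : ℝ) (x : M) : M := timeOneMap Ω (fun x => s * G t x) x

theorem exists_integral_curve (hG : IsCompactlySupportedFamily E G) {t : ℝ}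
    (ht : t ∈ Icc (0 : ℝ) 1) (x : M) :
    ∃ c : ℝ → M, c 0 = x ∧ IsMIntegralCurve (I := 𝓘(ℝ, E)) c (Ω.hamVectorField (G t)) := by
  have : IsManifold 𝓘(ℝ, E) 1 M := IsManifold.of_le (n := ∞) (by simp)
  have : CompleteSpace E := FiniteDimensional.complete ℝ E
  obtain ⟨δ, hδ, h⟩ := exists_uniform_integral_curves Ω hG
  exact exists_isMIntegralCurve_of_isMIntegralCurveOn
    (contMDiff_hamVectorField Ω (hG.contMDiff ht)) hδ (h t ht) x

theorem isMIntegralCurve_hamFlow (hG : IsCompactlySupportedFamily E G) {t : ℝ}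
    (ht : t ∈ Icc (0 : ℝ) 1) (x : M) :
    IsMIntegralCurve (I := 𝓘(ℝ, E)) (fun s => hamFlow Ω G s t x) (Ω.hamVectorField (G t)) := by
  obtain ⟨c, rfl, hc⟩ := exists_integral_curve Ω hG ht x
  have h : (fun s => hamFlow Ω G s t (c 0)) = c :=
    funext fun s => timeOneMap_eq Ω (hG.contMDiff ht) hc s
  rwa [h]

theorem hamFlow_zero (hG : IsCompactlySupportedFamily E G) {t : ℝ}
    (ht : t ∈ Icc (0 : ℝ) 1) (x : M) : hamFlow Ω G 0 t x = x := by
  obtain ⟨c, rfl, hc⟩ := exists_integral_curve Ω hG ht x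
  exact timeOneMap_eq Ω (hG.contMDiff ht) hc 0

theorem hamFlow_neg_hamFlow (hG : IsCompactlySupportedFamily E G) {t : ℝ}
    (ht : t ∈ Icc (0 : ℝ) 1) (s : ℝ) (x : M) :
    hamFlow Ω G (-s) t (hamFlow Ω G s t x) = x := by
  have h := timeOneMap_eq Ω (hG.contMDiff ht) ((isMIntegralCurve_hamFlow Ω hG ht x).comp_add s) (-s)
  simp only [Function.comp_apply, zero_add, neg_add_cancel] at h
  exact h.trans (hamFlow_zero Ω hG ht x)

theorem hamFlow_hamFlow_neg (hG : IsCompactlySupportedFamily E G) {t : ℝ}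
    (ht : t ∈ Icc (0 : ℝ) 1) (s : ℝ) (x : M) :
    hamFlow Ω G s t (hamFlow Ω G (-s) t x) = x := by
  simpa using hamFlow_neg_hamFlow Ω hG ht (-s) x

theorem hamFlow_eq_self (hG : IsCompactlySupportedFamily E G) {K : Set M} (hK : IsClosed K)
    (hK0 : ∀ t ∈ Icc (0 : ℝ) 1, ∀ x ∉ K, G t x = 0) {t : ℝ}
    (ht : t ∈ Icc (0 : ℝ) 1) (s : ℝ) {x : M} (hx : x ∉ K) : hamFlow Ω G s t x = x :=
  timeOneMap_eq Ω (hG.contMDiff ht) (c := fun _ => x)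
    (isMIntegralCurve_const (hamVectorField_zero_of_notMem Ω hK (hK0 t ht) hx)) s

theorem hamFlow_eq_of_isMIntegralCurveOn (hG : IsCompactlySupportedFamily E G) {t : ℝ}
    (ht : t ∈ Icc (0 : ℝ) 1) {δ : ℝ} {γ : ℝ → M}
    (hγ : IsMIntegralCurveOn (I := 𝓘(ℝ, E)) γ (Ω.hamVectorField (G t)) (Ioo (-δ) δ))
    {s : ℝ} (hs : s ∈ Ioo (-δ) δ) : hamFlow Ω G s t (γ 0) = γ s := by
  have : IsManifold 𝓘(ℝ, E) 1 M := IsManifold.of_le (n := ∞) (by simp)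
  have : CompleteSpace E := FiniteDimensional.complete ℝ E
  have h0 : (0 : ℝ) ∈ Ioo (-δ) δ := by constructor <;> linarith [hs.1, hs.2]
  exact isMIntegralCurveOn_Ioo_eqOn_of_contMDiff_boundaryless h0
    (contMDiff_hamVectorField Ω (hG.contMDiff ht))
    ((isMIntegralCurve_hamFlow Ω hG ht (γ 0)).isMIntegralCurveOn _) hγ
    (hamFlow_zero Ω hG ht _) hs

end GlobalFlow

/-! ### The drift, and the effect of the flow on the symplectic form. -/

noncomputable section FlowRegularity

variable {E : Type*} [NormedAddCommGroup E] [NormedSpace ℝ E]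

/-- The parameter domain of a local flow. -/
def flowDomain (δ t₀ : ℝ) (y₀ : E) : Set (ℝ × E) :=
  (Icc 0 1 ∩ Ioo (t₀ - δ) (t₀ + δ)) ×ˢ Metric.ball y₀ δ

theorem convex_flowDomain (δ t₀ : ℝ) (y₀ : E) : Convex ℝ (flowDomain δ t₀ y₀) :=
  ((convex_Icc _ _).inter (convex_Ioo _ _)).prod (convex_ball _ _)

/-- Since `t₀` may be an end of `[0,1]`, the domain need not be open; convexity and a nonempty
interior still give unique differentiability and symmetric second derivatives. -/
theorem interior_flowDomain_nonempty {δ t₀ : ℝ} (hδ : 0 < δ) (ht₀ : t₀ ∈ Icc (0 : ℝ) 1) (y₀ : E) :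
    (interior (flowDomain δ t₀ y₀)).Nonempty := by
  rw [flowDomain, interior_prod_eq, interior_inter, interior_Icc, isOpen_Ioo.interior_eq,
    Metric.isOpen_ball.interior_eq, Ioo_inter_Ioo]
  refine (nonempty_Ioo.2 ?_).prod ⟨y₀, Metric.mem_ball_self hδ⟩
  obtain ⟨h0, h1⟩ := ht₀
  rw [sup_lt_iff, lt_inf_iff, lt_inf_iff]
  constructor <;> constructor <;> linarith

theorem fderivWithin_prod_inl {Q F : Type*} [NormedAddCommGroup Q] [NormedSpace ℝ Q]
    [NormedAddCommGroup F] [NormedSpace ℝ F] {f : ℝ × Q → F} {a b : ℝ} {A : Set Q}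
    (hf : ContDiffOn ℝ ∞ f (Ioo a b ×ˢ A)) {p : ℝ × Q} (hp : p ∈ Ioo a b ×ˢ A) {f' : F}
    (hf' : HasDerivAt (fun σ => f (σ, p.2)) f' p.1) :
    fderivWithin ℝ f (Ioo a b ×ˢ A) p (1, 0) = f' := by
  have h1 := hasDerivWithinAt_prod_inl (s := p.1) (q := p.2) hp.2
    (hf.differentiableOn (by simp) p hp)
  exact (h1.hasDerivAt (isOpen_Ioo.mem_nhds hp.1)).unique hf'

variable [FiniteDimensional ℝ E]
variable {M : Type*} [TopologicalSpace M] [ChartedSpace E M] [IsManifold 𝓘(ℝ, E) ∞ M]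
variable (Ω : SymplecticForm E M) {G : ℝ → M → ℝ}

/-- The integral of the time derivative of `G` along the flow of `G t`. -/
def hamDrift (G : ℝ → M → ℝ) (s t : ℝ) (x : M) : ℝ :=
  ∫ σ in (0 : ℝ)..s, timeDeriv G t (hamFlow Ω G σ t x)

variable [T2Space M]

theorem continuous_timeDeriv_hamFlow (hG : IsCompactlySupportedFamily E G) {t : ℝ}
    (ht : t ∈ Icc (0 : ℝ) 1) (x : M) : Continuous fun σ => timeDeriv G t (hamFlow Ω G σ t x) :=
  (hG.timeDeriv.contMDiff ht).continuous.comp (isMIntegralCurve_hamFlow Ω hG ht x).continuous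

theorem hamDrift_eq_zero (hG : IsCompactlySupportedFamily E G) {K : Set M} (hK : IsClosed K)
    (hK0 : ∀ t ∈ Icc (0 : ℝ) 1, ∀ x ∉ K, G t x = 0) {t : ℝ}
    (ht : t ∈ Icc (0 : ℝ) 1) (s : ℝ) {x : M} (hx : x ∉ K) : hamDrift Ω G s t x = 0 := by
  have h1 : timeDeriv G t x = 0 := by
    have h2 : derivWithin (fun τ => G τ x) (Icc 0 1) t = derivWithin (fun _ => (0 : ℝ)) (Icc 0 1) t :=
      derivWithin_congr (fun τ hτ => hK0 τ hτ x hx) (hK0 t ht x hx)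
    simpa [timeDeriv] using h2
  simp [hamDrift, hamFlow_eq_self Ω hG hK hK0 ht _ hx, h1]

/-- The local expression of the flow and of the drift, and the way in which the flow changes the
symplectic form. -/
theorem exists_local_hamFlow (hG : IsCompactlySupportedFamily E G)
    {e : OpenPartialHomeomorph M E} (he : e ∈ atlas E M) {t₀ : ℝ} (ht₀ : t₀ ∈ Icc (0 : ℝ) 1)
    {y₀ : E} (hy₀ : y₀ ∈ e.target) :
    ∃ δ > 0, ∃ (Ψ : ℝ × ℝ × E → E) (ζ : ℝ × ℝ × E → ℝ),
      ContDiffOn ℝ ∞ Ψ (Ioo (-δ) δ ×ˢ flowDomain δ t₀ y₀) ∧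
      ContDiffOn ℝ ∞ ζ (Ioo (-δ) δ ×ˢ flowDomain δ t₀ y₀) ∧
      ∀ s ∈ Ioo (-δ) δ, ∀ q ∈ flowDomain δ t₀ y₀,
        q.2 ∈ e.target ∧ Ψ (s, q) ∈ e.target ∧
        hamFlow Ω G s q.1 (e.symm q.2) = e.symm (Ψ (s, q)) ∧
        hamDrift Ω G s q.1 (e.symm q.2) = ζ (s, q) ∧
        ∀ a b : ℝ × E, chartForm Ω.form e (Ψ (s, q))
            ![fderivWithin ℝ Ψ (Ioo (-δ) δ ×ˢ flowDomain δ t₀ y₀) (s, q) (0, a),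
              fderivWithin ℝ Ψ (Ioo (-δ) δ ×ˢ flowDomain δ t₀ y₀) (s, q) (0, b)] =
          chartForm Ω.form e q.2 ![a.2, b.2]
            + a.1 * fderivWithin ℝ ζ (Ioo (-δ) δ ×ˢ flowDomain δ t₀ y₀) (s, q) (0, b)
            - b.1 * fderivWithin ℝ ζ (Ioo (-δ) δ ×ˢ flowDomain δ t₀ y₀) (s, q) (0, a) := by
  obtain ⟨δ, hδ, Ψ, ζ, hΨ, hζ, h⟩ := exists_local_hamiltonian_flow Ω hG he ht₀ hy₀
  refine ⟨δ, hδ, Ψ, ζ, hΨ, hζ, ?_⟩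
  change ∀ s ∈ Ioo (-δ) δ, ∀ q ∈ flowDomain δ t₀ y₀, _ at h
  change ContDiffOn ℝ ∞ Ψ (Ioo (-δ) δ ×ˢ flowDomain δ t₀ y₀) at hΨ
  change ContDiffOn ℝ ∞ ζ (Ioo (-δ) δ ×ˢ flowDomain δ t₀ y₀) at hζ
  have h0 : (0 : ℝ) ∈ Ioo (-δ) δ := ⟨by linarith, hδ⟩
  have hflow : ∀ s ∈ Ioo (-δ) δ, ∀ q ∈ flowDomain δ t₀ y₀,
      hamFlow Ω G s q.1 (e.symm q.2) = e.symm (Ψ (s, q)) := by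
    intro s hs q hq
    have h1 := isMIntegralCurveOn_symm_comp Ω he (c := fun σ => Ψ (σ, q))
      (fun σ hσ => (h σ hσ q hq).1) fun σ hσ => (h σ hσ q hq).2.2.2.1
    have h2 := hamFlow_eq_of_isMIntegralCurveOn Ω hG hq.1.1 h1 hs
    simpa [(h 0 h0 q hq).2.1] using h2
  set S := Ioo (-δ) δ ×ˢ flowDomain δ t₀ y₀ with hS
  have hSu : UniqueDiffOn ℝ S := (isOpen_Ioo.uniqueDiffOn).prod
    (uniqueDiffOn_convex (convex_flowDomain _ _ _) (interior_flowDomain_nonempty hδ ht₀ y₀))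
  have hΨT : MapsTo Ψ S e.target := fun p hp => (h p.1 hp.1 p.2 hp.2).1
  have hmap : MapsTo (fun p : ℝ × ℝ × E => (p.2.1, Ψ p)) S (Icc 0 1 ×ˢ e.target) :=
    fun p hp => ⟨hp.2.1.1, hΨT hp⟩
  have hpair : ContDiffOn ℝ ∞ (fun p : ℝ × ℝ × E => (p.2.1, Ψ p)) S :=
    (contDiff_fst.comp contDiff_snd).contDiffOn.prodMk hΨ
  have hgcomp : ContDiffOn ℝ ∞ (fun p : ℝ × ℝ × E => G p.2.1 (e.symm (Ψ p))) S :=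
    (hG.contDiffOn_chart he).comp hpair hmap
  have hkcomp : ContDiffOn ℝ ∞ (fun p : ℝ × ℝ × E => timeDeriv G p.2.1 (e.symm (Ψ p))) S :=
    (hG.contDiffOn_timeDeriv_chart he).comp hpair hmap
  intro s hs q hq
  refine ⟨?_, (h s hs q hq).1, hflow s hs q hq, ?_, fun a b => ?_⟩
  · have h1 := h 0 h0 q hq
    rw [← h1.2.1]; exact h1.1
  · have hsub : uIcc 0 s ⊆ Ioo (-δ) δ := by
      intro σ hσ
      rw [mem_uIcc] at hσ
      rcases hσ with hσ | hσ <;> constructor <;> linarith [hs.1, hs.2, hσ.1, hσ.2]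
    have h1 := intervalIntegral.integral_eq_sub_of_hasDerivAt (f := fun σ => ζ (σ, q))
      (f' := fun σ => timeDeriv G q.1 (hamFlow Ω G σ q.1 (e.symm q.2))) (a := 0) (b := s)
      (fun σ hσ => by
        have h2 := (h σ (hsub hσ) q hq).2.2.2.2
        rwa [← hflow σ (hsub hσ) q hq] at h2)
      ((continuous_timeDeriv_hamFlow Ω hG hq.1.1 _).intervalIntegrable _ _)
    rw [(h 0 h0 q hq).2.2.1, sub_zero] at h1
    exact h1
  -- Here `g = G_t` and `k = ∂_t G_t` along the flow, and `λ = dt`. The contraction is `ω(X_{G_t},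
  -- ∂_bΨ) = dG_t(∂_bΨ)`; the chain rule for `G` in `(t, y)` shows that it differs from the full
  -- derivative of `g` by `dt(b) · ∂_t G_t`.
  · refine pullback_flow_two_form hδ (convex_flowDomain _ _ _)
      (interior_flowDomain_nonempty hδ ht₀ y₀) e.open_target (Ω.smooth e he) (Ω.closed e he) hΨ hΨT
      hgcomp hkcomp hζ (fun b => b.1) ?_ (fun p hp => fderivWithin_prod_inl hζ hp (h p.1 hp.1 p.2 hp.2).2.2.2.2)
      (ContinuousLinearMap.snd ℝ ℝ E) (fun q hq => (h 0 h0 q hq).2.1)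
      (fun q hq => (h 0 h0 q hq).2.2.1) hs hq a b
    intro p hp b
    have hGd : MDifferentiableAt 𝓘(ℝ, E) 𝓘(ℝ, ℝ) (G p.2.1) (e.symm (Ψ p)) :=
      (hG.contMDiff hp.2.1.1).mdifferentiable (by simp) _
    rw [← hS] at hp ⊢
    rw [fderivWithin_prod_inl hΨ hp (h p.1 hp.1 p.2 hp.2).2.2.2.1, chartForm_hamChart Ω he (hΨT hp) hGd]
    have hGc := (hG.contDiffOn_chart he).differentiableOn (by simp) (p.2.1, Ψ p) (hmap hp)
    have hΨd := (hΨ.differentiableOn (by simp) p hp).hasFDerivWithinAt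
    have hfs : HasFDerivWithinAt (fun p : ℝ × ℝ × E => p.2.1)
        ((ContinuousLinearMap.fst ℝ ℝ E).comp (ContinuousLinearMap.snd ℝ ℝ (ℝ × E))) S p :=
      ((ContinuousLinearMap.fst ℝ ℝ E).comp
        (ContinuousLinearMap.snd ℝ ℝ (ℝ × E))).hasFDerivWithinAt
    have h2 := (hGc.hasFDerivWithinAt.comp p (hfs.prodMk hΨd) hmap).fderivWithin (hSu p hp)
    have h3 : fderivWithin ℝ (fun p : ℝ × ℝ × E => G p.2.1 (e.symm (Ψ p))) S p = _ := h2
    rw [h3]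
    have h4 := fderiv_slice_eq e.open_target hp.2.1.1 (hΨT hp) hGc
      (fderivWithin ℝ Ψ S p (0, b))
    have h5 := ((hG.timeDeriv_chart he (hmap hp)).derivWithin
      (uniqueDiffOn_Icc one_pos p.2.1 hp.2.1.1))
    change timeDeriv G p.2.1 (e.symm (Ψ p)) = _ at h5
    have h6 : fderiv ℝ (G p.2.1 ∘ e.symm) (Ψ p) (fderivWithin ℝ Ψ S p (0, b)) = _ := h4
    rw [h6, h5]
    have h7 : ((b.1, fderivWithin ℝ Ψ S p (0, b)) : ℝ × E) =
        (0, fderivWithin ℝ Ψ S p (0, b)) + b.1 • (1, 0) := by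
      simp
    simp only [ContinuousLinearMap.comp_apply, ContinuousLinearMap.prod_apply,
      ContinuousLinearMap.coe_snd', ContinuousLinearMap.coe_fst']
    rw [h7, map_add, map_smul, smul_eq_mul]
    ring

end FlowRegularity

/-! ### Velocity of a moving point carried by the flow. -/

noncomputable section FlowRegularAtPoint

variable {E : Type*} [NormedAddCommGroup E] [NormedSpace ℝ E] [FiniteDimensional ℝ E]
variable {M : Type*} [TopologicalSpace M] [ChartedSpace E M] [IsManifold 𝓘(ℝ, E) ∞ M]

/-- The type of a velocity depends on its base point; this isolates the transport along an equality
of points. -/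
theorem HasMFDerivWithinAt.congr_velocity {c c' : ℝ → M} {s : Set ℝ} {t : ℝ}
    {X X' : ∀ x : M, TangentSpace 𝓘(ℝ, E) x}
    (h : HasMFDerivWithinAt 𝓘(ℝ, ℝ) 𝓘(ℝ, E) c s t ((1 : ℝ →L[ℝ] ℝ).smulRight (X (c t))))
    (hc : c' =ᶠ[𝓝[s] t] c) (ht : c' t = c t) (hX : X (c t) = X' (c t)) :
    HasMFDerivWithinAt 𝓘(ℝ, ℝ) 𝓘(ℝ, E) c' s t ((1 : ℝ →L[ℝ] ℝ).smulRight (X' (c' t))) := by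
  have h1 : HasMFDerivWithinAt 𝓘(ℝ, ℝ) 𝓘(ℝ, E) c s t
      ((1 : ℝ →L[ℝ] ℝ).smulRight (X' (c t))) := by rwa [hX] at h
  have h2 : ∀ y (hy : y = c t), (X' y : E) = X' (c t) := fun y hy => by rw [hy]
  refine (h1.congr_of_eventuallyEq hc ht).congr_mfderiv ?_
  ext
  exact congrArg (fun v : E => (1 : ℝ) • v) (h2 _ ht).symm

theorem hasFDerivAt_slice {N : Type*} [NormedAddCommGroup N] [NormedSpace ℝ N]
    {f : ℝ × ℝ × E → N} {f' : ℝ × ℝ × E →L[ℝ] N} {J : Set ℝ} {δ t₀ : ℝ} {y₀ : E} {s t : ℝ} {y : E}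
    (hs : s ∈ J) (ht : t ∈ Icc 0 1 ∩ Ioo (t₀ - δ) (t₀ + δ)) (hy : y ∈ Metric.ball y₀ δ)
    (hf : HasFDerivWithinAt f f' (J ×ˢ flowDomain δ t₀ y₀) (s, t, y)) :
    HasFDerivAt (fun y => f (s, t, y)) (f'.comp ((ContinuousLinearMap.inr ℝ ℝ (ℝ × E)).comp
      (ContinuousLinearMap.inr ℝ ℝ E))) y := by
  have h1 : HasFDerivAt (fun y : E => (s, t, y)) ((ContinuousLinearMap.inr ℝ ℝ (ℝ × E)).comp
      (ContinuousLinearMap.inr ℝ ℝ E)) y :=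
    (hasFDerivAt_prodMk_right s _).comp _ (hasFDerivAt_prodMk_right t _)
  have hm : MapsTo (fun y : E => (s, t, y)) (Metric.ball y₀ δ) (J ×ˢ flowDomain δ t₀ y₀) :=
    fun z hz => ⟨hs, ht, hz⟩
  exact (HasFDerivWithinAt.comp (f := fun y : E => (s, t, y)) y hf h1.hasFDerivWithinAt
    hm).hasFDerivAt (Metric.isOpen_ball.mem_nhds hy)

variable (Ω : SymplecticForm E M) {G : ℝ → M → ℝ}

/-- Smoothness of the time-`s` flow and of the drift near `(t, x)`, and the rule for the velocity of
the image of a curve through `x` at time `t`. -/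
structure FlowRegularAt (G : ℝ → M → ℝ) (s t : ℝ) (x : M) : Prop where
  flow : ContMDiffWithinAt (𝓘(ℝ, ℝ).prod 𝓘(ℝ, E)) 𝓘(ℝ, E) ∞
    (fun p : ℝ × M => hamFlow Ω G s p.1 p.2) (Icc 0 1 ×ˢ univ) (t, x)
  drift : ContMDiffWithinAt (𝓘(ℝ, ℝ).prod 𝓘(ℝ, E)) 𝓘(ℝ, ℝ) ∞
    (fun p : ℝ × M => hamDrift Ω G s p.1 p.2) (Icc 0 1 ×ˢ univ) (t, x)
  velocity : ∀ F K : M → ℝ, ContMDiff 𝓘(ℝ, E) 𝓘(ℝ, ℝ) ∞ F → ContMDiff 𝓘(ℝ, E) 𝓘(ℝ, ℝ) ∞ K →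
    (∀ y, K (hamFlow Ω G s t y) = F y + hamDrift Ω G s t y) → ∀ c : ℝ → M, c t = x →
    HasMFDerivWithinAt 𝓘(ℝ, ℝ) 𝓘(ℝ, E) c (Icc 0 1) t
      ((1 : ℝ →L[ℝ] ℝ).smulRight (Ω.hamVectorField F (c t))) →
    HasMFDerivWithinAt 𝓘(ℝ, ℝ) 𝓘(ℝ, E) (fun τ => hamFlow Ω G s τ (c τ)) (Icc 0 1) t
      ((1 : ℝ →L[ℝ] ℝ).smulRight (Ω.hamVectorField K (hamFlow Ω G s t (c t))))

variable [T2Space M]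

theorem flowRegularAt_of_notMem (hG : IsCompactlySupportedFamily E G) {K : Set M} (hK : IsClosed K)
    (hK0 : ∀ t ∈ Icc (0 : ℝ) 1, ∀ x ∉ K, G t x = 0) {t : ℝ}
    (ht : t ∈ Icc (0 : ℝ) 1) (s : ℝ) {x : M} (hx : x ∉ K) : FlowRegularAt Ω G s t x := by
  have hmem : Icc (0 : ℝ) 1 ×ˢ Kᶜ ∈ 𝓝[Icc 0 1 ×ˢ univ] (t, x) := by
    rw [nhdsWithin_prod_eq, nhdsWithin_univ]
    exact prod_mem_prod self_mem_nhdsWithin (hK.isOpen_compl.mem_nhds hx)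
  have hflow : ∀ τ ∈ Icc (0 : ℝ) 1, ∀ y ∉ K, hamFlow Ω G s τ y = y := fun τ hτ y hy =>
    hamFlow_eq_self Ω hG hK hK0 hτ s hy
  have hdrift : ∀ τ ∈ Icc (0 : ℝ) 1, ∀ y ∉ K, hamDrift Ω G s τ y = 0 := fun τ hτ y hy =>
    hamDrift_eq_zero Ω hG hK hK0 hτ s hy
  refine ⟨?_, ?_, ?_⟩
  · refine (contMDiffWithinAt_snd (n := ∞)).congr_of_eventuallyEq ?_ (hflow t ht x hx)
    filter_upwards [hmem] with p hp using hflow p.1 hp.1 p.2 hp.2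
  · refine (contMDiffWithinAt_const (c := (0 : ℝ)) (n := ∞)).congr_of_eventuallyEq ?_
      (hdrift t ht x hx)
    filter_upwards [hmem] with p hp using hdrift p.1 hp.1 p.2 hp.2
  · rintro F L - - hFL c rfl hc
    refine hc.congr_velocity (X := Ω.hamVectorField F) (X' := Ω.hamVectorField L) ?_
      (hflow t ht _ hx) ?_
    · filter_upwards [hc.continuousWithinAt (hK.isOpen_compl.mem_nhds hx), self_mem_nhdsWithin]
        with τ hτ hτI using hflow τ hτI _ hτ
    · refine hamVectorField_congr Ω ?_
      filter_upwards [hK.isOpen_compl.mem_nhds hx] with y hy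
      have h := hFL y
      rw [hflow t ht y hy, hdrift t ht y hy, add_zero] at h
      exact h.symm

/-- In a chart everything follows from `exists_local_hamFlow`. The identity `Ψ_s^*ω = ω + dt ∧ dζ_s`
is used twice: on two spatial vectors it makes the spatial derivative of the flow invertible, and on
a velocity and a spatial vector it determines the new velocity. -/
theorem eventually_flowRegularAt (hG : IsCompactlySupportedFamily E G) {t₀ : ℝ}
    (ht₀ : t₀ ∈ Icc (0 : ℝ) 1) (x₀ : M) :
    ∀ᶠ z : ℝ × ℝ × M in 𝓝 (0, t₀, x₀), z.2.1 ∈ Icc (0 : ℝ) 1 →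
      FlowRegularAt Ω G z.1 z.2.1 z.2.2 := by
  have he := chart_mem_atlas E x₀
  set e := chartAt E x₀
  have hx₀ : x₀ ∈ e.source := mem_chart_source E x₀
  obtain ⟨δ, hδ, Ψ, ζ, hΨ, hζ, h⟩ := exists_local_hamFlow Ω hG he ht₀ (mem_chart_target E x₀)
  have hn1 : ∀ᶠ z : ℝ × ℝ × M in 𝓝 (0, t₀, x₀), z.1 ∈ Ioo (-δ) δ :=
    continuousAt_fst.eventually_mem (Ioo_mem_nhds (by simp [hδ]) (by simp [hδ]))
  have hn2 : ∀ᶠ z : ℝ × ℝ × M in 𝓝 (0, t₀, x₀), z.2.1 ∈ Ioo (t₀ - δ) (t₀ + δ) :=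
    (continuous_fst.comp continuous_snd).continuousAt.eventually_mem
      (Ioo_mem_nhds (by simp [hδ]) (by simp [hδ]))
  set U : Set M := e.source ∩ e ⁻¹' Metric.ball (e x₀) δ with hU
  have hUo : IsOpen U := e.continuousOn.isOpen_inter_preimage e.open_source Metric.isOpen_ball
  have hn3 : ∀ᶠ z : ℝ × ℝ × M in 𝓝 (0, t₀, x₀), z.2.2 ∈ U :=
    (continuous_snd.comp continuous_snd).continuousAt.eventually_mem
      (hUo.mem_nhds ⟨hx₀, Metric.mem_ball_self hδ⟩)
  filter_upwards [hn1, hn2, hn3]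
  rintro ⟨s, t, x⟩ hs htJ hx ht
  simp only at hs htJ hx ht ⊢
  set S := Ioo (-δ) δ ×ˢ flowDomain δ t₀ (e x₀) with hS
  have hmem : (Icc (0 : ℝ) 1 ∩ Ioo (t₀ - δ) (t₀ + δ)) ×ˢ U ∈ 𝓝[Icc 0 1 ×ˢ univ] (t, x) := by
    rw [nhdsWithin_prod_eq, nhdsWithin_univ]
    exact prod_mem_prod (inter_mem_nhdsWithin _ (Ioo_mem_nhds htJ.1 htJ.2)) (hUo.mem_nhds hx)
  have hpt : (t, x) ∈ (Icc (0 : ℝ) 1 ∩ Ioo (t₀ - δ) (t₀ + δ)) ×ˢ U := ⟨⟨ht, htJ⟩, hx⟩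
  have hq : ∀ τ ∈ Icc (0 : ℝ) 1 ∩ Ioo (t₀ - δ) (t₀ + δ), ∀ y ∈ U,
      ((τ, e y) : ℝ × E) ∈ flowDomain δ t₀ (e x₀) := fun τ hτ y hy => ⟨hτ, hy.2⟩
  have hflow : ∀ τ ∈ Icc (0 : ℝ) 1 ∩ Ioo (t₀ - δ) (t₀ + δ), ∀ y ∈ U,
      hamFlow Ω G s τ y = e.symm (Ψ (s, τ, e y)) := by
    intro τ hτ y hy
    have h1 := (h s hs _ (hq τ hτ y hy)).2.2.1
    rwa [e.left_inv hy.1] at h1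
  have hdrift : ∀ τ ∈ Icc (0 : ℝ) 1 ∩ Ioo (t₀ - δ) (t₀ + δ), ∀ y ∈ U,
      hamDrift Ω G s τ y = ζ (s, τ, e y) := by
    intro τ hτ y hy
    have h1 := (h s hs _ (hq τ hτ y hy)).2.2.2.1
    rwa [e.left_inv hy.1] at h1
  have hms : MapsTo (fun q : ℝ × E => (s, q)) (flowDomain δ t₀ (e x₀)) S := fun q hq => ⟨hs, hq⟩
  have hΨs : ContDiffOn ℝ ∞ (fun q : ℝ × E => Ψ (s, q)) (flowDomain δ t₀ (e x₀)) :=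
    hΨ.comp (contDiff_const.prodMk contDiff_id).contDiffOn hms
  have hζs : ContDiffOn ℝ ∞ (fun q : ℝ × E => ζ (s, q)) (flowDomain δ t₀ (e x₀)) :=
    hζ.comp (contDiff_const.prodMk contDiff_id).contDiffOn hms
  refine ⟨?_, ?_, ?_⟩
  · have h1 := contMDiffOn_family_of_chart (M := M) he hΨs
    have h2 : ContMDiffOn 𝓘(ℝ, E) 𝓘(ℝ, E) ∞ e.symm e.target :=
      contMDiffOn_symm_of_mem_maximalAtlas (IsManifold.subset_maximalAtlas he)
    have h3 := h2.comp h1 fun p hp => (h s hs _ (hq _ hp.1 _ hp.2)).2.1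
    exact ((h3.congr fun p hp => hflow p.1 hp.1 p.2 hp.2) (t, x) hpt).mono_of_mem_nhdsWithin hmem
  · have h1 := contMDiffOn_family_of_chart (M := M) he hζs
    exact ((h1.congr fun p hp => hdrift p.1 hp.1 p.2 hp.2) (t, x) hpt).mono_of_mem_nhdsWithin hmem
  · rintro F K hF hK hFK c rfl hc
    have hqt := hq t ⟨ht, htJ⟩ (c t) hx
    have hp : (s, t, e (c t)) ∈ S := ⟨hs, hqt⟩
    have hΨd := (hΨ.differentiableOn (by simp) _ hp).hasFDerivWithinAt
    have hζd := (hζ.differentiableOn (by simp) _ hp).hasFDerivWithinAt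
    have hct : e (c t) ∈ e.target := e.map_source hx.1
    have hΨt : Ψ (s, t, e (c t)) ∈ e.target := (h s hs _ hqt).2.1
    have hlin := (h s hs _ hqt).2.2.2.2
    simp only at hlin
    set D := fderivWithin ℝ Ψ S (s, t, e (c t)) with hD
    set d := fderivWithin ℝ ζ S (s, t, e (c t)) with hd
    have hFd := hF.mdifferentiable (by simp)
    have hKd := hK.mdifferentiable (by simp)
    -- the velocity in the chart
    have hĉ : HasDerivWithinAt (F := E) (e ∘ c) (hamChart Ω F e (e (c t))) (Icc 0 1) t := by
      have h1 := hasDerivWithinAt_chart_comp he hx.1 hc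
      have h2 : ∀ y, y = c t → mfderiv 𝓘(ℝ, E) 𝓘(ℝ, E) e y (Ω.hamVectorField F y) =
          mfderiv 𝓘(ℝ, E) 𝓘(ℝ, E) e (c t) (Ω.hamVectorField F (c t)) := fun y hy => by rw [hy]
      exact h1.congr_deriv (h2 _ (e.left_inv hx.1)).symm
    have hcU : ∀ᶠ τ in 𝓝[Icc 0 1] t, τ ∈ Icc (0 : ℝ) 1 ∩ Ioo (t₀ - δ) (t₀ + δ) ∧ c τ ∈ U :=
      Filter.Eventually.and (inter_mem_nhdsWithin _ (Ioo_mem_nhds htJ.1 htJ.2))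
        (hc.continuousWithinAt (hUo.mem_nhds hx))
    set w := D (0, 1, hamChart Ω F e (e (c t))) with hw
    have hcurve : HasDerivWithinAt (fun τ => Ψ (s, τ, (e ∘ c) τ)) w (Icc 0 1) t := by
      set J := {τ | τ ∈ Icc (0 : ℝ) 1 ∩ Ioo (t₀ - δ) (t₀ + δ) ∧ c τ ∈ U}
      have h1 : HasDerivWithinAt (fun τ => (s, τ, (e ∘ c) τ))
          ((0 : ℝ), (1 : ℝ), hamChart Ω F e (e (c t))) J t :=
        (hasDerivWithinAt_const t J s).prodMk ((hasDerivWithinAt_id t J).prodMk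
          (hĉ.mono fun τ hτ => hτ.1.1))
      have hm : MapsTo (fun τ => (s, τ, (e ∘ c) τ)) J S := fun τ hτ => ⟨hs, hq τ hτ.1 _ hτ.2⟩
      exact (HasFDerivWithinAt.comp_hasDerivWithinAt t (l := Ψ)
        (f := fun τ => (s, τ, (e ∘ c) τ)) hΨd h1 hm).mono_of_mem_nhdsWithin hcU
    have hΨy := hasFDerivAt_slice hs ⟨ht, htJ⟩ hx.2 hΨd
    have hζy := hasFDerivAt_slice hs ⟨ht, htJ⟩ hx.2 hζd
    -- the derivative of the flow is an isomorphism
    have hsurj : Function.Surjective fun u : E => D (0, 0, u) := by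
      set L : E →ₗ[ℝ] E := (D.comp ((ContinuousLinearMap.inr ℝ ℝ (ℝ × E)).comp
          (ContinuousLinearMap.inr ℝ ℝ E))).toLinearMap with hL
      have hinj : Function.Injective L := by
        rw [injective_iff_map_eq_zero]
        intro u hu
        refine chartForm_nondegenerate Ω he hct fun v => ?_
        have h1 := hlin (0, u) (0, v)
        have h2 : D (0, 0, u) = 0 := hu
        simp only [h2, zero_mul, add_zero, sub_zero] at h1
        rw [← h1]
        exact (chartForm Ω.form e _).map_coord_zero 0 rfl
      exact LinearMap.injective_iff_surjective.1 hinj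
    have hrel : ∀ u, fderiv ℝ (K ∘ e.symm) (Ψ (s, t, e (c t))) (D (0, 0, u)) =
        fderiv ℝ (F ∘ e.symm) (e (c t)) u + d (0, 0, u) := by
      have hsymm : ∀ y ∈ e.target, ∀ f : M → ℝ, ContMDiff 𝓘(ℝ, E) 𝓘(ℝ, ℝ) ∞ f →
          DifferentiableAt ℝ (f ∘ e.symm) y := by
        intro y hy f hf
        have h1 : ContMDiffOn 𝓘(ℝ, E) 𝓘(ℝ, E) ∞ e.symm e.target :=
          contMDiffOn_symm_of_mem_maximalAtlas (IsManifold.subset_maximalAtlas he)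
        exact ((contMDiffOn_iff_contDiffOn.1 (hf.comp_contMDiffOn h1)).contDiffAt
          (e.open_target.mem_nhds hy)).differentiableAt (by simp)
      have h1 := (hsymm _ hΨt K hK).hasFDerivAt.comp (e (c t)) hΨy
      have h2 := (hsymm _ hct F hF).hasFDerivAt.add hζy
      have h3 : (K ∘ e.symm) ∘ (fun y => Ψ (s, t, y)) =ᶠ[𝓝 (e (c t))]
          F ∘ e.symm + fun y => ζ (s, t, y) := by
        filter_upwards [Metric.isOpen_ball.mem_nhds hx.2] with y hy
        have h4 := h s hs (t, y) ⟨⟨ht, htJ⟩, hy⟩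
        have h5 := hFK (e.symm y)
        have h6 : hamFlow Ω G s t (e.symm y) = e.symm (Ψ (s, t, y)) := h4.2.2.1
        have h7 : hamDrift Ω G s t (e.symm y) = ζ (s, t, y) := h4.2.2.2.1
        rw [h6, h7] at h5
        exact h5
      have h4 := h1.unique (h2.congr_of_eventuallyEq h3)
      intro u
      exact congrArg (fun L : E →L[ℝ] ℝ => L u) h4
    -- On `(1, X_F)` and `(0, u)` the identity reads `ω(w, Du) = dF(u) + dζ(u)`, which is `dK(Du)`
    -- by differentiating `K ∘ flow = F + drift`. As every vector is some `Du`, nondegeneracy gives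
    -- `w = X_K`.
    have hwK : w = hamChart Ω K e (Ψ (s, t, e (c t))) := by
      refine eq_hamChart_of_forall Ω he hΨt (hKd _) fun v => ?_
      obtain ⟨u, rfl⟩ := hsurj v
      have h1 := hlin (1, hamChart Ω F e (e (c t))) (0, u)
      simp only [one_mul, zero_mul, sub_zero] at h1
      rw [hw, h1, hrel, chartForm_hamChart Ω he hct (hFd _)]
    rw [hwK] at hcurve
    have h1 := hasMFDerivWithinAt_symm_comp he (c := fun τ => Ψ (s, τ, e (c τ))) hΨt hcurve
    rw [mfderiv_symm_hamChart Ω he K hΨt] at h1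
    refine h1.congr_velocity (X := Ω.hamVectorField K) (X' := Ω.hamVectorField K) ?_
      (hflow t ⟨ht, htJ⟩ _ hx) rfl
    filter_upwards [hcU] with τ hτ using hflow τ hτ.1 _ hτ.2

theorem eventually_forall_flowRegularAt (hG : IsCompactlySupportedFamily E G) :
    ∀ᶠ s in 𝓝 (0 : ℝ), ∀ t ∈ Icc (0 : ℝ) 1, ∀ x, FlowRegularAt Ω G s t x := by
  obtain ⟨K, hK, hK0⟩ := hG.2
  have h : ∀ᶠ s in 𝓝 (0 : ℝ), ∀ p ∈ Icc (0 : ℝ) 1 ×ˢ K, p.1 ∈ Icc (0 : ℝ) 1 →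
      FlowRegularAt Ω G s p.1 p.2 :=
    (isCompact_Icc.prod hK).eventually_forall_of_forall_eventually (x₀ := (0 : ℝ))
      fun p hp => eventually_flowRegularAt Ω hG hp.1 p.2
  filter_upwards [h] with s hs t ht x
  by_cases hx : x ∈ K
  · exact hs (t, x) ⟨ht, hx⟩ ht
  · exact flowRegularAt_of_notMem Ω hG hK.isClosed hK0 ht s hx

end FlowRegularAtPoint

/-! ### Total variation, and the drift to first order. -/

noncomputable section Totvar

section Elementary

variable {X : Type*} [Nonempty X] {f g : X → ℝ}

theorem iSup_sub_iSup_le {η : ℝ} (hf : BddAbove (range f)) (hg : BddAbove (range g))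
    (h : ∀ x, |f x - g x| ≤ η) : |(⨆ x, f x) - ⨆ x, g x| ≤ η := by
  rw [abs_le]
  constructor
  · have : (⨆ x, g x) ≤ (⨆ x, f x) + η := ciSup_le fun x => by
      have h1 := le_ciSup hf x
      have h2 := (abs_le.1 (h x)).1
      linarith
    linarith
  · have : (⨆ x, f x) ≤ (⨆ x, g x) + η := ciSup_le fun x => by
      have h1 := le_ciSup hg x
      have h2 := (abs_le.1 (h x)).2
      linarith
    linarith

theorem iInf_sub_iInf_le {η : ℝ} (hf : BddBelow (range f)) (hg : BddBelow (range g))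
    (h : ∀ x, |f x - g x| ≤ η) : |(⨅ x, f x) - ⨅ x, g x| ≤ η := by
  rw [abs_le]
  constructor
  · have : (⨅ x, g x) - η ≤ (⨅ x, f x) := le_ciInf fun x => by
      have h1 := ciInf_le hg x
      have h2 := (abs_le.1 (h x)).1
      linarith
    linarith
  · have : (⨅ x, f x) - η ≤ (⨅ x, g x) := le_ciInf fun x => by
      have h1 := ciInf_le hf x
      have h2 := (abs_le.1 (h x)).2
      linarith
    linarith

end Elementary

variable {X : Type*} {f g : X → ℝ}

theorem bddAbove_range_of_abs_le {C : ℝ} (h : ∀ x, |f x| ≤ C) : BddAbove (range f) :=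
  ⟨C, by rintro _ ⟨x, rfl⟩; exact (abs_le.1 (h x)).2⟩

theorem bddBelow_range_of_abs_le {C : ℝ} (h : ∀ x, |f x| ≤ C) : BddBelow (range f) :=
  ⟨-C, by rintro _ ⟨x, rfl⟩; exact (abs_le.1 (h x)).1⟩

variable {E : Type*} [NormedAddCommGroup E] [NormedSpace ℝ E] [FiniteDimensional ℝ E]
variable {M : Type*} [TopologicalSpace M] [ChartedSpace E M] [IsManifold 𝓘(ℝ, E) ∞ M]

theorem abs_totvar_sub_totvar_le [Nonempty M] {f g : M → ℝ} {C D η : ℝ} (hf : ∀ x, |f x| ≤ C)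
    (hg : ∀ x, |g x| ≤ D) (h : ∀ x, |f x - g x| ≤ η) : |totvar f - totvar g| ≤ 2 * η := by
  have h1 := abs_le.1 (iSup_sub_iSup_le (bddAbove_range_of_abs_le hf) (bddAbove_range_of_abs_le hg) h)
  have h2 := abs_le.1 (iInf_sub_iInf_le (bddBelow_range_of_abs_le hf) (bddBelow_range_of_abs_le hg) h)
  rw [totvar, totvar, abs_le]
  constructor <;> linarith [h1.1, h1.2, h2.1, h2.2]

theorem sub_le_totvar {f : M → ℝ} {C : ℝ} (hf : ∀ x, |f x| ≤ C) (x y : M) :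
    f x - f y ≤ totvar f :=
  sub_le_sub (le_ciSup (bddAbove_range_of_abs_le hf) x) (ciInf_le (bddBelow_range_of_abs_le hf) y)

theorem totvar_comp_surjective {f : M → ℝ} {φ : M → M} (hφ : Function.Surjective φ) :
    totvar (f ∘ φ) = totvar f := by
  simp only [totvar, Function.comp_apply]
  rw [hφ.iSup_comp (g := f), hφ.iInf_comp (g := f)]

theorem totvar_add_const [Nonempty M] {f : M → ℝ} {C : ℝ} (hf : ∀ x, |f x| ≤ C) (c : ℝ) :
    totvar (fun x => f x + c) = totvar f := by
  rw [totvar, totvar, ← ciSup_add (bddAbove_range_of_abs_le hf),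
    ← ciInf_add (bddBelow_range_of_abs_le hf)]
  ring

theorem totvar_neg {f : M → ℝ} : totvar (fun x => -f x) = totvar f := by
  have h1 : range (fun x => -f x) = -range f := by
    rw [← image_neg_eq_neg, ← range_comp]; rfl
  rw [totvar, totvar, iSup, iInf, iSup, iInf, h1, Real.sInf_def, Real.sInf_def, neg_neg]
  ring

theorem IsCompactlySupportedFamily.exists_bound {F : ℝ → M → ℝ}
    (hF : IsCompactlySupportedFamily E F) : ∃ C, ∀ t ∈ Icc (0 : ℝ) 1, ∀ x, |F t x| ≤ C := by
  obtain ⟨K, hK, hK0⟩ := hF.2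
  obtain ⟨C, hC⟩ := (isCompact_Icc.prod hK).exists_bound_of_continuousOn
    (hF.1.continuousOn.mono (prod_mono_right (subset_univ K)))
  refine ⟨max C 0, fun t ht x => ?_⟩
  by_cases hx : x ∈ K
  · exact (hC (t, x) ⟨ht, hx⟩).trans (le_max_left _ _)
  · rw [hK0 t ht x hx, abs_zero]
    exact le_max_right _ _

/-- The compact common support turns joint continuity into closeness uniform in `x`. -/
theorem IsCompactlySupportedFamily.eventually_close {F : ℝ → M → ℝ}
    (hF : IsCompactlySupportedFamily E F) {t₀ : ℝ} (ht₀ : t₀ ∈ Icc (0 : ℝ) 1) {η : ℝ} (hη : 0 < η) :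
    ∀ᶠ t in 𝓝 t₀, t ∈ Icc (0 : ℝ) 1 → ∀ x, |F t x - F t₀ x| ≤ η := by
  obtain ⟨K, hK, hK0⟩ := hF.2
  have h : ∀ᶠ t in 𝓝 t₀, ∀ x ∈ K, t ∈ Icc (0 : ℝ) 1 → |F t x - F t₀ x| ≤ η := by
    refine hK.eventually_forall_of_forall_eventually fun x _ => ?_
    have h1 := hF.1.continuousOn (t₀, x) ⟨ht₀, mem_univ _⟩
    have h2 : ∀ᶠ p in 𝓝[Icc (0 : ℝ) 1 ×ˢ univ] (t₀, x), |F p.1 p.2 - F t₀ x| < η / 2 := by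
      have := (Metric.continuousWithinAt_iff'.1 h1) (η / 2) (by positivity)
      simpa [Real.dist_eq] using this
    have h3 : ∀ᶠ p in 𝓝 (t₀, x), |F t₀ p.2 - F t₀ x| < η / 2 := by
      have hc : ContinuousAt (fun p : ℝ × M => F t₀ p.2) (t₀, x) :=
        ((hF.contMDiff ht₀).continuous.comp continuous_snd).continuousAt
      have := (Metric.continuousAt_iff'.1 hc) (η / 2) (by positivity)
      simpa [Real.dist_eq] using this
    rw [eventually_nhdsWithin_iff] at h2
    filter_upwards [h2, h3] with p hp hp' hpt
    have h4 := abs_lt.1 (hp ⟨hpt, mem_univ _⟩)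
    have h5 := abs_lt.1 hp'
    rw [abs_le]
    constructor <;> linarith [h4.1, h4.2, h5.1, h5.2]
  filter_upwards [h] with t ht htI x
  by_cases hx : x ∈ K
  · exact ht x hx htI
  · rw [hK0 t htI x hx, hK0 t₀ ht₀ x hx]
    simpa using hη.le

theorem IsCompactlySupportedFamily.continuousOn_totvar [Nonempty M] {F : ℝ → M → ℝ}
    (hF : IsCompactlySupportedFamily E F) : ContinuousOn (fun t => totvar (F t)) (Icc 0 1) := by
  obtain ⟨C, hC⟩ := hF.exists_bound
  intro t₀ ht₀
  rw [Metric.continuousWithinAt_iff']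
  intro η hη
  have h := eventually_nhdsWithin_of_eventually_nhds (s := Icc 0 1)
    (hF.eventually_close ht₀ (η := η / 4) (by positivity))
  filter_upwards [h, self_mem_nhdsWithin] with t ht htI
  have h1 := abs_totvar_sub_totvar_le (hC t htI) (hC t₀ ht₀) (ht htI)
  rw [Real.dist_eq]
  linarith

section Drift

variable (Ω : SymplecticForm E M) {F G : ℝ → M → ℝ}

/-- The family of Poisson brackets of two families. -/
theorem isCompactlySupportedFamily_poisson [T2Space M] (hF : IsCompactlySupportedFamily E F)
    (hG : IsCompactlySupportedFamily E G) : IsCompactlySupportedFamily E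
      (fun t x => Ω.form x ![Ω.hamVectorField (F t) x, Ω.hamVectorField (G t) x]) := by
  refine isCompactlySupportedFamily_of_chart (fun e he => ?_) ?_
  · have h1 := ((contDiffOn_twoFormFlat (Ω.smooth e he)).comp (contDiffOn_snd (F := E)
      (s := Icc (0 : ℝ) 1 ×ˢ e.target)) fun p hp => hp.2)
    have h2 := contDiffOn_hamChart Ω he (uniqueDiffOn_Icc one_pos) hF.1
    have h3 := contDiffOn_hamChart Ω he (uniqueDiffOn_Icc one_pos) hG.1
    refine ((h1.clm_apply h2).clm_apply h3).congr fun p hp => ?_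
    rw [Function.comp_apply, twoFormFlat_apply, chartForm_apply, mfderiv_symm_hamChart Ω he _ hp.2,
      mfderiv_symm_hamChart Ω he _ hp.2]
  · obtain ⟨K, hK, hK0⟩ := hF.2
    refine ⟨K, hK, fun t ht x hx => ?_⟩
    rw [hamVectorField_zero_of_notMem Ω hK.isClosed (hK0 t ht) hx]
    exact (Ω.form x).map_coord_zero 0 rfl

/-- Along the flow of `G_t` the derivative of `∂_t G_t` is the bracket `ω(X_{∂_t G_t}, X_{G_t})`.
This is a compactly supported family, hence bounded, and two integrations in `σ` give the quadratic
error. -/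
theorem exists_hamDrift_estimate [T2Space M] (hG : IsCompactlySupportedFamily E G) :
    ∃ C, 0 ≤ C ∧ ∀ t ∈ Icc (0 : ℝ) 1, ∀ s x,
      |hamDrift Ω G s t x - s * timeDeriv G t x| ≤ C * s ^ 2 := by
  obtain ⟨C, hC⟩ := (isCompactlySupportedFamily_poisson Ω hG.timeDeriv hG).exists_bound
  refine ⟨|C|, abs_nonneg _, fun t ht s x => ?_⟩
  have hder : ∀ σ, HasDerivAt (fun σ => timeDeriv G t (hamFlow Ω G σ t x))
      (Ω.form (hamFlow Ω G σ t x) ![Ω.hamVectorField (timeDeriv G t) (hamFlow Ω G σ t x),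
        Ω.hamVectorField (G t) (hamFlow Ω G σ t x)]) σ := by
    intro σ
    have h1 := ((hG.timeDeriv.contMDiff ht).mdifferentiable (by simp)
      (hamFlow Ω G σ t x)).hasMFDerivAt.comp σ (isMIntegralCurve_hamFlow Ω hG ht x σ)
    rw [Ω.form_hamVectorField]
    have h2 : HasMFDerivWithinAt 𝓘(ℝ, ℝ) 𝓘(ℝ, ℝ) (fun σ => timeDeriv G t (hamFlow Ω G σ t x)) univ σ
        ((1 : ℝ →L[ℝ] ℝ).smulRight (mfderiv 𝓘(ℝ, E) 𝓘(ℝ, ℝ) (timeDeriv G t) (hamFlow Ω G σ t x)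
          (Ω.hamVectorField (G t) (hamFlow Ω G σ t x))) : ℝ →L[ℝ] ℝ) := by
      refine (hasMFDerivWithinAt_univ.2 h1).congr_mfderiv ?_
      ext
      exact (congrArg (mfderiv 𝓘(ℝ, E) 𝓘(ℝ, ℝ) (timeDeriv G t) (hamFlow Ω G σ t x))
        (one_smul ℝ (Ω.hamVectorField (G t) (hamFlow Ω G σ t x)))).trans (one_smul ℝ _).symm
    exact (hasDerivWithinAt_of_hasMFDerivWithinAt h2).hasDerivAt univ_mem
  have hlip : ∀ σ, |timeDeriv G t (hamFlow Ω G σ t x) - timeDeriv G t x| ≤ |C| * |σ| := by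
    intro σ
    have h1 := convex_univ.norm_image_sub_le_of_norm_hasDerivWithin_le (C := |C|)
      (fun σ _ => (hder σ).hasDerivWithinAt)
      (fun σ _ => (hC t ht _).trans (le_abs_self C)) (mem_univ 0) (mem_univ σ)
    simpa [hamFlow_zero Ω hG ht x] using h1
  have hint : hamDrift Ω G s t x - s * timeDeriv G t x =
      ∫ σ in (0 : ℝ)..s, (timeDeriv G t (hamFlow Ω G σ t x) - timeDeriv G t x) := by
    rw [intervalIntegral.integral_sub
      ((continuous_timeDeriv_hamFlow Ω hG ht x).intervalIntegrable _ _)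
      intervalIntegrable_const, intervalIntegral.integral_const, hamDrift]
    simp
  rw [hint]
  have h2 := intervalIntegral.norm_integral_le_of_norm_le_const (a := 0) (b := s) (C := |C| * |s|)
    (f := fun σ => timeDeriv G t (hamFlow Ω G σ t x) - timeDeriv G t x) (fun σ hσ => by
      refine (hlip σ).trans (mul_le_mul_of_nonneg_left ?_ (abs_nonneg C))
      rcases mem_uIoc.1 hσ with h | h
      · rw [abs_of_pos h.1, abs_of_nonneg (h.1.le.trans h.2)]; exact h.2
      · rw [abs_of_nonpos h.2, abs_of_nonpos (h.1.le.trans h.2)]; linarith [h.1])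
  rw [sub_zero, mul_assoc, abs_mul_abs_self, ← sq] at h2
  exact h2

end Drift

end Totvar

/-! ### Criteria for a map to be open and onto. -/

noncomputable section Surjectivity

variable {E : Type*} [NormedAddCommGroup E] [NormedSpace ℝ E] [FiniteDimensional ℝ E]
variable {M : Type*} [TopologicalSpace M] [ChartedSpace E M] [IsManifold 𝓘(ℝ, E) ∞ M]
variable {Ω : SymplecticForm E M} {H : ℝ → M → ℝ} {φ : ℝ → M → M}

theorem Generates.contMDiff (hφ : Generates Ω H φ) {t : ℝ} (ht : t ∈ Icc (0 : ℝ) 1) :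
    ContMDiff 𝓘(ℝ, E) 𝓘(ℝ, E) ∞ (φ t) := by
  have h2 : ContMDiff 𝓘(ℝ, E) (𝓘(ℝ, ℝ).prod 𝓘(ℝ, E)) ∞ fun x : M => (t, x) :=
    contMDiff_const.prodMk contMDiff_id
  exact hφ.2.1.comp_contMDiff h2 fun x => ⟨ht, mem_univ _⟩

/-- The range is open, and it is closed as the union of the compact `f '' K` and the closure of
`Kᶜ`, which `f` fixes pointwise. -/
theorem surjective_of_isOpenMap_of_eq_self [T2Space M] [ConnectedSpace M] {f : M → M}
    (hf : Continuous f) (ho : IsOpenMap f) {K : Set M} (hK : IsCompact K) (h : ∀ x ∉ K, f x = x) :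
    Function.Surjective f := by
  rw [← range_eq_univ]
  refine IsClopen.eq_univ ⟨?_, ho.isOpen_range⟩ (range_nonempty f)
  have hcl : ∀ x ∈ closure Kᶜ, f x = x := fun x hx =>
    (isClosed_eq hf continuous_id).closure_subset_iff.2 (fun y hy => h y hy) hx
  have hr : range f = f '' K ∪ closure Kᶜ := by
    ext y
    constructor
    · rintro ⟨x, rfl⟩
      by_cases hx : x ∈ K
      · exact Or.inl ⟨x, hx, rfl⟩
      · rw [h x hx]; exact Or.inr (subset_closure hx)
    · rintro (⟨x, -, rfl⟩ | hy)
      · exact ⟨x, rfl⟩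
      · exact ⟨y, hcl y hy⟩
  rw [hr]
  exact (hK.image hf).isClosed.union isClosed_closure

theorem fderiv_chart_comp {e e₀ : OpenPartialHomeomorph M E} (he : e ∈ atlas E M)
    (he₀ : e₀ ∈ atlas E M) {f : M → M} {y : E} (hy : y ∈ e₀.target)
    (hf : MDifferentiableAt 𝓘(ℝ, E) 𝓘(ℝ, E) f (e₀.symm y)) (hfy : f (e₀.symm y) ∈ e.source)
    (a : E) : fderiv ℝ (e ∘ f ∘ e₀.symm) y a =
      mfderiv 𝓘(ℝ, E) 𝓘(ℝ, E) e (f (e₀.symm y)) (mfderiv 𝓘(ℝ, E) 𝓘(ℝ, E) f (e₀.symm y)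
        (mfderiv 𝓘(ℝ, E) 𝓘(ℝ, E) e₀.symm y a)) := by
  have h := ((hasMFDerivAt_atlas he hfy).comp y
    (hf.hasMFDerivAt.comp y (hasMFDerivAt_atlas_symm he₀ hy))).mfderiv
  rw [mfderiv_eq_fderiv] at h
  exact congrArg (fun L : E →L[ℝ] E => L a) h

/-- In equal finite dimensions an injective derivative is onto, and the local open mapping theorem
applies in charts. -/
theorem isOpenMap_of_injective_mfderiv {f : M → M} (hf : ContMDiff 𝓘(ℝ, E) 𝓘(ℝ, E) ∞ f)
    (hinj : ∀ x, Function.Injective (mfderiv 𝓘(ℝ, E) 𝓘(ℝ, E) f x)) : IsOpenMap f := by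
  have : CompleteSpace E := FiniteDimensional.complete ℝ E
  refine IsOpenMap.of_nhds_le fun x => ?_
  have he₀ := chart_mem_atlas E x
  have hx₀ := mem_chart_source E x
  set e₀ := chartAt E x
  have he := chart_mem_atlas E (f x)
  have hx := mem_chart_source E (f x)
  set e := chartAt E (f x)
  have hy₀ : e₀ x ∈ e₀.target := e₀.map_source hx₀
  have hfx : f (e₀.symm (e₀ x)) ∈ e.source := by rwa [e₀.left_inv hx₀]
  have hs₀ : ContMDiffOn 𝓘(ℝ, E) 𝓘(ℝ, E) ∞ e₀.symm e₀.target :=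
    contMDiffOn_symm_of_mem_maximalAtlas (IsManifold.subset_maximalAtlas he₀)
  have hs : ContMDiffOn 𝓘(ℝ, E) 𝓘(ℝ, E) ∞ e e.source :=
    contMDiffOn_of_mem_maximalAtlas (IsManifold.subset_maximalAtlas he)
  have hc : ContDiffAt ℝ ∞ (e ∘ f ∘ e₀.symm) (e₀ x) := by
    have h1 := (hs.contMDiffAt (e.open_source.mem_nhds hfx)).comp (e₀ x)
      ((hf _).comp (e₀ x) (hs₀.contMDiffAt (e₀.open_target.mem_nhds hy₀)))
    exact contMDiffAt_iff_contDiffAt.1 h1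
  have hLinj : Function.Injective (fderiv ℝ (e ∘ f ∘ e₀.symm) (e₀ x)) := by
    rw [injective_iff_map_eq_zero]
    intro a ha
    have h1 := (fderiv_chart_comp he he₀ hy₀ (hf.mdifferentiable (by simp) _) hfx a).symm.trans ha
    have h2 : ∀ v : TangentSpace 𝓘(ℝ, E) (f (e₀.symm (e₀ x))),
        mfderiv 𝓘(ℝ, E) 𝓘(ℝ, E) e (f (e₀.symm (e₀ x))) v = 0 → v = 0 := by
      intro v hv
      have h3 := (mdifferentiable_of_mem_atlas (I := 𝓘(ℝ, E)) he).mfderiv_injective hfx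
      exact (injective_iff_map_eq_zero _).1 h3 v hv
    have h4 := h2 _ h1
    have h5 := (injective_iff_map_eq_zero _).1 (hinj (e₀.symm (e₀ x))) _ h4
    have h6 := mfderiv_atlas_comp_symm he₀ hy₀ a
    rw [← h6]
    have h7 : mfderiv 𝓘(ℝ, E) 𝓘(ℝ, E) e₀.symm (e₀ x) a = 0 := h5
    rw [h7]
    exact map_zero _
  have hstrict := hc.hasStrictFDerivAt (by simp)
  have hmap := hstrict.map_nhds_eq_of_surj
    (LinearMap.range_eq_top.2 (LinearMap.injective_iff_surjective.1 hLinj))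
  have h1 : map e (map f (𝓝 x)) = 𝓝 (e (f x)) := by
    have h2 : map e₀.symm (𝓝 (e₀ x)) = 𝓝 x := by
      rw [e₀.symm.map_nhds_eq hy₀, e₀.left_inv hx₀]
    rw [← h2, map_map, map_map]
    have h3 : (e ∘ f ∘ e₀.symm) (e₀ x) = e (f x) := by
      simp only [Function.comp_apply, e₀.left_inv hx₀]
    rw [← h3, ← hmap]
    rfl
  have h2 : map e.symm (map e (map f (𝓝 x))) = 𝓝 (f x) := by
    rw [h1, e.symm.map_nhds_eq (e.map_source hx), e.left_inv hx]
  have h3 : map e.symm (map e (map f (𝓝 x))) = map f (𝓝 x) := by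
    rw [map_map, map_map]
    refine Filter.map_congr ?_
    filter_upwards [hf.continuous.continuousAt (e.open_source.mem_nhds hx)] with y hy
    exact e.left_inv hy
  rw [← h2, h3]

/-- A bump function at `φ 0 x`, supported off `K` and off `φ t x`, is constant along the orbit: the
velocity vanishes off `K` and the bump vanishes near points of `K`. So it would equal `1` at `φ t
x`. -/
theorem Generates.eq_of_notMem [T2Space M] (hφ : Generates Ω H φ) {K : Set M} (hK : IsClosed K)
    (hK0 : ∀ t ∈ Icc (0 : ℝ) 1, ∀ x ∉ K, H t x = 0) {x : M} (hx : φ 0 x ∉ K) {t : ℝ}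
    (ht : t ∈ Icc (0 : ℝ) 1) : φ t x = φ 0 x := by
  by_contra hne
  have hU : {φ t x}ᶜ ∩ Kᶜ ∈ 𝓝 (φ 0 x) :=
    inter_mem (isOpen_compl_singleton.mem_nhds (Ne.symm hne)) (hK.isOpen_compl.mem_nhds hx)
  obtain ⟨f, -, hf⟩ := (SmoothBumpFunction.nhds_basis_tsupport (I := 𝓘(ℝ, E)) (φ 0 x)).mem_iff.1 hU
  have hfs : ContMDiff 𝓘(ℝ, E) 𝓘(ℝ, ℝ) ∞ f := f.contMDiff
  have hder : ∀ τ ∈ Icc (0 : ℝ) 1, HasDerivWithinAt (fun τ => f (φ τ x)) 0 (Icc 0 1) τ := by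
    intro τ hτ
    have h1 := ((hfs.mdifferentiable (by simp) (φ τ x)).hasMFDerivAt).comp_hasMFDerivWithinAt τ
      (hφ.2.2 τ hτ x)
    have h0 : mfderiv 𝓘(ℝ, E) 𝓘(ℝ, ℝ) f (φ τ x) (Ω.hamVectorField (H τ) (φ τ x)) = 0 := by
      by_cases hm : φ τ x ∈ K
      · have h2 : f =ᶠ[𝓝 (φ τ x)] fun _ => (0 : ℝ) := by
          have h3 : φ τ x ∉ tsupport f := fun h => (hf h).2 hm
          exact notMem_tsupport_iff_eventuallyEq.1 h3
        rw [h2.mfderiv_eq, mfderiv_const]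
        rfl
      · rw [hamVectorField_zero_of_notMem Ω hK (hK0 τ hτ) hm]
        exact map_zero _
    have h2 : HasMFDerivWithinAt 𝓘(ℝ, ℝ) 𝓘(ℝ, ℝ) (fun τ => f (φ τ x)) (Icc 0 1) τ
        ((1 : ℝ →L[ℝ] ℝ).smulRight (0 : ℝ) : ℝ →L[ℝ] ℝ) := by
      refine h1.congr_mfderiv ?_
      ext
      exact (congrArg (mfderiv 𝓘(ℝ, E) 𝓘(ℝ, ℝ) f (φ τ x)) (one_smul ℝ _)).trans
        (h0.trans (one_smul ℝ (0 : ℝ)).symm)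
    exact hasDerivWithinAt_of_hasMFDerivWithinAt h2
  have hconst := constant_of_derivWithin_zero
    (fun τ hτ => (hder τ hτ).differentiableWithinAt)
    (fun τ hτ => (hder τ (Ico_subset_Icc_self hτ)).derivWithin
      (uniqueDiffOn_Icc one_pos τ (Ico_subset_Icc_self hτ))) t ht
  simp only [f.eq_one] at hconst
  have hmem : φ t x ∈ tsupport f := subset_tsupport _ (by
    rw [Function.mem_support, hconst]; exact one_ne_zero)
  exact (hf hmem).1 rfl

end Surjectivity

/-! ### Hamiltonian isotopies keep the pulled-back form constant in time. -/

noncomputable section FormPreservation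

variable {E : Type*} [NormedAddCommGroup E] [NormedSpace ℝ E] [FiniteDimensional ℝ E]
variable {M : Type*} [TopologicalSpace M] [ChartedSpace E M] [IsManifold 𝓘(ℝ, E) ∞ M]
variable {Ω : SymplecticForm E M} {H : ℝ → M → ℝ} {φ : ℝ → M → M}

/-- Infinitesimal Cartan formula: the contraction of the pulled-back form with `∂_t` is `dH_t`,
which is exact, and the form is closed. It is the case `k = 0`, `λ = 0` of
`fderivWithin_pullback_closed_two_form`, with the time of the path as the distinguished variable. -/
theorem Generates.hasDerivWithinAt_form (hφ : Generates Ω H φ) {e₀ : OpenPartialHomeomorph M E}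
    (he₀ : e₀ ∈ atlas E M) {y₀ : E} (hy₀ : y₀ ∈ e₀.target) {t₀ : ℝ} (ht₀ : t₀ ∈ Icc (0 : ℝ) 1)
    (a b : E) :
    HasDerivWithinAt (fun t => Ω.form (φ t (e₀.symm y₀))
      ![mfderiv 𝓘(ℝ, E) 𝓘(ℝ, E) (φ t) (e₀.symm y₀) (mfderiv 𝓘(ℝ, E) 𝓘(ℝ, E) e₀.symm y₀ a),
        mfderiv 𝓘(ℝ, E) 𝓘(ℝ, E) (φ t) (e₀.symm y₀) (mfderiv 𝓘(ℝ, E) 𝓘(ℝ, E) e₀.symm y₀ b)])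
      0 (Icc 0 1) t₀ := by
  have he := chart_mem_atlas E (φ t₀ (e₀.symm y₀))
  have hx := mem_chart_source E (φ t₀ (e₀.symm y₀))
  set e := chartAt E (φ t₀ (e₀.symm y₀))
  have hs₀ : ContMDiffOn 𝓘(ℝ, E) 𝓘(ℝ, E) ∞ e₀.symm e₀.target :=
    contMDiffOn_symm_of_mem_maximalAtlas (IsManifold.subset_maximalAtlas he₀)
  have hs : ContMDiffOn 𝓘(ℝ, E) 𝓘(ℝ, E) ∞ e e.source :=
    contMDiffOn_of_mem_maximalAtlas (IsManifold.subset_maximalAtlas he)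
  have hφc : ContMDiffOn 𝓘(ℝ, ℝ × E) 𝓘(ℝ, E) ∞ (fun p : ℝ × E => φ p.1 (e₀.symm p.2))
      (Icc 0 1 ×ˢ e₀.target) := by
    have h2 : ContMDiffOn 𝓘(ℝ, ℝ × E) (𝓘(ℝ, ℝ).prod 𝓘(ℝ, E)) ∞
        (fun p : ℝ × E => (p.1, e₀.symm p.2)) (Icc 0 1 ×ˢ e₀.target) :=
      contDiff_fst.contMDiff.contMDiffOn.prodMk
        (hs₀.comp contDiff_snd.contMDiff.contMDiffOn fun p hp => hp.2)
    exact hφ.2.1.comp h2 fun p hp => ⟨hp.1, mem_univ _⟩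
  obtain ⟨δ, hδ, hδU⟩ : ∃ δ > 0, ∀ q ∈ flowDomain δ t₀ y₀,
      q.2 ∈ e₀.target ∧ φ q.1 (e₀.symm q.2) ∈ e.source := by
    have h1 : ∀ᶠ q in 𝓝 (t₀, y₀), q ∈ Icc (0 : ℝ) 1 ×ˢ e₀.target → φ q.1 (e₀.symm q.2) ∈ e.source :=
      eventually_nhdsWithin_iff.1 (hφc.continuousOn (t₀, y₀) ⟨ht₀, hy₀⟩
        (e.open_source.mem_nhds hx))
    have h2 : ∀ᶠ q : ℝ × E in 𝓝 (t₀, y₀), q.2 ∈ e₀.target :=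
      continuousAt_snd.eventually_mem (e₀.open_target.mem_nhds hy₀)
    obtain ⟨δ, hδ, h⟩ := Metric.eventually_nhds_iff_ball.1 (h1.and h2)
    refine ⟨δ, hδ, fun q hq => ?_⟩
    have hqb : q ∈ Metric.ball (t₀, y₀) δ := by
      rw [← ball_prod_same, Real.ball_eq_Ioo]
      exact ⟨hq.1.2, hq.2⟩
    exact ⟨(h q hqb).2, (h q hqb).1 ⟨hq.1.1, (h q hqb).2⟩⟩
  set S := flowDomain δ t₀ y₀ with hS
  have hScv : Convex ℝ S := convex_flowDomain _ _ _
  have hSi : (interior S).Nonempty := interior_flowDomain_nonempty hδ ht₀ y₀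
  have hSu : UniqueDiffOn ℝ S := uniqueDiffOn_convex hScv hSi
  have hSc : S ⊆ closure (interior S) := by
    rw [hScv.closure_interior_eq_closure_of_nonempty_interior hSi]; exact subset_closure
  set Ψ : ℝ × E → E := fun q => e (φ q.1 (e₀.symm q.2)) with hΨdef
  have hΨ : ContDiffOn ℝ ∞ Ψ S := by
    rw [← contMDiffOn_iff_contDiffOn]
    exact hs.comp (hφc.mono fun q hq => ⟨hq.1.1, (hδU q hq).1⟩) fun q hq => (hδU q hq).2
  have hΨT : MapsTo Ψ S e.target := fun q hq => e.map_source (hδU q hq).2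
  have hmap : MapsTo (fun p : ℝ × E => (p.1, Ψ p)) S (Icc 0 1 ×ˢ e.target) :=
    fun p hp => ⟨hp.1.1, hΨT hp⟩
  have hg : ContDiffOn ℝ ∞ (fun p : ℝ × E => H p.1 (e.symm (Ψ p))) S :=
    (hφ.1.contDiffOn_chart he).comp (contDiff_fst.contDiffOn.prodMk hΨ) hmap
  have hball : UniqueDiffOn ℝ (Metric.ball y₀ δ) := Metric.isOpen_ball.uniqueDiffOn
  have hslice : ∀ p ∈ S, HasFDerivAt (fun y => Ψ (p.1, y))
      ((fderivWithin ℝ Ψ S p).comp (ContinuousLinearMap.inr ℝ ℝ E)) p.2 := by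
    intro p hp
    have h1 : HasFDerivWithinAt (fun y => Ψ (p.1, y))
        ((fderivWithin ℝ Ψ S p).comp (ContinuousLinearMap.inr ℝ ℝ E)) (Metric.ball y₀ δ) p.2 :=
      (hΨ.differentiableOn (by simp) p hp).hasFDerivWithinAt.comp (f := fun y => (p.1, y)) p.2
        (hasFDerivAt_prodMk_right p.1 p.2).hasFDerivWithinAt fun y hy => ⟨hp.1, hy⟩
    exact h1.hasFDerivAt (Metric.isOpen_ball.mem_nhds hp.2)
  have hcontr : ∀ p ∈ S, ∀ b : E, chartForm Ω.form e (Ψ p)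
      ![fderivWithin ℝ Ψ S p (1, 0), fderivWithin ℝ Ψ S p (0, b)] =
      fderivWithin ℝ (fun p : ℝ × E => H p.1 (e.symm (Ψ p))) S p (0, b) - 0 * 0 := by
    intro p hp b
    have h1 : fderivWithin ℝ Ψ S p (1, 0) = hamChart Ω (H p.1) e (Ψ p) := by
      have h2 := hasDerivWithinAt_prod_inl hp.2 (hΨ.differentiableOn (by simp) p hp)
      have h3 := hasDerivWithinAt_chart_comp he (hδU p hp).2 (hφ.2.2 p.1 hp.1.1 (e₀.symm p.2))
      have h4 := h3.mono (inter_subset_left (t := Ioo (t₀ - δ) (t₀ + δ)))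
      have h5 : UniqueDiffWithinAt ℝ (Icc (0 : ℝ) 1 ∩ Ioo (t₀ - δ) (t₀ + δ)) p.1 :=
        (uniqueDiffOn_Icc one_pos p.1 hp.1.1).inter (Ioo_mem_nhds hp.1.2.1 hp.1.2.2)
      have h6 : fderivWithin ℝ Ψ S p (1, 0) = _ := h5.eq_deriv _ h2 h4
      rw [h6]
      have h7 : ∀ x, x = φ p.1 (e₀.symm p.2) →
          mfderiv 𝓘(ℝ, E) 𝓘(ℝ, E) e x (Ω.hamVectorField (H p.1) x) =
          mfderiv 𝓘(ℝ, E) 𝓘(ℝ, E) e (φ p.1 (e₀.symm p.2))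
            (Ω.hamVectorField (H p.1) (φ p.1 (e₀.symm p.2))) := fun x hx => by rw [hx]
      exact (h7 _ (e.left_inv (hδU p hp).2)).symm
    have hHd : MDifferentiableAt 𝓘(ℝ, E) 𝓘(ℝ, ℝ) (H p.1) (e.symm (Ψ p)) :=
      (hφ.1.contMDiff hp.1.1).mdifferentiable (by simp) _
    rw [h1, chartForm_hamChart Ω he (hΨT hp) hHd, zero_mul, sub_zero]
    have hs' : ContMDiffOn 𝓘(ℝ, E) 𝓘(ℝ, E) ∞ e.symm e.target :=
      contMDiffOn_symm_of_mem_maximalAtlas (IsManifold.subset_maximalAtlas he)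
    have hHe : DifferentiableAt ℝ (H p.1 ∘ e.symm) (Ψ p) :=
      ((contMDiffOn_iff_contDiffOn.1 ((hφ.1.contMDiff hp.1.1).comp_contMDiffOn hs')).contDiffAt
        (e.open_target.mem_nhds (hΨT hp))).differentiableAt (by simp)
    have h2 := hHe.hasFDerivAt.comp (f := fun y => Ψ (p.1, y)) p.2 (hslice p hp)
    exact (fderivWithin_prod_inr (J := Icc (0 : ℝ) 1 ∩ Ioo (t₀ - δ) (t₀ + δ)) hball hp.1 hp.2
      (hg.differentiableOn (by simp) p hp) h2.hasFDerivWithinAt b).symm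
  have hform := fun p (hp : p ∈ S) => fderivWithin_pullback_closed_two_form hSu hSc e.open_target
    (Ω.smooth e he) (Ω.closed e he) hΨ hΨT hg (contDiffOn_const (c := (0 : ℝ))) (fun _ => 0)
    hcontr hp a b
  have hpt : (t₀, y₀) ∈ S := ⟨⟨ht₀, by simp [hδ], by simp [hδ]⟩, Metric.mem_ball_self hδ⟩
  have h1 := (hasDerivWithinAt_prod_inl hpt.2 (hform _ hpt).1).congr_deriv
    ((hform _ hpt).2.trans (by ring : _ = (0 : ℝ)))
  have hJ : Icc (0 : ℝ) 1 ∩ Ioo (t₀ - δ) (t₀ + δ) ∈ 𝓝[Icc 0 1] t₀ :=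
    inter_mem_nhdsWithin _ (Ioo_mem_nhds hpt.1.2.1 hpt.1.2.2)
  have heq : ∀ t ∈ Icc (0 : ℝ) 1 ∩ Ioo (t₀ - δ) (t₀ + δ), Ω.form (φ t (e₀.symm y₀))
      ![mfderiv 𝓘(ℝ, E) 𝓘(ℝ, E) (φ t) (e₀.symm y₀) (mfderiv 𝓘(ℝ, E) 𝓘(ℝ, E) e₀.symm y₀ a),
        mfderiv 𝓘(ℝ, E) 𝓘(ℝ, E) (φ t) (e₀.symm y₀) (mfderiv 𝓘(ℝ, E) 𝓘(ℝ, E) e₀.symm y₀ b)] =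
      chartForm Ω.form e (Ψ (t, y₀)) ![fderivWithin ℝ Ψ S (t, y₀) (0, a),
        fderivWithin ℝ Ψ S (t, y₀) (0, b)] := by
    intro t ht
    have hp : (t, y₀) ∈ S := ⟨ht, hpt.2⟩
    have hd : ∀ a, fderivWithin ℝ Ψ S (t, y₀) (0, a) =
        mfderiv 𝓘(ℝ, E) 𝓘(ℝ, E) e (φ t (e₀.symm y₀)) (mfderiv 𝓘(ℝ, E) 𝓘(ℝ, E) (φ t) (e₀.symm y₀)
        (mfderiv 𝓘(ℝ, E) 𝓘(ℝ, E) e₀.symm y₀ a)) := by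
      intro a
      rw [← fderiv_chart_comp he he₀ hy₀ ((hφ.contMDiff ht.1).mdifferentiable (by simp) _)
        (hδU _ hp).2 a]
      exact (congrArg (fun L : E →L[ℝ] E => L a) (hslice _ hp).fderiv).symm
    rw [chartForm_apply, hd, hd]
    have hinv : e.symm (Ψ (t, y₀)) = φ t (e₀.symm y₀) := e.left_inv (hδU _ hp).2
    have hcancel : ∀ v : TangentSpace 𝓘(ℝ, E) (φ t (e₀.symm y₀)),
        (mfderiv 𝓘(ℝ, E) 𝓘(ℝ, E) e.symm (Ψ (t, y₀))
          (mfderiv 𝓘(ℝ, E) 𝓘(ℝ, E) e (φ t (e₀.symm y₀)) v) : E) = v := by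
      intro v
      have h2 := (mdifferentiable_of_mem_atlas (I := 𝓘(ℝ, E)) he).symm_comp_deriv (hδU _ hp).2
      exact congrArg (fun L : TangentSpace 𝓘(ℝ, E) (φ t (e₀.symm y₀)) →L[ℝ]
        TangentSpace 𝓘(ℝ, E) (φ t (e₀.symm y₀)) => L v) h2
    have hgen : ∀ x (_ : x = φ t (e₀.symm y₀)) (v w : E), (Ω.form x : E [⋀^Fin 2]→L[ℝ] ℝ) ![v, w] =
        (Ω.form (φ t (e₀.symm y₀)) : E [⋀^Fin 2]→L[ℝ] ℝ) ![v, w] := by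
      rintro x rfl v w; rfl
    refine Eq.trans ?_ (hgen _ hinv _ _).symm
    rw [hcancel, hcancel]
  exact (h1.congr heq (heq t₀ hpt.1)).mono_of_mem_nhdsWithin hJ

end FormPreservation

/-! ### The length does not depend on the generator; lengths of variations. -/

noncomputable section LengthOfPaths

variable {E : Type*} [NormedAddCommGroup E] [NormedSpace ℝ E] [FiniteDimensional ℝ E]
variable {M : Type*} [TopologicalSpace M] [ChartedSpace E M] [IsManifold 𝓘(ℝ, E) ∞ M]
variable {Ω : SymplecticForm E M} {H : ℝ → M → ℝ} {φ : ℝ → M → M}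

/-- `φ_t^*ω = φ_0^*ω` is nondegenerate because `dφ_0` is an isomorphism, so `dφ_t` has no kernel. -/
theorem Generates.injective_mfderiv (hφ : Generates Ω H φ)
    (h0 : ∀ x, Function.Injective (mfderiv 𝓘(ℝ, E) 𝓘(ℝ, E) (φ 0) x)) {t : ℝ}
    (ht : t ∈ Icc (0 : ℝ) 1) (x : M) :
    Function.Injective (mfderiv 𝓘(ℝ, E) 𝓘(ℝ, E) (φ t) x) := by
  have key : ∀ e₀ ∈ atlas E M, ∀ y ∈ e₀.target,
      Function.Injective (mfderiv 𝓘(ℝ, E) 𝓘(ℝ, E) (φ t) (e₀.symm y)) := by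
    intro e₀ he₀ y hy
    rw [injective_iff_map_eq_zero]
    intro v hv
    have hconst : ∀ a b : E, Ω.form (φ t (e₀.symm y))
        ![mfderiv 𝓘(ℝ, E) 𝓘(ℝ, E) (φ t) (e₀.symm y) (mfderiv 𝓘(ℝ, E) 𝓘(ℝ, E) e₀.symm y a),
          mfderiv 𝓘(ℝ, E) 𝓘(ℝ, E) (φ t) (e₀.symm y) (mfderiv 𝓘(ℝ, E) 𝓘(ℝ, E) e₀.symm y b)] =
        Ω.form (φ 0 (e₀.symm y))
        ![mfderiv 𝓘(ℝ, E) 𝓘(ℝ, E) (φ 0) (e₀.symm y) (mfderiv 𝓘(ℝ, E) 𝓘(ℝ, E) e₀.symm y a),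
          mfderiv 𝓘(ℝ, E) 𝓘(ℝ, E) (φ 0) (e₀.symm y) (mfderiv 𝓘(ℝ, E) 𝓘(ℝ, E) e₀.symm y b)] :=
      fun a b => constant_of_derivWithin_zero
        (fun τ hτ => (hφ.hasDerivWithinAt_form he₀ hy hτ a b).differentiableWithinAt)
        (fun τ hτ => (hφ.hasDerivWithinAt_form he₀ hy (Ico_subset_Icc_self hτ) a b).derivWithin
          (uniqueDiffOn_Icc one_pos τ (Ico_subset_Icc_self hτ))) t ht
    have hv0 : mfderiv 𝓘(ℝ, E) 𝓘(ℝ, E) (φ 0) (e₀.symm y) v = 0 := by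
      refine Ω.nondegenerate _ _ fun w => ?_
      have hsurj : Function.Surjective (mfderiv 𝓘(ℝ, E) 𝓘(ℝ, E) (φ 0) (e₀.symm y)) :=
        have hL : ∀ L : E →L[ℝ] E, Function.Injective L → Function.Surjective L :=
          fun L hL => LinearMap.injective_iff_surjective (f := (L : E →ₗ[ℝ] E)).1 hL
        hL _ (h0 _)
      obtain ⟨u, rfl⟩ := hsurj w
      have h1 := hconst (mfderiv 𝓘(ℝ, E) 𝓘(ℝ, E) e₀ (e₀.symm y) v)
        (mfderiv 𝓘(ℝ, E) 𝓘(ℝ, E) e₀ (e₀.symm y) u)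
      rw [mfderiv_atlas_symm_comp he₀ hy v, mfderiv_atlas_symm_comp he₀ hy u, hv] at h1
      rw [← h1]
      exact (Ω.form _).map_coord_zero 0 rfl
    exact (injective_iff_map_eq_zero _).1 (h0 _) _ hv0
  have h := key _ (chart_mem_atlas E x) _ (mem_chart_target E x)
  rwa [(chartAt E x).left_inv (mem_chart_source E x)] at h

/-- The maps of a path in the group of Hamiltonian symplectomorphisms are onto. -/
theorem Generates.surjective [T2Space M] [ConnectedSpace M] (hφ : Generates Ω H φ)
    (hφ₀ : φ 0 ∈ hamGroup Ω) {t : ℝ} (ht : t ∈ Icc (0 : ℝ) 1) : Function.Surjective (φ t) := by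
  obtain ⟨L, Φ, hΦ, hΦ0, hΦ1⟩ := hφ₀
  have h0I : (0 : ℝ) ∈ Icc (0 : ℝ) 1 := ⟨le_rfl, zero_le_one⟩
  have h1I : (1 : ℝ) ∈ Icc (0 : ℝ) 1 := ⟨zero_le_one, le_rfl⟩
  obtain ⟨K, hK, hK0⟩ := hφ.1.2
  obtain ⟨K', hK', hK0'⟩ := hΦ.1.2
  have hinj0 : ∀ x, Function.Injective (mfderiv 𝓘(ℝ, E) 𝓘(ℝ, E) (Φ 0) x) := by
    intro x
    rw [hΦ0, mfderiv_id]
    exact fun _ _ h => h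
  have hinj : ∀ x, Function.Injective (mfderiv 𝓘(ℝ, E) 𝓘(ℝ, E) (φ t) x) :=
    fun x => hφ.injective_mfderiv (fun x => hΦ1 ▸ hΦ.injective_mfderiv hinj0 h1I x) ht x
  refine surjective_of_isOpenMap_of_eq_self (hφ.contMDiff ht).continuous
    (isOpenMap_of_injective_mfderiv (hφ.contMDiff ht) hinj) (hK.union hK') fun x hx => ?_
  have hx1 : x ∉ K := fun h => hx (Or.inl h)
  have hx2 : x ∉ K' := fun h => hx (Or.inr h)
  have h1 : φ 0 x = x := by
    rw [← hΦ1, hΦ.eq_of_notMem hK'.isClosed hK0' (by rwa [hΦ0]) h1I, hΦ0]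
    rfl
  rw [hφ.eq_of_notMem hK.isClosed hK0 (by rwa [h1]) ht, h1]

theorem eq_add_const_of_hamVectorField_eq [PreconnectedSpace M] [Nonempty M] {F F' : M → ℝ}
    (hF : ContMDiff 𝓘(ℝ, E) 𝓘(ℝ, ℝ) ∞ F) (hF' : ContMDiff 𝓘(ℝ, E) 𝓘(ℝ, ℝ) ∞ F')
    (h : ∀ x, Ω.hamVectorField F x = Ω.hamVectorField F' x) : ∃ c, ∀ x, F x = F' x + c := by
  have hloc : IsLocallyConstant (fun x => F x - F' x) := by
    rw [IsLocallyConstant.iff_eventually_eq]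
    intro x
    have he := chart_mem_atlas E x
    have hx := mem_chart_source E x
    set e := chartAt E x
    have hs' : ContMDiffOn 𝓘(ℝ, E) 𝓘(ℝ, E) ∞ e.symm e.target :=
      contMDiffOn_symm_of_mem_maximalAtlas (IsManifold.subset_maximalAtlas he)
    have hd : ∀ f : M → ℝ, ContMDiff 𝓘(ℝ, E) 𝓘(ℝ, ℝ) ∞ f → DifferentiableOn ℝ (f ∘ e.symm) e.target :=
      fun f hf => (contMDiffOn_iff_contDiffOn.1 (hf.comp_contMDiffOn hs')).differentiableOn (by simp)
    obtain ⟨ρ, hρ, hball⟩ := Metric.isOpen_iff.1 e.open_target _ (e.map_source hx)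
    have hmem : e.source ∩ e ⁻¹' Metric.ball (e x) ρ ∈ 𝓝 x :=
      (e.continuousOn.isOpen_inter_preimage e.open_source Metric.isOpen_ball).mem_nhds
        ⟨hx, Metric.mem_ball_self hρ⟩
    filter_upwards [hmem] with y hy
    have hfd : EqOn (fderiv ℝ (F ∘ e.symm)) (fderiv ℝ (F' ∘ e.symm)) (Metric.ball (e x) ρ) := by
      intro z hz
      ext w
      rw [← chartForm_hamChart Ω he (hball hz) (hF.mdifferentiable (by simp) _),
        ← chartForm_hamChart Ω he (hball hz) (hF'.mdifferentiable (by simp) _)]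
      rw [hamChart, hamChart, h]
    have hc := (convex_ball (e x) ρ).is_const_of_fderivWithin_eq_zero (𝕜 := ℝ)
      (f := fun z => (F ∘ e.symm) z - (F' ∘ e.symm) z)
      (((hd F hF).mono hball).sub ((hd F' hF').mono hball)) (fun z hz => by
        have h1 := ((hd F hF).differentiableAt (e.open_target.mem_nhds (hball hz))).hasFDerivAt
        have h2 := ((hd F' hF').differentiableAt (e.open_target.mem_nhds (hball hz))).hasFDerivAt
        have h3 := (h1.sub h2).hasFDerivWithinAt (s := Metric.ball (e x) ρ)
        rw [hfd hz, sub_self] at h3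
        exact h3.fderivWithin (Metric.isOpen_ball.uniqueDiffWithinAt hz)) hy.2
      (Metric.mem_ball_self hρ)
    simpa [e.left_inv hy.1, e.left_inv hx] using hc
  obtain ⟨x₀⟩ := ‹Nonempty M›
  refine ⟨F x₀ - F' x₀, fun x => ?_⟩
  have := hloc.apply_eq_of_preconnectedSpace x x₀
  linarith

/-- The path determines `X_{H_t}` on the range of `φ t`, which is all of `M`; on a connected
manifold this fixes `H_t` up to a constant. -/
theorem Generates.totvar_eq [T2Space M] [ConnectedSpace M] {H' : ℝ → M → ℝ}
    (hφ : Generates Ω H φ) (hφ' : Generates Ω H' φ) {t : ℝ} (ht : t ∈ Icc (0 : ℝ) 1)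
    (hs : Function.Surjective (φ t)) : totvar (H t) = totvar (H' t) := by
  have hX : ∀ x, Ω.hamVectorField (H t) x = Ω.hamVectorField (H' t) x := by
    intro x
    obtain ⟨y, rfl⟩ := hs x
    have hu : UniqueMDiffWithinAt 𝓘(ℝ, ℝ) (Icc (0 : ℝ) 1) t :=
      uniqueMDiffWithinAt_iff_uniqueDiffWithinAt.2 (uniqueDiffOn_Icc one_pos t ht)
    have h1 := hu.eq (hφ.2.2 t ht y) (hφ'.2.2 t ht y)
    have h2 := congrArg (fun L : ℝ →L[ℝ] TangentSpace 𝓘(ℝ, E) (φ t y) => L 1) h1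
    exact (one_smul ℝ (Ω.hamVectorField (H t) (φ t y))).symm.trans
      (h2.trans (one_smul ℝ (Ω.hamVectorField (H' t) (φ t y))))
  obtain ⟨c, hc⟩ := eq_add_const_of_hamVectorField_eq (hφ.1.contMDiff ht) (hφ'.1.contMDiff ht) hX
  obtain ⟨C, hC⟩ := hφ'.1.exists_bound
  rw [show H t = fun x => H' t x + c from funext hc, totvar_add_const (hC t ht)]

theorem Generates.hoferLength_eq [T2Space M] [ConnectedSpace M] (hφ : Generates Ω H φ)
    (hs : ∀ t ∈ Icc (0 : ℝ) 1, Function.Surjective (φ t)) :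
    hoferLength Ω φ = ∫ t in (0 : ℝ)..1, totvar (H t) := by
  have hex : ∃ H, Generates Ω H φ := ⟨H, hφ⟩
  rw [hoferLength, dif_pos hex]
  refine intervalIntegral.integral_congr fun t ht => ?_
  rw [uIcc_of_le zero_le_one] at ht
  exact hex.choose_spec.totvar_eq hφ ht (hs t ht)

section Variation

variable {G : ℝ → M → ℝ} [T2Space M]

/-- A generating Hamiltonian of a variation of a path. -/
theorem Generates.variation (hφ : Generates Ω H φ) (hG : IsCompactlySupportedFamily E G) {s : ℝ}
    (hs : ∀ t ∈ Icc (0 : ℝ) 1, ∀ x, FlowRegularAt Ω G s t x)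
    (hs' : ∀ t ∈ Icc (0 : ℝ) 1, ∀ x, FlowRegularAt Ω G (-s) t x) :
    Generates Ω (fun t x => H t (hamFlow Ω G (-s) t x) + hamDrift Ω G s t (hamFlow Ω G (-s) t x))
      (variation Ω G φ s) := by
  have hfam : IsCompactlySupportedFamily E (fun t x => H t (hamFlow Ω G (-s) t x) +
      hamDrift Ω G s t (hamFlow Ω G (-s) t x)) := by
    constructor
    · have h1 : ContMDiffOn (𝓘(ℝ, ℝ).prod 𝓘(ℝ, E)) (𝓘(ℝ, ℝ).prod 𝓘(ℝ, E)) ∞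
          (fun p : ℝ × M => (p.1, hamFlow Ω G (-s) p.1 p.2)) (Icc 0 1 ×ˢ univ) :=
        contMDiffOn_fst.prodMk fun p hp => (hs' p.1 hp.1 p.2).flow
      have h2 : ContMDiffOn (𝓘(ℝ, ℝ).prod 𝓘(ℝ, E)) 𝓘(ℝ, ℝ) ∞
          (fun p : ℝ × M => hamDrift Ω G s p.1 p.2) (Icc 0 1 ×ˢ univ) :=
        fun p hp => (hs p.1 hp.1 p.2).drift
      exact (hφ.1.1.comp h1 fun p hp => ⟨hp.1, mem_univ _⟩).add
        (h2.comp h1 fun p hp => ⟨hp.1, mem_univ _⟩)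
    · obtain ⟨K, hK, hK0⟩ := hφ.1.2
      obtain ⟨K', hK', hK0'⟩ := hG.2
      refine ⟨K ∪ K', hK.union hK', fun t ht x hx => ?_⟩
      have hx1 : x ∉ K := fun h => hx (Or.inl h)
      have hx2 : x ∉ K' := fun h => hx (Or.inr h)
      simp only [hamFlow_eq_self Ω hG hK'.isClosed hK0' ht _ hx2, hK0 t ht x hx1,
        hamDrift_eq_zero Ω hG hK'.isClosed hK0' ht _ hx2, add_zero]
  refine ⟨hfam, ?_, fun t ht x => ?_⟩
  · have h1 : ContMDiffOn (𝓘(ℝ, ℝ).prod 𝓘(ℝ, E)) (𝓘(ℝ, ℝ).prod 𝓘(ℝ, E)) ∞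
        (fun p : ℝ × M => (p.1, φ p.1 p.2)) (Icc 0 1 ×ˢ univ) :=
      contMDiffOn_fst.prodMk hφ.2.1
    have h2 : ContMDiffOn (𝓘(ℝ, ℝ).prod 𝓘(ℝ, E)) 𝓘(ℝ, E) ∞
        (fun p : ℝ × M => hamFlow Ω G s p.1 p.2) (Icc 0 1 ×ˢ univ) :=
      fun p hp => (hs p.1 hp.1 p.2).flow
    exact h2.comp h1 fun p hp => ⟨hp.1, mem_univ _⟩
  -- The relation required by `velocity`, that the new Hamiltonian composed with the flow is `H_t`
  -- plus the drift, holds because the flows at `s` and `-s` are inverse.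
  · exact (hs t ht (φ t x)).velocity (H t) _ (hφ.1.contMDiff ht) (hfam.contMDiff ht)
      (fun y => by simp only [hamFlow_neg_hamFlow Ω hG ht s y]) (fun τ => φ τ x) rfl (hφ.2.2 t ht x)

/-- The length of a variation of a path. -/
theorem Generates.hoferLength_variation [ConnectedSpace M] (hφ : Generates Ω H φ)
    (hG : IsCompactlySupportedFamily E G)
    (hsurj : ∀ t ∈ Icc (0 : ℝ) 1, Function.Surjective (φ t)) {s : ℝ}
    (hs : ∀ t ∈ Icc (0 : ℝ) 1, ∀ x, FlowRegularAt Ω G s t x)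
    (hs' : ∀ t ∈ Icc (0 : ℝ) 1, ∀ x, FlowRegularAt Ω G (-s) t x) :
    ContinuousOn (fun t => totvar (fun x => H t x + hamDrift Ω G s t x)) (Icc 0 1) ∧
    hoferLength Ω (_root_.variation Ω G φ s) =
      ∫ t in (0 : ℝ)..1, totvar (fun x => H t x + hamDrift Ω G s t x) := by
  have hgen := hφ.variation hG hs hs'
  -- Composition with the surjective flow at `-s` leaves the total variation unchanged.
  have htv : ∀ t ∈ Icc (0 : ℝ) 1, totvar (fun x => H t (hamFlow Ω G (-s) t x) +
      hamDrift Ω G s t (hamFlow Ω G (-s) t x)) = totvar (fun x => H t x + hamDrift Ω G s t x) :=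
    fun t ht => totvar_comp_surjective (f := fun x => H t x + hamDrift Ω G s t x)
      (φ := hamFlow Ω G (-s) t) fun x => ⟨_, hamFlow_neg_hamFlow Ω hG ht s x⟩
  refine ⟨hgen.1.continuousOn_totvar.congr fun t ht => (htv t ht).symm, ?_⟩
  have hsurj' : ∀ t ∈ Icc (0 : ℝ) 1, Function.Surjective (_root_.variation Ω G φ s t) :=
    fun t ht => Function.Surjective.comp (g := hamFlow Ω G s t)
      (fun x => ⟨_, hamFlow_hamFlow_neg Ω hG ht s x⟩) (hsurj t ht)
  rw [hgen.hoferLength_eq hsurj']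
  refine intervalIntegral.integral_congr fun t ht => ?_
  rw [uIcc_of_le zero_le_one] at ht
  exact htv t ht

end Variation

end LengthOfPaths

/-! ### From the length estimate to criticality. -/

noncomputable section Criticality

variable {E : Type*} [NormedAddCommGroup E] [NormedSpace ℝ E] [FiniteDimensional ℝ E]
variable {M : Type*} [TopologicalSpace M] [ChartedSpace E M] [IsManifold 𝓘(ℝ, E) ∞ M]
variable {Ω : SymplecticForm E M} {F G H : ℝ → M → ℝ} {φ : ℝ → M → M}

theorem IsCompactlySupportedFamily.add (hF : IsCompactlySupportedFamily E F)
    (hG : IsCompactlySupportedFamily E G) :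
    IsCompactlySupportedFamily E (fun t x => F t x + G t x) := by
  obtain ⟨K, hK, hK0⟩ := hF.2
  obtain ⟨K', hK', hK0'⟩ := hG.2
  refine ⟨hF.1.add hG.1, K ∪ K', hK.union hK', fun t ht x hx => ?_⟩
  simp only [hK0 t ht x fun h => hx (Or.inl h), hK0' t ht x fun h => hx (Or.inr h), add_zero]

theorem IsCompactlySupportedFamily.const_mul (hF : IsCompactlySupportedFamily E F) (c : ℝ) :
    IsCompactlySupportedFamily E (fun t x => c * F t x) := by
  obtain ⟨K, hK, hK0⟩ := hF.2
  refine ⟨contMDiffOn_const.mul hF.1, K, hK, fun t ht x hx => ?_⟩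
  simp only [hK0 t ht x hx, mul_zero]

theorem IsCompactlySupportedFamily.continuousOn_apply (hF : IsCompactlySupportedFamily E F)
    (x : M) : ContinuousOn (fun t => F t x) (Icc 0 1) :=
  fun _ ht => (hF.hasDerivWithinAt ht x).continuousWithinAt

theorem intervalIntegrable_zero_one {f : ℝ → ℝ} (hf : ContinuousOn f (Icc 0 1)) :
    IntervalIntegrable f volume 0 1 :=
  ContinuousOn.intervalIntegrable (by rwa [uIcc_of_le zero_le_one])

variable [T2Space M] [ConnectedSpace M]

/-- The length of a variation, up to terms of second order. -/
theorem Generates.exists_length_estimate (hφ : Generates Ω H φ) (hφ₀ : φ 0 ∈ hamGroup Ω)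
    (hG : IsCompactlySupportedFamily E G) :
    ∃ δ > 0, ∃ C, ∀ ε ∈ Ioo (-δ) δ, |hoferLength Ω (_root_.variation Ω G φ ε) -
      ∫ t in (0 : ℝ)..1, totvar (fun x => H t x + ε * timeDeriv G t x)| ≤ C * ε ^ 2 := by
  have hsurj : ∀ t ∈ Icc (0 : ℝ) 1, Function.Surjective (φ t) := fun t ht => hφ.surjective hφ₀ ht
  obtain ⟨δ, hδ, hreg⟩ := Metric.eventually_nhds_iff.1 (eventually_forall_flowRegularAt Ω hG)
  obtain ⟨C, hC0, hC⟩ := exists_hamDrift_estimate Ω hG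
  refine ⟨δ, hδ, 2 * C, fun ε hε => ?_⟩
  have hε' : |ε| < δ := abs_lt.2 hε
  have h1 := hreg (y := ε) (by simpa [Real.dist_eq] using hε')
  have h2 := hreg (y := -ε) (by simpa [Real.dist_eq] using hε')
  obtain ⟨hc, hL⟩ := hφ.hoferLength_variation hG hsurj h1 h2
  have hfam : IsCompactlySupportedFamily E (fun t x => H t x + ε * timeDeriv G t x) :=
    hφ.1.add (hG.timeDeriv.const_mul ε)
  obtain ⟨B, hB⟩ := hfam.exists_bound
  have hclose : ∀ t ∈ Icc (0 : ℝ) 1, ∀ x, |(H t x + hamDrift Ω G ε t x) -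
      (H t x + ε * timeDeriv G t x)| ≤ C * ε ^ 2 := fun t ht x => by
    rw [add_sub_add_left_eq_sub]; exact hC t ht ε x
  have hbd : ∀ t ∈ Icc (0 : ℝ) 1, ∀ x, |H t x + hamDrift Ω G ε t x| ≤ B + C * ε ^ 2 := by
    intro t ht x
    have h3 := abs_le.1 (hclose t ht x)
    have h4 := abs_le.1 (hB t ht x)
    rw [abs_le]
    constructor <;> linarith [h3.1, h3.2, h4.1, h4.2]
  rw [hL, ← intervalIntegral.integral_sub (intervalIntegrable_zero_one hc)
    (intervalIntegrable_zero_one hfam.continuousOn_totvar)]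
  have h3 := intervalIntegral.norm_integral_le_of_norm_le_const (a := 0) (b := 1)
    (C := 2 * (C * ε ^ 2)) (f := fun t => totvar (fun x => H t x + hamDrift Ω G ε t x) -
      totvar (fun x => H t x + ε * timeDeriv G t x)) (fun t ht => by
      rw [uIoc_of_le zero_le_one] at ht
      have htI : t ∈ Icc (0 : ℝ) 1 := ⟨ht.1.le, ht.2⟩
      exact abs_totvar_sub_totvar_le (hbd t htI) (hB t htI) (hclose t htI))
  rw [sub_zero, abs_one, mul_one, ← mul_assoc] at h3
  exact h3

theorem IsTangentField.integral_timeDeriv (hG : IsTangentField E G) (x : M) :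
    ∫ t in (0 : ℝ)..1, timeDeriv G t x = 0 := by
  have h := intervalIntegral.integral_eq_sub_of_hasDeriv_right_of_le zero_le_one
    (f := fun t => G t x) (f' := fun t => timeDeriv G t x)
    (fun t ht => (hG.1.hasDerivWithinAt ht x).continuousWithinAt)
    (fun t ht => ((hG.1.hasDerivWithinAt (Ioo_subset_Icc_self ht) x).hasDerivAt
      (Icc_mem_nhds ht.1 ht.2)).hasDerivWithinAt)
    (intervalIntegrable_zero_one (hG.1.timeDeriv.continuousOn_apply x))
  rw [h, hG.2.1, hG.2.2]
  simp

/-- A path with a fixed minimum and a fixed maximum is critical. -/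
theorem Generates.isLCritical_of_fixed (hφ : Generates Ω H φ) (hφ₀ : φ 0 ∈ hamGroup Ω) {p P : M}
    (hp : ∀ t ∈ Icc (0 : ℝ) 1, p ∈ minset (H t)) (hP : ∀ t ∈ Icc (0 : ℝ) 1, P ∈ maxset (H t)) :
    IsLCritical Ω φ := by
  intro G hG
  have hsurj : ∀ t ∈ Icc (0 : ℝ) 1, Function.Surjective (φ t) := fun t ht => hφ.surjective hφ₀ ht
  obtain ⟨δ, hδ, C, hC⟩ := hφ.exists_length_estimate hφ₀ hG.1
  refine ⟨δ, hδ, fun ε => hoferLength Ω φ - C * ε ^ 2, ?_, by simp, ?_, fun ε hε => ?_⟩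
  · exact (contDiff_const.sub (contDiff_const.mul (contDiff_id.pow 2))).contDiffOn
  · have h := ((hasDerivAt_pow 2 (0 : ℝ)).const_mul C).const_sub (hoferLength Ω φ)
    rw [h.deriv]
    simp
  · have h1 := (abs_le.1 (hC ε hε)).1
    have hfam : IsCompactlySupportedFamily E (fun t x => H t x + ε * timeDeriv G t x) :=
      hφ.1.add (hG.1.timeDeriv.const_mul ε)
    obtain ⟨B, hB⟩ := hfam.exists_bound
    have hcP := hG.1.timeDeriv.continuousOn_apply P
    have hcp := hG.1.timeDeriv.continuousOn_apply p
    have hcd : ContinuousOn (fun t => ε * (timeDeriv G t P - timeDeriv G t p)) (Icc 0 1) :=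
      continuousOn_const.mul (hcP.sub hcp)
    -- Evaluating at `P` and `p` only bounds the total variation from below; the term in `ε` is a
    -- time derivative of `G` and integrates to zero.
    have hlow : ∫ t in (0 : ℝ)..1, (totvar (H t) + ε * (timeDeriv G t P - timeDeriv G t p)) ≤
        ∫ t in (0 : ℝ)..1, totvar (fun x => H t x + ε * timeDeriv G t x) := by
      refine intervalIntegral.integral_mono_on zero_le_one (intervalIntegrable_zero_one
        (hφ.1.continuousOn_totvar.add hcd))
        (intervalIntegrable_zero_one hfam.continuousOn_totvar) fun t ht => ?_
      have h2 := sub_le_totvar (hB t ht) P p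
      have h3 : totvar (H t) ≤ H t P - H t p :=
        sub_le_sub (ciSup_le (hP t ht)) (le_ciInf (hp t ht))
      linarith
    rw [intervalIntegral.integral_add (intervalIntegrable_zero_one hφ.1.continuousOn_totvar)
      (intervalIntegrable_zero_one hcd),
      intervalIntegral.integral_const_mul, intervalIntegral.integral_sub
      (intervalIntegrable_zero_one hcP) (intervalIntegrable_zero_one hcp),
      hG.integral_timeDeriv, hG.integral_timeDeriv, sub_zero, mul_zero, add_zero,
      ← hφ.hoferLength_eq hsurj] at hlow
    linarith

/-- A path which can be shortened to first order is not critical. -/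
theorem Generates.not_isLCritical_of_decreasing (hφ : Generates Ω H φ) (hφ₀ : φ 0 ∈ hamGroup Ω)
    (hG : IsTangentField E G) {c ε₀ : ℝ} (hc : 0 < c) (hε₀ : 0 < ε₀)
    (h : ∀ ε ∈ Ioo 0 ε₀, ∫ t in (0 : ℝ)..1, totvar (fun x => H t x + ε * timeDeriv G t x) ≤
      (∫ t in (0 : ℝ)..1, totvar (H t)) - c * ε) : ¬ IsLCritical Ω φ := by
  intro hcrit
  obtain ⟨δ, hδ, f, hf, hf0, hfd, hfle⟩ := hcrit G hG
  obtain ⟨δ', hδ', C, hC⟩ := hφ.exists_length_estimate hφ₀ hG.1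
  rw [hφ.hoferLength_eq fun t ht => hφ.surjective hφ₀ ht] at hf0
  have hder : HasDerivAt f 0 0 := by
    have h1 : DifferentiableAt ℝ f 0 := (hf.contDiffAt (Ioo_mem_nhds (by linarith) hδ)).differentiableAt
      (by simp)
    have h2 := h1.hasDerivAt
    rwa [hfd] at h2
  have hslope : Tendsto (fun ε => ε⁻¹ * (f ε - f 0)) (𝓝[>] 0) (𝓝 0) := by
    have h1 := (hasDerivWithinAt_iff_tendsto_slope' (by simp)).1 (hder.hasDerivWithinAt (s := Ioi 0))
    refine h1.congr fun ε => ?_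
    rw [slope, sub_zero]
    rfl
  have hlim : Tendsto (fun ε : ℝ => -c + C * ε) (𝓝[>] 0) (𝓝 (-c)) := by
    have h1 : Tendsto (fun ε : ℝ => -c + C * ε) (𝓝 0) (𝓝 (-c + C * 0)) :=
      (continuous_const.add (continuous_const.mul continuous_id)).tendsto 0
    rw [mul_zero, add_zero] at h1
    exact h1.mono_left nhdsWithin_le_nhds
  -- For small `ε > 0`, `f(ε) ≤ L(γ_ε) ≤ f(0) - c ε + C ε²`; dividing by `ε` bounds the limit of the
  -- slopes, which is zero, by `-c`.
  have hle : (0 : ℝ) ≤ -c := by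
    refine le_of_tendsto_of_tendsto hslope hlim ?_
    have hm : Ioo (0 : ℝ) (min δ (min δ' ε₀)) ∈ 𝓝[>] (0 : ℝ) :=
      Ioo_mem_nhdsGT (lt_min hδ (lt_min hδ' hε₀))
    filter_upwards [hm] with ε hε
    obtain ⟨h0, h1⟩ := hε
    rw [lt_min_iff, lt_min_iff] at h1
    have h2 := hfle ε ⟨by linarith, h1.1⟩
    have h3 := (abs_le.1 (hC ε ⟨by linarith, h1.2.1⟩)).2
    have h4 := h ε ⟨h0, h1.2.2⟩
    rw [hf0, inv_mul_le_iff₀ h0]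
    nlinarith
  linarith

end Criticality

/-! ### Steps in time, and gaps below the maximum or above the minimum. -/

noncomputable section ShorteningFields

theorem exists_smooth_step {s w : ℝ} (hs : 0 < s) (hw : 0 < w) (hsw : s + w < 1) :
    ∃ θ ρ : ℝ → ℝ, ContDiff ℝ ∞ θ ∧ Continuous ρ ∧ (∀ t, HasDerivAt θ (ρ t) t) ∧ (∀ t, 0 ≤ ρ t) ∧
      (∀ t, ρ t ≠ 0 → |t - s| ≤ w) ∧ θ 0 = 0 ∧ θ 1 = 1 := by
  set θ : ℝ → ℝ := fun t => Real.smoothTransition ((t - s) / w) with hθ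
  have hc : ContDiff ℝ ∞ θ :=
    Real.smoothTransition.contDiff.comp ((contDiff_id.sub contDiff_const).div_const w)
  have hmono : Monotone θ := fun a b hab =>
    Real.smoothTransition.monotone (by gcongr)
  refine ⟨θ, deriv θ, hc, hc.continuous_deriv (by simp), fun t =>
    (hc.differentiable (by simp) t).hasDerivAt, fun t => hmono.deriv_nonneg, fun t ht => ?_, ?_, ?_⟩
  · by_contra hts
    rw [abs_le, not_and_or, not_le, not_le] at hts
    refine ht ?_
    rcases hts with h | h
    · have h1 : θ =ᶠ[𝓝 t] fun _ => (0 : ℝ) := by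
        filter_upwards [Iio_mem_nhds (show t < s by linarith)] with τ hτ
        exact Real.smoothTransition.zero_of_nonpos
          (div_nonpos_of_nonpos_of_nonneg (by linarith [mem_Iio.1 hτ]) hw.le)
      rw [h1.deriv_eq, deriv_const]
    · have h1 : θ =ᶠ[𝓝 t] fun _ => (1 : ℝ) := by
        filter_upwards [Ioi_mem_nhds (show s + w < t by linarith)] with τ hτ
        refine Real.smoothTransition.one_of_one_le ?_
        rw [one_le_div hw]
        linarith [mem_Ioi.1 hτ]
      rw [h1.deriv_eq, deriv_const]
  · exact Real.smoothTransition.zero_of_nonpos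
      (div_nonpos_of_nonpos_of_nonneg (by linarith) hw.le)
  · refine Real.smoothTransition.one_of_one_le ?_
    rw [one_le_div hw]
    linarith

variable {E : Type*} [NormedAddCommGroup E] [NormedSpace ℝ E] [FiniteDimensional ℝ E]
variable {M : Type*} [TopologicalSpace M] [ChartedSpace E M] [IsManifold 𝓘(ℝ, E) ∞ M]
variable {H : ℝ → M → ℝ}

theorem isClosed_maxset {f : M → ℝ} (hf : Continuous f) : IsClosed (maxset f) := by
  rw [maxset, ofPred_forall]
  exact isClosed_iInter fun y => isClosed_le continuous_const hf

theorem isClosed_minset {f : M → ℝ} (hf : Continuous f) : IsClosed (minset f) := by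
  rw [minset, ofPred_forall]
  exact isClosed_iInter fun y => isClosed_le hf continuous_const

theorem exists_gap_of_isCompact {f : M → ℝ} (hf : Continuous f) (hb : BddAbove (range f))
    {Z : Set M} (hZ : IsCompact Z) (h : ∀ x ∈ Z, x ∉ maxset f) :
    ∃ η > 0, ∀ x ∈ Z, f x ≤ (⨆ y, f y) - η := by
  rcases Z.eq_empty_or_nonempty with rfl | hne
  · exact ⟨1, one_pos, by simp⟩
  · obtain ⟨z, hz, hmax⟩ := hZ.exists_isMaxOn hne hf.continuousOn
    have h1 := h z hz
    simp only [maxset, mem_ofPred_eq, not_forall, not_le] at h1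
    obtain ⟨y, hy⟩ := h1
    refine ⟨(⨆ y, f y) - f z, sub_pos.2 (hy.trans_le (le_ciSup hb y)), fun x hx => ?_⟩
    rw [sub_sub_cancel]
    exact hmax hx

theorem exists_gap_of_isCompact' {f : M → ℝ} (hf : Continuous f) (hb : BddBelow (range f))
    {Z : Set M} (hZ : IsCompact Z) (h : ∀ x ∈ Z, x ∉ minset f) :
    ∃ η > 0, ∀ x ∈ Z, (⨅ y, f y) + η ≤ f x := by
  rcases Z.eq_empty_or_nonempty with rfl | hne
  · exact ⟨1, one_pos, by simp⟩
  · obtain ⟨z, hz, hmin⟩ := hZ.exists_isMinOn hne hf.continuousOn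
    have h1 := h z hz
    simp only [minset, mem_ofPred_eq, not_forall, not_le] at h1
    obtain ⟨y, hy⟩ := h1
    refine ⟨f z - ⨅ y, f y, sub_pos.2 ((ciInf_le hb y).trans_lt hy), fun x hx => ?_⟩
    rw [add_sub_cancel]
    exact hmin hx

variable [Nonempty M]

/-- A gap `η` at `t₀` shrinks by at most `η/3` from the change of the supremum and `η/3` from that
of the value. One `r` serves as time window and as gap, so that later all smallness conditions can
be met together. -/
theorem IsCompactlySupportedFamily.eventually_gap (hH : IsCompactlySupportedFamily E H) {t₀ : ℝ}
    (ht₀ : t₀ ∈ Icc (0 : ℝ) 1) {Z : Set M}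
    (h : ∃ η > 0, ∀ x ∈ Z, H t₀ x ≤ (⨆ y, H t₀ y) - η) :
    ∀ᶠ r in 𝓝[>] (0 : ℝ), ∀ t ∈ Icc (0 : ℝ) 1, |t - t₀| ≤ r → ∀ x ∈ Z,
      H t x ≤ (⨆ y, H t y) - r := by
  obtain ⟨η, hη, hZ⟩ := h
  obtain ⟨C, hC⟩ := hH.exists_bound
  obtain ⟨w, hw, hw'⟩ := Metric.eventually_nhds_iff.1
    (hH.eventually_close ht₀ (η := η / 3) (by positivity))
  filter_upwards [Ioo_mem_nhdsGT (lt_min hw (by positivity : 0 < η / 3))] with r hr t ht htr x hx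
  obtain ⟨hr0, hr1⟩ := hr
  rw [lt_min_iff] at hr1
  have h1 := hw' (y := t) (by rw [Real.dist_eq]; linarith) ht
  have h2 := abs_le.1 (iSup_sub_iSup_le (bddAbove_range_of_abs_le (hC t ht))
    (bddAbove_range_of_abs_le (hC t₀ ht₀)) h1)
  have h3 := abs_le.1 (h1 x)
  have h4 := hZ x hx
  linarith [h2.1, h3.2]

theorem IsCompactlySupportedFamily.eventually_gap' (hH : IsCompactlySupportedFamily E H) {t₀ : ℝ}
    (ht₀ : t₀ ∈ Icc (0 : ℝ) 1) {Z : Set M}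
    (h : ∃ η > 0, ∀ x ∈ Z, (⨅ y, H t₀ y) + η ≤ H t₀ x) :
    ∀ᶠ r in 𝓝[>] (0 : ℝ), ∀ t ∈ Icc (0 : ℝ) 1, |t - t₀| ≤ r → ∀ x ∈ Z,
      (⨅ y, H t y) + r ≤ H t x := by
  obtain ⟨η, hη, hZ⟩ := h
  obtain ⟨C, hC⟩ := hH.exists_bound
  obtain ⟨w, hw, hw'⟩ := Metric.eventually_nhds_iff.1
    (hH.eventually_close ht₀ (η := η / 3) (by positivity))
  filter_upwards [Ioo_mem_nhdsGT (lt_min hw (by positivity : 0 < η / 3))] with r hr t ht htr x hx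
  obtain ⟨hr0, hr1⟩ := hr
  rw [lt_min_iff] at hr1
  have h1 := hw' (y := t) (by rw [Real.dist_eq]; linarith) ht
  have h2 := abs_le.1 (iInf_sub_iInf_le (bddBelow_range_of_abs_le (hC t ht))
    (bddBelow_range_of_abs_le (hC t₀ ht₀)) h1)
  have h3 := abs_le.1 (h1 x)
  have h4 := hZ x hx
  linarith [h2.2, h3.1]

/-- Being a maximum is a closed condition in time, so a failure in `[0,1]` entails one in the open
interval, where a step function has room. -/
theorem exists_notMem_maxset_of_no_fixed (hH : IsCompactlySupportedFamily E H)
    (hno : ¬ (⋂ t ∈ Icc (0 : ℝ) 1, maxset (H t)).Nonempty) (x : M) :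
    ∃ s ∈ Ioo (0 : ℝ) 1, x ∉ maxset (H s) := by
  by_contra hcon
  push Not at hcon
  refine hno ⟨x, mem_iInter₂.2 fun t ht y => ?_⟩
  have hcl : t ∈ closure (Ioo (0 : ℝ) 1) := by rwa [closure_Ioo zero_ne_one]
  have := mem_closure_iff_nhdsWithin_neBot.1 hcl
  have hle : 𝓝[Ioo (0 : ℝ) 1] t ≤ 𝓝[Icc 0 1] t := nhdsWithin_mono _ Ioo_subset_Icc_self
  refine le_of_tendsto_of_tendsto (b := 𝓝[Ioo (0 : ℝ) 1] t) (f := fun t => H t y)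
    (g := fun t => H t x) ?_ ?_ ?_
  · exact (hH.hasDerivWithinAt ht y).continuousWithinAt.mono_left hle
  · exact (hH.hasDerivWithinAt ht x).continuousWithinAt.mono_left hle
  · filter_upwards [self_mem_nhdsWithin] with τ hτ using hcon τ hτ y

variable [T2Space M]

/-- A time at which the set of maximum points is compact and the Hamiltonian is not constant. -/
theorem exists_time_of_no_fixed (hH : IsCompactlySupportedFamily E H)
    (hno : ¬ (⋂ t ∈ Icc (0 : ℝ) 1, maxset (H t)).Nonempty) :
    ∃ t₁ ∈ Ioo (0 : ℝ) 1, IsCompact (maxset (H t₁)) ∧ (maxset (H t₁))ᶜ.Nonempty ∧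
      ∀ Z : Set M, IsClosed Z → (∀ x ∈ Z, x ∉ maxset (H t₁)) →
        ∃ η > 0, ∀ x ∈ Z, H t₁ x ≤ (⨆ y, H t₁ y) - η := by
  obtain ⟨K, hK, hK0⟩ := hH.2
  obtain ⟨C, hC⟩ := hH.exists_bound
  obtain ⟨t₁, ht₁, x₀, hx₀, η₀, hη₀, hout⟩ : ∃ t₁ ∈ Ioo (0 : ℝ) 1, ∃ x₀, x₀ ∉ maxset (H t₁) ∧
      ∃ η > 0, ∀ x ∉ K, H t₁ x ≤ (⨆ y, H t₁ y) - η := by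
    -- A point outside `K` has value `0` at all times. Once it fails to be a maximum the supremum is
    -- positive, so the maximum set lies in `K` and the supremum itself is the gap off `K`.
    -- Otherwise `M = K` is compact.
    by_cases hKu : ∃ x₀, x₀ ∉ K
    · obtain ⟨x₀, hx₀⟩ := hKu
      obtain ⟨t₁, ht₁, hx₁⟩ := exists_notMem_maxset_of_no_fixed hH hno x₀
      have ht₁' := Ioo_subset_Icc_self ht₁
      refine ⟨t₁, ht₁, x₀, hx₁, ⨆ y, H t₁ y, ?_, fun x hx => ?_⟩
      · have h1 := hx₁
        simp only [maxset, mem_ofPred_eq, not_forall, not_le, hK0 t₁ ht₁' x₀ hx₀] at h1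
        obtain ⟨y, hy⟩ := h1
        exact hy.trans_le (le_ciSup (bddAbove_range_of_abs_le (hC t₁ ht₁')) y)
      · rw [sub_self, hK0 t₁ ht₁' x hx]
    · push Not at hKu
      obtain ⟨x₀⟩ := ‹Nonempty M›
      obtain ⟨t₁, ht₁, hx₁⟩ := exists_notMem_maxset_of_no_fixed hH hno x₀
      exact ⟨t₁, ht₁, x₀, hx₁, 1, one_pos, fun x hx => absurd (hKu x) hx⟩
  have ht₁' := Ioo_subset_Icc_self ht₁
  have hc : Continuous (H t₁) := (hH.contMDiff ht₁').continuous
  have hb := bddAbove_range_of_abs_le (hC t₁ ht₁')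
  refine ⟨t₁, ht₁, ?_, ⟨x₀, hx₀⟩, fun Z hZ hZB => ?_⟩
  · refine hK.of_isClosed_subset (isClosed_maxset hc) fun x hx => ?_
    by_contra hxK
    have h1 := hout x hxK
    have h2 : (⨆ y, H t₁ y) ≤ H t₁ x := ciSup_le hx
    linarith
  · obtain ⟨η, hη, h⟩ := exists_gap_of_isCompact hc hb (hK.inter_right hZ)
      fun x hx => hZB x hx.2
    refine ⟨min η η₀, lt_min hη hη₀, fun x hx => ?_⟩
    by_cases hxK : x ∈ K
    · linarith [h x ⟨hxK, hx⟩, min_le_left η η₀]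
    · linarith [hout x hxK, min_le_right η η₀]

end ShorteningFields

/-! ### Construction of the tangent field that shortens the path. -/

noncomputable section ShorteningFieldConstruction

variable {E : Type*} [NormedAddCommGroup E] [NormedSpace ℝ E] [FiniteDimensional ℝ E]
variable {M : Type*} [TopologicalSpace M] [ChartedSpace E M] [IsManifold 𝓘(ℝ, E) ∞ M]
variable {H : ℝ → M → ℝ} [Nonempty M] [T2Space M]

/-- A finite family of bump functions which covers the maximum set at a time `t₁`, each of which is
supported away from the maximum set at some other time. -/
theorem exists_bump_family (hH : IsCompactlySupportedFamily E H)
    (hno : ¬ (⋂ t ∈ Icc (0 : ℝ) 1, maxset (H t)).Nonempty) :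
    ∃ t₁ ∈ Ioo (0 : ℝ) 1, ∃ (T : Finset M) (σ : M → ℝ) (h : M → M → ℝ),
      (∀ x ∈ T, σ x ∈ Ioo (0 : ℝ) 1 ∧ σ x ≠ t₁ ∧ ContMDiff 𝓘(ℝ, E) 𝓘(ℝ, ℝ) ∞ (h x) ∧
        (∀ y, 0 ≤ h x y) ∧ (∀ y, h x y ≤ 1)) ∧
      ∃ r > 0, t₁ + r < 1 ∧ ∃ K, IsCompact K ∧
        (∀ x ∈ T, σ x + r < 1 ∧ 2 * r < |σ x - t₁| ∧ (∀ y ∉ K, h x y = 0) ∧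
          ∀ t ∈ Icc (0 : ℝ) 1, |t - σ x| ≤ r → ∀ y, h x y ≠ 0 → H t y ≤ (⨆ y, H t y) - r) ∧
        ∀ t ∈ Icc (0 : ℝ) 1, |t - t₁| ≤ r →
          (∀ y ∈ K, (⨅ y, H t y) + r ≤ H t y) ∧
          ∀ y, ∑ x ∈ T, h x y ≤ 1 / 2 → H t y ≤ (⨆ y, H t y) - r := by
  obtain ⟨C, hC⟩ := hH.exists_bound
  obtain ⟨t₁, ht₁, hB, ⟨x₀, hx₀⟩, hgap⟩ := exists_time_of_no_fixed hH hno
  have ht₁' := Ioo_subset_Icc_self ht₁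
  -- A point that is both maximum and minimum would make `H t₁` constant, against the existence of
  -- `x₀`.
  have hdisj : ∀ x ∈ maxset (H t₁), x ∉ minset (H t₁) := fun x hx hx' =>
    hx₀ fun y => (hx y).trans (hx' x₀)
  have hex : ∀ x, ∃ (s : ℝ) (h : M → ℝ), x ∈ maxset (H t₁) → s ∈ Ioo (0 : ℝ) 1 ∧
      x ∉ maxset (H s) ∧ ContMDiff 𝓘(ℝ, E) 𝓘(ℝ, ℝ) ∞ h ∧ HasCompactSupport h ∧ (∀ y, 0 ≤ h y) ∧
      (∀ y, h y ≤ 1) ∧ h x = 1 ∧ ∀ y ∈ tsupport h, y ∉ maxset (H s) ∧ y ∉ minset (H t₁) := by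
    intro x
    by_cases hx : x ∈ maxset (H t₁)
    · obtain ⟨s, hs, hxs⟩ := exists_notMem_maxset_of_no_fixed hH hno x
      have hs' := Ioo_subset_Icc_self hs
      have hU : (maxset (H s))ᶜ ∩ (minset (H t₁))ᶜ ∈ 𝓝 x :=
        inter_mem ((isClosed_maxset (hH.contMDiff hs').continuous).isOpen_compl.mem_nhds hxs)
          ((isClosed_minset (hH.contMDiff ht₁').continuous).isOpen_compl.mem_nhds (hdisj x hx))
      obtain ⟨f, -, hf⟩ :=
        (SmoothBumpFunction.nhds_basis_tsupport (I := 𝓘(ℝ, E)) x).mem_iff.1 hU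
      exact ⟨s, f, fun _ => ⟨hs, hxs, f.contMDiff, f.hasCompactSupport, fun y => f.nonneg,
        fun y => f.le_one, f.eq_one, fun y hy => hf hy⟩⟩
    · exact ⟨0, 0, fun h => absurd h hx⟩
  choose σ h hσh using hex
  obtain ⟨T, hTB, hT⟩ := hB.elim_nhds_subcover (fun x => {y | 1 / 2 < h x y}) fun x hx => by
    have h1 := hσh x hx
    exact h1.2.2.1.continuous.continuousAt.eventually_mem
      (Ioi_mem_nhds (by rw [h1.2.2.2.2.2.2.1]; norm_num))
  replace hσh := fun x (hx : x ∈ T) => hσh x (hTB x hx)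
  have hne : ∀ x ∈ T, σ x ≠ t₁ := fun x hx heq => (hσh x hx).2.1 (heq ▸ hTB x hx)
  have hsupp : ∀ x ∈ T, IsCompact (tsupport (h x)) := fun x hx => (hσh x hx).2.2.2.1
  have hsumc : Continuous fun y => ∑ x ∈ T, h x y :=
    continuous_finsetSum _ fun x hx => (hσh x hx).2.2.1.continuous
  have hsum : ∀ y, ∑ x ∈ T, h x y ≤ 1 / 2 → y ∉ maxset (H t₁) := by
    intro y hy hyB
    obtain ⟨x, hx, hxy⟩ := mem_iUnion₂.1 (hT hyB)
    have h1 := Finset.single_le_sum (f := fun x => h x y) (fun x hx => (hσh x hx).2.2.2.2.1 y) hx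
    have h2 : 1 / 2 < h x y := hxy
    linarith
  have ev1 : ∀ᶠ r in 𝓝[>] (0 : ℝ), t₁ + r < 1 := by
    filter_upwards [Ioo_mem_nhdsGT (sub_pos.2 ht₁.2)] with r hr
    linarith [hr.2]
  have ev2 : ∀ᶠ r in 𝓝[>] (0 : ℝ), ∀ x ∈ T, σ x + r < 1 ∧ 2 * r < |σ x - t₁| ∧
      ∀ t ∈ Icc (0 : ℝ) 1, |t - σ x| ≤ r → ∀ y ∈ tsupport (h x), H t y ≤ (⨆ y, H t y) - r := by
    rw [Filter.eventually_all_finset]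
    intro x hx
    have hs' := Ioo_subset_Icc_self (hσh x hx).1
    filter_upwards [Ioo_mem_nhdsGT (sub_pos.2 (hσh x hx).1.2),
      Ioo_mem_nhdsGT (half_pos (abs_pos.2 (sub_ne_zero.2 (hne x hx)))),
      hH.eventually_gap hs' (exists_gap_of_isCompact (hH.contMDiff hs').continuous
        (bddAbove_range_of_abs_le (hC _ hs')) (hsupp x hx)
        fun y hy => ((hσh x hx).2.2.2.2.2.2.2 y hy).1)] with r hr1 hr2 hr3
    exact ⟨by linarith [hr1.2], by linarith [hr2.2], hr3⟩
  have hK : IsCompact (⋃ x ∈ T, tsupport (h x)) := T.isCompact_biUnion hsupp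
  have ev3 := hH.eventually_gap' ht₁' (exists_gap_of_isCompact' (hH.contMDiff ht₁').continuous
    (bddBelow_range_of_abs_le (hC _ ht₁')) hK fun y hy => by
      obtain ⟨x, hx, hxy⟩ := mem_iUnion₂.1 hy
      exact ((hσh x hx).2.2.2.2.2.2.2 y hxy).2)
  -- The set where the bumps sum to at most `1/2` is closed and misses the maximum set, but need not
  -- be compact; hence the gap is taken from `hgap`.
  have ev4 := hH.eventually_gap ht₁' (hgap {y | ∑ x ∈ T, h x y ≤ 1 / 2}
    (isClosed_le hsumc continuous_const) hsum)
  have ev0 : ∀ᶠ r in 𝓝[>] (0 : ℝ), 0 < r := self_mem_nhdsWithin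
  obtain ⟨r, hr0, hr1, hr2, hr3, hr4⟩ :=
    (ev0.and (ev1.and (ev2.and (ev3.and ev4)))).exists
  refine ⟨t₁, ht₁, T, σ, h, fun x hx => ⟨(hσh x hx).1, hne x hx, (hσh x hx).2.2.1,
    (hσh x hx).2.2.2.2.1, (hσh x hx).2.2.2.2.2.1⟩, r, hr0, hr1, _, hK, fun x hx =>
    ⟨(hr2 x hx).1, (hr2 x hx).2.1, fun y hy => ?_, fun t ht htr y hy =>
      (hr2 x hx).2.2 t ht htr y (subset_tsupport _ hy)⟩,
    fun t ht htr => ⟨hr3 t ht htr, hr4 t ht htr⟩⟩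
  by_contra hne0
  exact hy (mem_iUnion₂.2 ⟨x, hx, subset_tsupport _ hne0⟩)

/-- If there is no fixed maximum, some tangent field decreases the length to first order. -/
theorem exists_shortening_field (hH : IsCompactlySupportedFamily E H)
    (hno : ¬ (⋂ t ∈ Icc (0 : ℝ) 1, maxset (H t)).Nonempty) :
    ∃ G, IsTangentField E G ∧ ∃ ε₀ > 0, ∀ ε ∈ Ioo 0 ε₀,
      ∫ t in (0 : ℝ)..1, totvar (fun x => H t x + ε * timeDeriv G t x) ≤
        (∫ t in (0 : ℝ)..1, totvar (H t)) - 1 / 2 * ε := by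
  obtain ⟨C, hC⟩ := hH.exists_bound
  obtain ⟨t₁, ht₁, T, σ, h, hσh, r, hr, htr, K, hK, hTr, ht₁r⟩ := exists_bump_family hH hno
  obtain ⟨θ₁, ρ₁, hθ₁, hρ₁, hd₁, hn₁, hs₁, hz₁, ho₁⟩ := exists_smooth_step ht₁.1 hr htr
  have hex : ∀ x, ∃ θ ρ : ℝ → ℝ, x ∈ T → ContDiff ℝ ∞ θ ∧ Continuous ρ ∧
      (∀ t, HasDerivAt θ (ρ t) t) ∧ (∀ t, 0 ≤ ρ t) ∧ (∀ t, ρ t ≠ 0 → |t - σ x| ≤ r) ∧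
      θ 0 = 0 ∧ θ 1 = 1 := by
    intro x
    by_cases hx : x ∈ T
    · obtain ⟨θ, ρ, hθ⟩ := exists_smooth_step (hσh x hx).1.1 hr (hTr x hx).1
      exact ⟨θ, ρ, fun _ => hθ⟩
    · exact ⟨0, 0, fun h => absurd h hx⟩
  choose θ ρ hθρ using hex
  -- The difference of two steps vanishes at both ends; its derivative removes `h x` near `t₁` and
  -- restores it near `σ x`.
  set G : ℝ → M → ℝ := fun t y => ∑ x ∈ T, (θ x t - θ₁ t) * h x y with hGdef
  have hG : IsTangentField E G := by
    refine ⟨⟨?_, K, hK, fun t ht y hy => ?_⟩, ?_, ?_⟩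
    · refine contMDiffOn_finsetSum fun x hx => ContMDiffOn.mul ?_ ?_
      · exact (((hθρ x hx).1.sub hθ₁).contMDiff.comp contMDiff_fst).contMDiffOn
      · exact ((hσh x hx).2.2.1.comp contMDiff_snd).contMDiffOn
    · exact Finset.sum_eq_zero fun x hx => by rw [(hTr x hx).2.2.1 y hy, mul_zero]
    · ext y
      exact Finset.sum_eq_zero fun x hx => by rw [(hθρ x hx).2.2.2.2.2.1, hz₁, sub_zero, zero_mul]
    · ext y
      exact Finset.sum_eq_zero fun x hx => by rw [(hθρ x hx).2.2.2.2.2.2, ho₁, sub_self, zero_mul]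
  have hder : ∀ t ∈ Icc (0 : ℝ) 1, ∀ y, timeDeriv G t y = ∑ x ∈ T, (ρ x t - ρ₁ t) * h x y := by
    intro t ht y
    have h1 : HasDerivAt (fun τ => G τ y) (∑ x ∈ T, (ρ x t - ρ₁ t) * h x y) t :=
      HasDerivAt.fun_sum fun x hx => (((hθρ x hx).2.2.1 t).sub (hd₁ t)).mul_const _
    exact h1.hasDerivWithinAt.derivWithin (uniqueDiffOn_Icc one_pos t ht)
  obtain ⟨R, hR⟩ := isCompact_Icc.exists_bound_of_continuousOn (s := Icc (0 : ℝ) 1)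
    (f := fun t => (∑ x ∈ T, ρ x t) + ρ₁ t)
    ((continuous_finsetSum _ fun x hx => (hθρ x hx).2.1).add hρ₁).continuousOn
  have hR0 : ∀ t ∈ Icc (0 : ℝ) 1, ∑ x ∈ T, ρ x t ≤ R ∧ ρ₁ t ≤ R := by
    intro t ht
    have h1 := (le_abs_self _).trans (hR t ht)
    have h2 : 0 ≤ ∑ x ∈ T, ρ x t := Finset.sum_nonneg fun x hx => (hθρ x hx).2.2.2.1 t
    constructor <;> linarith [hn₁ t]
  have hRnn : 0 ≤ R := (hn₁ 0).trans (hR0 0 ⟨le_rfl, zero_le_one⟩).2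
  have hsum0 : ∀ y, 0 ≤ ∑ x ∈ T, h x y := fun y =>
    Finset.sum_nonneg fun x hx => (hσh x hx).2.2.2.1 y
  have hsum1 : ∀ y, ∑ x ∈ T, h x y ≤ T.card := fun y => by
    have h1 := Finset.sum_le_sum (f := fun x => h x y) (g := fun _ => (1 : ℝ))
      fun x hx => (hσh x hx).2.2.2.2 y
    simpa using h1
  -- This `ε₀` keeps `ε |∂_t G|` below the gap `r`, with `R` bounding the step speeds and `T.card`
  -- the sum of the bumps.
  refine ⟨G, hG, r / ((T.card + 1) * (R + 1)), by positivity, fun ε hε => ?_⟩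
  obtain ⟨hε0, hε1⟩ := hε
  have hεr : ε * ((T.card + 1) * (R + 1)) < r := by rwa [lt_div_iff₀ (by positivity)] at hε1
  have hpoint : ∀ t ∈ Icc (0 : ℝ) 1, totvar (fun x => H t x + ε * timeDeriv G t x) ≤
      totvar (H t) - ε / 2 * ρ₁ t := by
    intro t ht
    have hba := bddAbove_range_of_abs_le (hC t ht)
    have hbb := bddBelow_range_of_abs_le (hC t ht)
    obtain ⟨hRt, hRt₁⟩ := hR0 t ht
    have hn : (0 : ℝ) ≤ T.card := Nat.cast_nonneg _
    -- Away from the step at `t₁` the increment is nonnegative and lives where `H` is at least `r`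
    -- below its supremum, so neither extremum moves the wrong way.
    by_cases hρt : ρ₁ t = 0
    · have hnn : ∀ y, 0 ≤ timeDeriv G t y := fun y => by
        rw [hder t ht, hρt]
        exact Finset.sum_nonneg fun x hx => by
          rw [sub_zero]; exact mul_nonneg ((hθρ x hx).2.2.2.1 t) ((hσh x hx).2.2.2.1 y)
      have hle : ∀ y, timeDeriv G t y ≤ R := fun y => by
        rw [hder t ht, hρt]
        refine le_trans (Finset.sum_le_sum fun x hx => ?_) hRt
        rw [sub_zero]
        exact mul_le_of_le_one_right ((hθρ x hx).2.2.2.1 t) ((hσh x hx).2.2.2.2 y)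
      have h1 : (⨆ y, (H t y + ε * timeDeriv G t y)) ≤ ⨆ y, H t y := by
        refine ciSup_le fun y => ?_
        by_cases hy : timeDeriv G t y = 0
        · rw [hy, mul_zero, add_zero]; exact le_ciSup hba y
        · rw [hder t ht, hρt] at hy
          obtain ⟨x, hx, hxy⟩ := Finset.exists_ne_zero_of_sum_ne_zero hy
          rw [sub_zero] at hxy
          have h2 := (hTr x hx).2.2.2 t ht
            ((hθρ x hx).2.2.2.2.1 t (left_ne_zero_of_mul hxy)) y (right_ne_zero_of_mul hxy)
          have h3 : ε * timeDeriv G t y ≤ ε * ((T.card + 1) * (R + 1)) :=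
            mul_le_mul_of_nonneg_left (by nlinarith [hle y]) hε0.le
          linarith
      have h2 : (⨅ y, H t y) ≤ ⨅ y, (H t y + ε * timeDeriv G t y) := le_ciInf fun y => by
        have h3 := ciInf_le hbb y
        have h4 := mul_nonneg hε0.le (hnn y)
        linarith
      rw [hρt, mul_zero, sub_zero]
      exact sub_le_sub h1 h2
    · have ht₁t := hs₁ t hρt
      -- The window at `t₁` is disjoint from each window at `σ x`, since `2 r < |σ x - t₁|`.
      have hρx : ∀ x ∈ T, ρ x t = 0 := by
        intro x hx
        by_contra hne
        have h1 := (hθρ x hx).2.2.2.2.1 t hne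
        have h2 := (hTr x hx).2.1
        have h3 : |σ x - t₁| ≤ |t - σ x| + |t - t₁| := by
          rw [← abs_sub_comm (σ x) t]
          exact abs_sub_le (σ x) t t₁
        linarith
      have hdt : ∀ y, timeDeriv G t y = -(ρ₁ t * ∑ x ∈ T, h x y) := fun y => by
        rw [hder t ht, Finset.mul_sum, ← Finset.sum_neg_distrib]
        exact Finset.sum_congr rfl fun x hx => by rw [hρx x hx]; ring
      have hερ : 0 ≤ ε * ρ₁ t := mul_nonneg hε0.le (hn₁ t)
      have hερr : ε * ρ₁ t * (T.card + 1) ≤ r := by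
        have h3 : ε * (ρ₁ t * (T.card + 1)) ≤ ε * ((T.card + 1) * (R + 1)) :=
          mul_le_mul_of_nonneg_left (by nlinarith) hε0.le
        rw [mul_assoc]
        linarith
      have h1 : (⨆ y, (H t y + ε * timeDeriv G t y)) ≤ (⨆ y, H t y) - ε / 2 * ρ₁ t := by
        refine ciSup_le fun y => ?_
        rw [hdt]
        -- Either the gap already exceeds the required drop, or the bumps sum to more than `1/2` and
        -- `H` is lowered by at least `ε ρ₁ / 2`.
        by_cases hy : ∑ x ∈ T, h x y ≤ 1 / 2
        · have h2 := (ht₁r t ht ht₁t).2 y hy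
          have h3 : 0 ≤ ε * ρ₁ t * ∑ x ∈ T, h x y := mul_nonneg hερ (hsum0 y)
          nlinarith
        · have h2 := le_ciSup hba y
          have h3 : ε * ρ₁ t * (1 / 2) ≤ ε * ρ₁ t * ∑ x ∈ T, h x y :=
            mul_le_mul_of_nonneg_left (not_le.1 hy).le hερ
          linarith
      have h2 : (⨅ y, H t y) ≤ ⨅ y, (H t y + ε * timeDeriv G t y) := by
        refine le_ciInf fun y => ?_
        rw [hdt]
        by_cases hy : y ∈ K
        · have h3 := (ht₁r t ht ht₁t).1 y hy
          have h4 : ε * ρ₁ t * ∑ x ∈ T, h x y ≤ ε * ρ₁ t * (T.card + 1) :=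
            mul_le_mul_of_nonneg_left (by linarith [hsum1 y]) hερ
          linarith
        · rw [Finset.sum_eq_zero fun x hx => (hTr x hx).2.2.1 y hy]
          simpa using ciInf_le hbb y
      simp only [totvar]
      linarith
  have hfam : IsCompactlySupportedFamily E (fun t x => H t x + ε * timeDeriv G t x) :=
    hH.add (hG.1.timeDeriv.const_mul ε)
  have hcρ : ContinuousOn (fun t => ε / 2 * ρ₁ t) (Icc 0 1) :=
    (continuous_const.mul hρ₁).continuousOn
  have hcs : ContinuousOn (fun t => totvar (H t) - ε / 2 * ρ₁ t) (Icc 0 1) :=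
    hH.continuousOn_totvar.sub hcρ
  have hint := intervalIntegral.integral_mono_on zero_le_one
    (intervalIntegrable_zero_one hfam.continuousOn_totvar)
    (intervalIntegrable_zero_one hcs) hpoint
  -- The step `ρ₁` has integral `θ₁ 1 - θ₁ 0 = 1`, whence the rate `1/2`.
  rw [intervalIntegral.integral_sub (intervalIntegrable_zero_one hH.continuousOn_totvar)
    (intervalIntegrable_zero_one hcρ), intervalIntegral.integral_const_mul,
    intervalIntegral.integral_eq_sub_of_hasDerivAt (fun t _ => hd₁ t)
      (hρ₁.intervalIntegrable _ _), hz₁, ho₁] at hint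
  linarith

end ShorteningFieldConstruction

theorem mainTheorem4 {E : Type*} [NormedAddCommGroup E] [NormedSpace ℝ E] [FiniteDimensional ℝ E]
    {M : Type*} [TopologicalSpace M] [ChartedSpace E M] [IsManifold 𝓘(ℝ, E) ∞ M]
    [T2Space M] [SecondCountableTopology M] [ConnectedSpace M]
    (Ω : SymplecticForm E M) (φ : ℝ → M → M) (H : ℝ → M → ℝ)
    (hφ₀ : φ 0 ∈ hamGroup Ω) (hφ : Generates Ω H φ) :
    IsLCritical Ω φ ↔
      (⋂ t ∈ Icc (0 : ℝ) 1, minset (H t)).Nonempty ∧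
        (⋂ t ∈ Icc (0 : ℝ) 1, maxset (H t)).Nonempty := by
  constructor
  · intro hcrit
    constructor
    · by_contra hno
      have hneg : ∀ t, maxset (fun x => -1 * H t x) = minset (H t) := by
        intro t
        ext x
        simp [maxset, minset]
      -- A field `G` that shortens `-H` gives the field `-G` for `H`, because `totvar` is even.
      obtain ⟨G, hG, ε₀, hε₀, h⟩ := exists_shortening_field (hφ.1.const_mul (-1))
        (by simpa only [hneg] using hno)
      have hG' : IsTangentField E (fun t x => -1 * G t x) :=
        ⟨hG.1.const_mul (-1), by ext x; simp [hG.2.1], by ext x; simp [hG.2.2]⟩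
      have hder : ∀ t ∈ Icc (0 : ℝ) 1, ∀ x, timeDeriv (fun t x => -1 * G t x) t x =
          -1 * timeDeriv G t x := fun t ht x =>
        ((hG.1.hasDerivWithinAt ht x).const_mul (-1)).derivWithin (uniqueDiffOn_Icc one_pos t ht)
      refine hφ.not_isLCritical_of_decreasing hφ₀ hG' one_half_pos hε₀ (fun ε hε => ?_) hcrit
      have h1 : ∀ t ∈ Icc (0 : ℝ) 1,
          totvar (fun x => H t x + ε * timeDeriv (fun t x => -1 * G t x) t x) =
          totvar (fun x => -1 * H t x + ε * timeDeriv G t x) := by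
        intro t ht
        rw [← totvar_neg]
        congr 1
        ext x
        rw [hder t ht x]
        ring
      have h2 : ∀ t, totvar (fun x => -1 * H t x) = totvar (H t) := by
        intro t
        rw [← totvar_neg]
        simp
      rw [intervalIntegral.integral_congr fun t ht => h1 t (by rwa [uIcc_of_le zero_le_one] at ht)]
      simpa only [h2] using h ε hε
    · by_contra hno
      obtain ⟨G, hG, ε₀, hε₀, h⟩ := exists_shortening_field hφ.1 hno
      exact hφ.not_isLCritical_of_decreasing hφ₀ hG one_half_pos hε₀ h hcrit
  · rintro ⟨⟨p, hp⟩, ⟨P, hP⟩⟩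
    exact hφ.isLCritical_of_fixed hφ₀ (mem_iInter₂.1 hp) (mem_iInter₂.1 hP)
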